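/- **Setting.** Let $(E,d)$ be a locally compact separable metric space and $\mu$ a positive Borel measure on $E$ with full support that is finite on compact sets. Let $(T_t)_{t>0}$ be a sub-Markovian $C_0$-semigroup of contractions on $L^2(E,\mu)$ (for example the semigroup of a generalized Dirichlet form) and $(\widehat T_t)_{t>0}$ its adjoint semigroup. For $f\ge 0$ in $L^\infty(E,\mu)$ put $T_tf=\lim_k T_tf_k$ for $f_k\in L^2\cap L^\infty$, $f_k\nearrow f$ $\mu$-a.e.; $(T_t)$ is called conservative if $T_t1=1$ $\mu$-a.e. for every $t>0$ (equivalently, for some $t>0$). The support $\mathrm{supp}(u)$ of a function $u$ is the support of the measure $|u|\,d\mu$. For a space $W$ of functions, $W_b$ denotes its $\mu$-a.e. bounded elements, $W_{0,b}$ those that moreover have compact support, and $W_{loc}$ the functions that on each relatively compact open set agree $\mu$-a.e. with an element of $W$. Let $(\mathcal E^0,D(\mathcal E^0))$ be a symmetric, regular, strongly local Dirichlet form on $L^2(E,\mu)$ (strongly local: $\mathcal E^0(u,v)=0$ whenever $u$ is constant on a neighbourhood of $\mathrm{supp}(v)$) given by a carré du champ: $\Gamma:D(\mathcal E^0)\times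 D(\mathcal E^0)\to L^1(E,\mu)$ is bilinear, symmetric and positive semidefinite, $\mathcal E^0(u,v)=\int_E\Gamma(u,v)\,d\mu$, and $2\int_E f\,\Gamma(u,u)\,d\mu=2\mathcal E^0(u,fu)-\mathcal E^0(u^2,f)$ for $u\in D(\mathcal E^0)_b$, $f\in D(\mathcal E^0)\cap C_b(E)$. Let $(N,D(N))$ be a linear operator on $L^2(E,\mu)$ with $D(\mathcal E^0)_b\subset D(N)$ and $Nv\in L^1(E,\mu)_{loc}$ for $v\in D(\mathcal E^0)_b$, such that * if $v\in D(\mathcal E^0)_b$ is $\mu$-a.e. constant on a Borel set $B$, then $Nv=0$ $\mu$-a.e. on $B$; * $\int_E Nv\,d\mu=0$ for $v\in D(\mathcal E^0)_{0,b}$; * $N(uv)=vNu+uNv$ for $u,v\in D(\mathcal E^0)_b$, and $N\eta(v)=\eta'(v)Nv$ for $v\in D(\mathcal E^0)_b$ and $\eta\in C_b^1(\mathbb R)$ with $\eta(v)\in D(\mathcal E^0)_b$. (H3) Let $\rho\ge 0$ be a continuous function on $E$ with $\rho\in D(\mathcal E^0)_{loc}$ such that $E_r=\{\rho<r\}$ is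 relatively compact for every $r>0$. Define $\Gamma(\rho,\rho)$ and $N(\rho)$ locally, i.e. as $\Gamma(w,w)$ and $Nw$ on $E_m$ for any $w\in D(\mathcal E^0)_b$ with $w=\rho$ $\mu$-a.e. on $E_m$, $m\ge1$. Assume that for some compact $K_0\subset E$ the functions $\Gamma(\rho,\rho)$ and $N(\rho)$ are $\mu$-essentially bounded on every compact subset of $K_0^c$. Put $V_n=E_{4n}$, $n\ge 1$, and fix $t>0$. (H1) For $p=1$ or $p=2$ there are sub-Markovian $C_0$-semigroups of contractions $(\widehat T^n_s)_{s>0}$ on $L^p(V_n,\mu)$, $n\ge1$, with generators $(\widehat L^n,D(\widehat L^n))$, such that for every non-negative $f\in L^1(E,\mu)\cap L^\infty(E,\mu)$, writing $\widehat T^n_tf:=\widehat T^n_t(f1_{V_n})$ and extending by $0$, $\widehat T^n_tf\nearrow\widehat T_tf$ $\mu$-a.e. as $n\to\infty$. (H2) For every $n\ge1$, each bounded $v\in D(\widehat L^n)$, extended by $0$ outside $V_n$, lies in $D(\mathcal E^0)_b$, and $$-\int_{V_n}\widehat L^nv\,u\,d\mu=\int_E\Gamma(u,v)\,d\mu+\int_{V_n}u\,Nv\,d\mu$$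 for every $u\in D(\mathcal E^0)_b$ with $u=0$ $\mu$-a.e. outside $V_n$. Fix a compact $K\supset K_0$. For $f$ with compact support let $k_f=\min\{m\in\mathbb N: m\ge 1,\ \mathrm{supp}(f)\subset E_m,\ K\subset E_m\}$, and let $D_0$ be the set of all $f\in L^\infty(E,\mu)\cap L^2(E,\mu)$ with compact support such that $\widehat T^n_sf\in D(\widehat L^n)$ for all $n\ge k_f$ and $s\in(0,t]$. For an increasing (that is, nondecreasing) $\phi\in C^1([0,\infty))$ with $\phi(0)=0$ and $\phi(r)\to\infty$ as $r\to\infty$ put $$c_n(f)=\operatorname*{ess\,sup}_{E_{4n}\setminus E_{k_f}}\left|\phi'(\rho)^2\Gamma(\rho,\rho)+\phi'(\rho)N(\rho)\right|,\quad a_n=\operatorname*{ess\,sup}_{E_{4n}\setminus E_{2n}}\Gamma(\rho,\rho),\quad b_n=\operatorname*{ess\,sup}_{E_{4n}\setminus E_{2n}}\phi'(\rho)\Gamma(\rho,\rho),$$ $$\widehat A_n(\phi)=(\sqrt{a_n}+b_n)\,\mu(E_{4n}\setminus E_{2n})^{1/2}+\|N(\rho)\|_{L^2(E_{4n}\setminus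 E_{2n},\mu)}$$ (an essential supremum over a null set is $0$), and say that $(f,\phi,T)$, with $T>0$, satisfies $(*)$ if $$\limsup_{n\to\infty}\frac{e^{-\phi(2n)+c_n(f)T}}{n}\,\widehat A_n(\phi)=0.$$ **Theorem.** (i) If $f\in D_0$ and $(f,\phi,T)$ satisfies $(*)$ for some such $\phi$ and some $T>0$, then $\widehat T_tf\in L^1(E,\mu)$ and $\int_E\widehat T_tf\,d\mu=\int_Ef\,d\mu$. (ii) If $(*)$ holds for at least one such triple $(f,\phi,T)$ with $f\in D_0$, then it holds for $(g,\phi,T)$ for every $g\in D_0$. In particular, if in addition $D_0$ is dense in $L^1(E,\mu)$, then $(T_t)_{t>0}$ is conservative. -/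

import Mathlib

open MeasureTheory Filter Topology Set
open scoped ENNReal

noncomputable section

namespace DivFreePerturbation

/-! ## Functions -/

section Functions

variable {E : Type*} [TopologicalSpace E] [MeasurableSpace E]

/-- `u` is bounded `μ`-a.e. -/
def EssBdd (μ : Measure E) (u : E → ℝ) : Prop :=
  ∃ C : ℝ, ∀ᵐ x ∂μ, |u x| ≤ C

/-- The support of a function: the support of the measure `|u| dμ`. -/
def supp (μ : Measure E) (u : E → ℝ) : Set E :=
  (μ.withDensity fun x => ‖u x‖ₑ).support

/-- `g ∈ L^∞_loc(Oᶜ, μ)` for the closed set `O`: essentially bounded on every compact set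
that does not meet `O`. -/
def LocEssBddOff (μ : Measure E) (O : Set E) (g : E → ℝ) : Prop :=
  ∀ F : Set E, IsCompact F → F ⊆ Oᶜ → EssBdd (μ.restrict F) g

/-- The sublevel set `E_r = {ρ < r}`. -/
def sublevel (ρ : E → ℝ) (r : ℝ) : Set E := {x | ρ x < r}

/-- The exhausting sets `V_n = E_{4n}`. -/
def V (ρ : E → ℝ) (n : ℕ) : Set E := sublevel ρ (4 * n)

/-- The annulus `E_{4n} \ E_{2n}`. -/
def annulus (ρ : E → ℝ) (n : ℕ) : Set E := sublevel ρ (4 * n) \ sublevel ρ (2 * n)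

open Classical in
/-- The class in `L^p(W, μ)` of the function `f · 1_W` (for `f` that is `p`-integrable on `W`). -/
def restrictLp (μ : Measure E) (p : ℝ≥0∞) (W : Set E) (f : E → ℝ) : Lp ℝ p (μ.restrict W) :=
  if h : MemLp f p (μ.restrict W) then h.toLp f else 0

end Functions

/-! ## Semigroups -/

section Semigroups

/-- `C₀`-semigroups of contractions on a Banach space, indexed by `t ≥ 0`
(the values of `S` at negative times are irrelevant). -/
structure IsC0ContractionSemigroup {X : Type*} [NormedAddCommGroup X] [NormedSpace ℝ X]
    (S : ℝ → X →L[ℝ] X) : Prop where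
  zero : S 0 = ContinuousLinearMap.id ℝ X
  add : ∀ s t : ℝ, 0 ≤ s → 0 ≤ t → S (s + t) = (S s).comp (S t)
  contraction : ∀ t : ℝ, 0 ≤ t → ∀ x : X, ‖S t x‖ ≤ ‖x‖
  strongly_continuous : ∀ x : X, Tendsto (fun t => S t x) (𝓝[>] 0) (𝓝 x)

/-- `x` lies in the domain of the generator of `S`, which maps `x` to `y`. -/
def GeneratorMaps {X : Type*} [NormedAddCommGroup X] [NormedSpace ℝ X]
    (S : ℝ → X →L[ℝ] X) (x y : X) : Prop :=
  Tendsto (fun h : ℝ => h⁻¹ • (S h x - x)) (𝓝[>] 0) (𝓝 y)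

variable {E : Type*} [MeasurableSpace E]

/-- `0 ≤ f ≤ 1` a.e. implies `0 ≤ A f ≤ 1` a.e. -/
def IsSubMarkovian {ν : Measure E} {p : ℝ≥0∞} [Fact (1 ≤ p)]
    (A : Lp ℝ p ν →L[ℝ] Lp ℝ p ν) : Prop :=
  ∀ f : Lp ℝ p ν, (∀ᵐ x ∂ν, 0 ≤ f x ∧ f x ≤ 1) → ∀ᵐ x ∂ν, 0 ≤ A f x ∧ A f x ≤ 1

/-- `A f = g` for the monotone extension of an operator `A` on `L²` to a non-negative
`f ∈ L^∞`: whenever `f_k ∈ L² ∩ L^∞` increases to `f` a.e., then `A f_k → g` a.e. -/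
def MonotoneExtensionMaps {μ : Measure E} (A : Lp ℝ 2 μ →L[ℝ] Lp ℝ 2 μ) (f g : E → ℝ) : Prop :=
  ∀ F : ℕ → Lp ℝ 2 μ, (∀ k, ∃ C : ℝ, ∀ᵐ x ∂μ, |F k x| ≤ C) →
    (∀ᵐ x ∂μ, Monotone (fun k => F k x) ∧ Tendsto (fun k => F k x) atTop (𝓝 (f x))) →
    ∀ᵐ x ∂μ, Tendsto (fun k => A (F k) x) atTop (𝓝 (g x))

/-- `T_t 1 = 1` a.e. for every `t > 0`. -/
def Conservative {μ : Measure E} (T : ℝ → Lp ℝ 2 μ →L[ℝ] Lp ℝ 2 μ) : Prop :=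
  ∀ t : ℝ, 0 < t → MonotoneExtensionMaps (T t) (fun _ => 1) (fun _ => 1)

/-- The adjoint semigroup on `L²`. -/
def adj {μ : Measure E} (T : ℝ → Lp ℝ 2 μ →L[ℝ] Lp ℝ 2 μ) (t : ℝ) : Lp ℝ 2 μ →L[ℝ] Lp ℝ 2 μ :=
  ContinuousLinearMap.adjoint (T t)

end Semigroups

/-! ## Symmetric Dirichlet forms -/

section Forms

variable {E : Type*} [TopologicalSpace E] [MeasurableSpace E]

/-- Symmetric Dirichlet forms on `L²(E, μ)`: densely defined, closed, Markovian. -/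
structure SymmDirichletForm (μ : Measure E) where
  dom : Submodule ℝ (Lp ℝ 2 μ)
  form : dom →ₗ[ℝ] dom →ₗ[ℝ] ℝ
  dense_dom : Dense (dom : Set (Lp ℝ 2 μ))
  symm : ∀ u v : dom, form u v = form v u
  nonneg : ∀ u : dom, 0 ≤ form u u
  closed : ∀ u : ℕ → dom,
    (∀ ε : ℝ, 0 < ε → ∃ M : ℕ, ∀ m ≥ M, ∀ k ≥ M,
      form (u m - u k) (u m - u k) + ‖((u m - u k : dom) : Lp ℝ 2 μ)‖ ^ 2 < ε) →
    ∃ v : dom, Tendsto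
      (fun k => form (u k - v) (u k - v) + ‖((u k - v : dom) : Lp ℝ 2 μ)‖ ^ 2) atTop (𝓝 0)
  markov : ∀ u : dom, ∃ v : dom,
    (∀ᵐ x ∂μ, (v : Lp ℝ 2 μ) x = min (max ((u : Lp ℝ 2 μ) x) 0) 1) ∧ form v v ≤ form u u

namespace SymmDirichletForm

variable {μ : Measure E} (𝓔 : SymmDirichletForm μ)

/-- `u ∈ D(𝓔)_b`. -/
def MemBdd (u : Lp ℝ 2 μ) : Prop := u ∈ 𝓔.dom ∧ EssBdd μ u

/-- `u ∈ D(𝓔)_loc`: on every relatively compact open set, `u` agrees a.e. with an element of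
`D(𝓔)`. -/
def MemLoc (u : E → ℝ) : Prop :=
  ∀ W : Set E, IsOpen W → IsCompact (closure W) →
    ∃ w : Lp ℝ 2 μ, w ∈ 𝓔.dom ∧ w =ᵐ[μ.restrict W] u

/-- Regularity: `D(𝓔) ∩ C_0(E)` (continuous functions of compact support) is dense in `D(𝓔)` for
the norm of `𝓔_1` and in `C_0(E)` for the uniform norm. -/
structure IsRegular : Prop where
  dense_form : ∀ u : 𝓔.dom, ∀ ε : ℝ, 0 < ε → ∃ (w : 𝓔.dom) (g : E → ℝ),
    Continuous g ∧ HasCompactSupport g ∧ ((w : Lp ℝ 2 μ) : E → ℝ) =ᵐ[μ] g ∧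
    𝓔.form (u - w) (u - w) + ‖((u - w : 𝓔.dom) : Lp ℝ 2 μ)‖ ^ 2 < ε
  dense_unif : ∀ h : E → ℝ, Continuous h → HasCompactSupport h → ∀ ε : ℝ, 0 < ε →
    ∃ (w : 𝓔.dom) (g : E → ℝ), Continuous g ∧ HasCompactSupport g ∧
      ((w : Lp ℝ 2 μ) : E → ℝ) =ᵐ[μ] g ∧ ∀ x, |h x - g x| < ε

/-- Strong locality: `𝓔(u, v) = 0` whenever `u` is constant on a neighbourhood of `supp v`. -/
def IsStronglyLocal : Prop :=
  ∀ (u v : 𝓔.dom) (c : ℝ) (U : Set E), IsOpen U → supp μ (v : Lp ℝ 2 μ) ⊆ U →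
    (∀ᵐ x ∂μ.restrict U, (u : Lp ℝ 2 μ) x = c) → 𝓔.form u v = 0

/-- A carré du champ of `𝓔`: a positive semidefinite symmetric bilinear `Γ : D(𝓔) × D(𝓔) → L¹`
with `𝓔(u, v) = ∫ Γ(u, v) dμ` and such that `2 Γ(u, u) dμ` is the energy measure of `u`, i.e.
`2 ∫ f Γ(u, u) dμ = 2 𝓔(u, f u) - 𝓔(u², f)` for `u ∈ D(𝓔)_b` and `f ∈ D(𝓔) ∩ C_b(E)`
(where `u²` and `f u` are in `D(𝓔)`). -/
structure CarreDuChamp where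
  gamma : 𝓔.dom →ₗ[ℝ] 𝓔.dom →ₗ[ℝ] Lp ℝ 1 μ
  symm : ∀ u v : 𝓔.dom, gamma u v = gamma v u
  nonneg : ∀ u : 𝓔.dom, ∀ᵐ x ∂μ, 0 ≤ gamma u u x
  form_eq : ∀ u v : 𝓔.dom, 𝓔.form u v = ∫ x, gamma u v x ∂μ
  energy : ∀ (u w usq fu : 𝓔.dom) (f : E → ℝ), EssBdd μ (u : Lp ℝ 2 μ) →
    Continuous f → (∃ C : ℝ, ∀ x, |f x| ≤ C) → ((w : Lp ℝ 2 μ) : E → ℝ) =ᵐ[μ] f →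
    (∀ᵐ x ∂μ, (usq : Lp ℝ 2 μ) x = (u : Lp ℝ 2 μ) x ^ 2) →
    (∀ᵐ x ∂μ, (fu : Lp ℝ 2 μ) x = f x * (u : Lp ℝ 2 μ) x) →
    2 * ∫ x, f x * gamma u u x ∂μ = 2 * 𝓔.form u fu - 𝓔.form usq w

/-- The conditions on the first order perturbation `N`, a linear operator on `L²(E, μ)` with
`D(𝓔)_b ⊆ D(N)` and with values in `L¹(E, μ)_loc`: it is local, it is divergence free, and it
satisfies the chain rule and the Leibniz rule on `D(𝓔)_b`. -/
structure IsDivFreeDerivation (N : Lp ℝ 2 μ →ₗ.[ℝ] (E →ₘ[μ] ℝ)) : Prop where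
  dom_le : ∀ u : Lp ℝ 2 μ, 𝓔.MemBdd u → u ∈ N.domain
  loc_integrable : ∀ v : N.domain, 𝓔.MemBdd v → ∀ W : Set E, IsOpen W → IsCompact (closure W) →
    IntegrableOn (N v) W μ
  isLocal : ∀ v : N.domain, 𝓔.MemBdd v → ∀ (c : ℝ) (B : Set E), MeasurableSet B →
    (∀ᵐ x ∂μ.restrict B, (v : Lp ℝ 2 μ) x = c) → ∀ᵐ x ∂μ.restrict B, N v x = 0
  divFree : ∀ v : N.domain, 𝓔.MemBdd v → IsCompact (supp μ (v : Lp ℝ 2 μ)) → ∫ x, N v x ∂μ = 0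
  chain : ∀ v w : N.domain, 𝓔.MemBdd v → 𝓔.MemBdd w → ∀ φ : ℝ → ℝ, ContDiff ℝ 1 φ →
    (∃ C : ℝ, ∀ r, |φ r| ≤ C ∧ |deriv φ r| ≤ C) →
    (∀ᵐ x ∂μ, (w : Lp ℝ 2 μ) x = φ ((v : Lp ℝ 2 μ) x)) →
    ∀ᵐ x ∂μ, N w x = deriv φ ((v : Lp ℝ 2 μ) x) * N v x
  leibniz : ∀ u v w : N.domain, 𝓔.MemBdd u → 𝓔.MemBdd v → 𝓔.MemBdd w →
    (∀ᵐ x ∂μ, (w : Lp ℝ 2 μ) x = (u : Lp ℝ 2 μ) x * (v : Lp ℝ 2 μ) x) →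
    ∀ᵐ x ∂μ, N w x = (v : Lp ℝ 2 μ) x * N u x + (u : Lp ℝ 2 μ) x * N v x

/-- `ρ` is a non-negative continuous function in `D(𝓔)_loc` whose sublevel sets are relatively
compact. (They are open and exhaust `E` since `ρ` is continuous and finite.) -/
structure IsExhaustion (ρ : E → ℝ) : Prop where
  continuous : Continuous ρ
  nonneg : ∀ x, 0 ≤ ρ x
  relCompact : ∀ r : ℝ, 0 < r → IsCompact (closure (sublevel ρ r))
  memLoc : 𝓔.MemLoc ρ

variable {𝓔}

/-- On `E_m`, `m ≥ 1`, the function `ρ` agrees a.e. with an element of `D(𝓔)_b`. -/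
theorem IsExhaustion.exists_approx [OpensMeasurableSpace E] {ρ : E → ℝ}
    (hρ : 𝓔.IsExhaustion ρ) (m : ℕ) (hm : 0 < m) :
    ∃ w : Lp ℝ 2 μ, 𝓔.MemBdd w ∧ w =ᵐ[μ.restrict (sublevel ρ m)] ρ := by
  have hm' : (0 : ℝ) < m := by exact_mod_cast hm
  have hopen : IsOpen (sublevel ρ m) := isOpen_lt hρ.continuous continuous_const
  obtain ⟨w, hw, hwρ⟩ := hρ.memLoc (sublevel ρ m) hopen (hρ.relCompact m hm')
  obtain ⟨v, hv, -⟩ := 𝓔.markov ((m : ℝ)⁻¹ • ⟨w, hw⟩)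
  have hcoe : ∀ᵐ x ∂μ, ((m : ℝ) • (v : Lp ℝ 2 μ) : Lp ℝ 2 μ) x
      = m * min (max ((m : ℝ)⁻¹ * w x) 0) 1 := by
    filter_upwards [hv, Lp.coeFn_smul (m : ℝ) (v : Lp ℝ 2 μ), Lp.coeFn_smul ((m : ℝ)⁻¹) w]
      with x hx h1x h2x
    rw [h1x, Pi.smul_apply, hx, smul_eq_mul]
    congr 3
  refine ⟨(m : ℝ) • (v : Lp ℝ 2 μ), ⟨𝓔.dom.smul_mem _ v.2, m, ?_⟩, ?_⟩
  · filter_upwards [hcoe] with x hx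
    have h0 : 0 ≤ min (max ((m : ℝ)⁻¹ * w x) 0) 1 := le_min (le_max_right _ _) zero_le_one
    rw [hx, abs_of_nonneg (mul_nonneg hm'.le h0)]
    exact mul_le_of_le_one_right hm'.le (min_le_right _ _)
  · filter_upwards [ae_restrict_of_ae hcoe, hwρ, ae_restrict_mem hopen.measurableSet]
      with x hx hwx hmem
    have hlt : ρ x < m := hmem
    have h0 : 0 ≤ (m : ℝ)⁻¹ * ρ x := mul_nonneg (inv_nonneg.2 hm'.le) (hρ.nonneg x)
    have h1 : (m : ℝ)⁻¹ * ρ x ≤ 1 := by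
      rw [inv_mul_le_iff₀ hm']; linarith
    rw [hx, hwx, max_eq_left h0, min_eq_left h1, mul_inv_cancel_left₀ hm'.ne']

/-- A fixed choice of an element of `D(𝓔)_b` that agrees with `ρ` a.e. on `E_{m+1}`. -/
def IsExhaustion.approx [OpensMeasurableSpace E] {ρ : E → ℝ} (hρ : 𝓔.IsExhaustion ρ) (m : ℕ) :
    Lp ℝ 2 μ :=
  (hρ.exists_approx (m + 1) m.succ_pos).choose

theorem IsExhaustion.approx_spec [OpensMeasurableSpace E] {ρ : E → ℝ} (hρ : 𝓔.IsExhaustion ρ)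
    (m : ℕ) : 𝓔.MemBdd (hρ.approx m) ∧
      hρ.approx m =ᵐ[μ.restrict (sublevel ρ ((m + 1 : ℕ) : ℝ))] ρ :=
  (hρ.exists_approx (m + 1) m.succ_pos).choose_spec

/-- The function `Γ(ρ, ρ)` for `ρ ∈ D(𝓔)_loc`, by localization: on `E_{m+1} \ E_m` it is
`Γ(w, w)` with `w ∈ D(𝓔)_b`, `w = ρ` a.e. on `E_{m+1}`. By strong locality `Γ(w, w)` does not
depend on the choice of `w` there, up to null sets. -/
def CarreDuChamp.gammaLoc [OpensMeasurableSpace E] (Γ : 𝓔.CarreDuChamp) {ρ : E → ℝ}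
    (hρ : 𝓔.IsExhaustion ρ) : E → ℝ := fun x =>
  Γ.gamma ⟨hρ.approx ⌊ρ x⌋₊, (hρ.approx_spec _).1.1⟩ ⟨hρ.approx ⌊ρ x⌋₊, (hρ.approx_spec _).1.1⟩ x

/-- The function `N(ρ)` for `ρ ∈ D(𝓔)_loc`, by localization in the same way: on
`E_{m+1} \ E_m` it is `N w` with `w ∈ D(𝓔)_b`, `w = ρ` a.e. on `E_{m+1}`. -/
def IsDivFreeDerivation.nLoc [OpensMeasurableSpace E] {N : Lp ℝ 2 μ →ₗ.[ℝ] (E →ₘ[μ] ℝ)}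
    (hN : 𝓔.IsDivFreeDerivation N) {ρ : E → ℝ} (hρ : 𝓔.IsExhaustion ρ) : E → ℝ := fun x =>
  N ⟨hρ.approx ⌊ρ x⌋₊, hN.dom_le _ (hρ.approx_spec _).1⟩ x

end SymmDirichletForm

end Forms

/-! ## The local semigroups -/

section Local

variable {E : Type*} [TopologicalSpace E] [MeasurableSpace E] {μ : Measure E}
  {p : ℝ≥0∞} [Fact (1 ≤ p)] {ρ : E → ℝ}

/-- Approximation of `T̂_t` at the fixed time `t` along `V_n = {ρ < 4n}`: `(S n)`, `n ≥ 1`, are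
sub-Markovian `C₀`-semigroups of contractions on `L^p(V_n, μ)`, and `S n t (f · 1_{V_n})`
increases a.e. to `T̂_t f` for every non-negative `f ∈ L¹ ∩ L^∞`. -/
structure LocallyApproximates (S : ∀ n : ℕ, ℝ → Lp ℝ p (μ.restrict (V ρ n)) →L[ℝ]
    Lp ℝ p (μ.restrict (V ρ n))) (T : ℝ → Lp ℝ 2 μ →L[ℝ] Lp ℝ 2 μ) (t : ℝ) : Prop where
  semigroup : ∀ n : ℕ, 1 ≤ n → IsC0ContractionSemigroup (S n)
  subMarkovian : ∀ n : ℕ, 1 ≤ n → ∀ s : ℝ, 0 ≤ s → IsSubMarkovian (S n s)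
  increases : ∀ f : Lp ℝ 2 μ, Integrable f μ → EssBdd μ f → (∀ᵐ x ∂μ, 0 ≤ f x) →
    ∀ᵐ x ∂μ, MonotoneOn (fun n => (V ρ n).indicator (S n t (restrictLp μ p (V ρ n) f)) x) (Ici 1) ∧
      Tendsto (fun n => (V ρ n).indicator (S n t (restrictLp μ p (V ρ n) f)) x) atTop
        (𝓝 (adj T t f x))

/-- Local representation along `V_n = {ρ < 4n}`: every bounded `v` in the domain of the generator `L̂ⁿ`
of `S n` lies (extended by `0`) in `D(𝓔)`, and
`-∫_{V_n} L̂ⁿ v · u dμ = ∫_E Γ(u, v) dμ + ∫_{V_n} u N v dμ` for all `u ∈ D(𝓔)_b` that vanish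
outside `V_n`. -/
def LocallyRepresents (S : ∀ n : ℕ, ℝ → Lp ℝ p (μ.restrict (V ρ n)) →L[ℝ]
    Lp ℝ p (μ.restrict (V ρ n))) {𝓔 : SymmDirichletForm μ} (Γ : 𝓔.CarreDuChamp)
    {N : Lp ℝ 2 μ →ₗ.[ℝ] (E →ₘ[μ] ℝ)} (hN : 𝓔.IsDivFreeDerivation N) : Prop :=
  ∀ n : ℕ, 1 ≤ n → ∀ v y : Lp ℝ p (μ.restrict (V ρ n)), GeneratorMaps (S n) v y →
    EssBdd (μ.restrict (V ρ n)) v →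
    ∃ (w : Lp ℝ 2 μ) (hw : 𝓔.MemBdd w), w =ᵐ[μ] (V ρ n).indicator v ∧
      ∀ (u : Lp ℝ 2 μ) (hu : 𝓔.MemBdd u), (∀ᵐ x ∂μ, x ∉ V ρ n → u x = 0) →
        -∫ x in V ρ n, y x * u x ∂μ =
          ∫ x, Γ.gamma ⟨u, hu.1⟩ ⟨w, hw.1⟩ x ∂μ
            + ∫ x in V ρ n, u x * N ⟨w, hN.dom_le w hw⟩ x ∂μ

/-- `k_f = min {m ∈ ℕ : supp f ⊆ E_m and K ⊆ E_m}`. -/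
def kIndex (μ : Measure E) (ρ : E → ℝ) (K : Set E) (f : E → ℝ) : ℕ :=
  sInf {m : ℕ | 1 ≤ m ∧ supp μ f ⊆ sublevel ρ m ∧ K ⊆ sublevel ρ m}

/-- `D_0`: the bounded `f ∈ L²` with compact support such that `S n s f ∈ D(L̂ⁿ)` for all
`n ≥ k_f` and `s ∈ (0, t]`. -/
def D0 (S : ∀ n : ℕ, ℝ → Lp ℝ p (μ.restrict (V ρ n)) →L[ℝ] Lp ℝ p (μ.restrict (V ρ n)))
    (K : Set E) (t : ℝ) : Set (Lp ℝ 2 μ) :=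
  {f | EssBdd μ f ∧ IsCompact (supp μ f) ∧
    ∀ n : ℕ, kIndex μ ρ K f ≤ n → ∀ s : ℝ, 0 < s → s ≤ t →
      ∃ y, GeneratorMaps (S n) (S n s (restrictLp μ p (V ρ n) f)) y}

end Local

/-! ## The quantities in the criterion -/

section Criterion

variable {E : Type*} [MeasurableSpace E]

/-- `φ : [0, ∞) → [0, ∞)` is continuously differentiable and increasing, with `φ(0) = 0` and
`φ(r) → ∞` as `r → ∞`. -/
structure IsAdmissible (φ : ℝ → ℝ) : Prop where
  contDiffOn : ContDiffOn ℝ 1 φ (Ici 0)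
  monotoneOn : MonotoneOn φ (Ici 0)
  zero : φ 0 = 0
  tendsto : Tendsto φ atTop atTop

/-- The derivative on `[0, ∞)`, one-sided at `0`. -/
def dphi (φ : ℝ → ℝ) (r : ℝ) : ℝ := derivWithin φ (Ici 0) r

/-- `a_n`, where `G = Γ(ρ, ρ)`. -/
def aCoef (μ : Measure E) (ρ G : E → ℝ) (n : ℕ) : ℝ :=
  essSup G (μ.restrict (annulus ρ n))

/-- `b_n`, where `G = Γ(ρ, ρ)`. -/
def bCoef (μ : Measure E) (ρ G : E → ℝ) (φ : ℝ → ℝ) (n : ℕ) : ℝ :=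
  essSup (fun x => dphi φ (ρ x) * G x) (μ.restrict (annulus ρ n))

/-- The essential supremum over `E_{4n} \ E_k` of `|φ'(ρ)² Γ(ρ, ρ) + φ'(ρ) N(ρ)|`, where
`G = Γ(ρ, ρ)` and `H = N(ρ)`; for `k = k_f` this is `c_n(f)`. -/
def cCoef (μ : Measure E) (ρ G H : E → ℝ) (φ : ℝ → ℝ) (k n : ℕ) : ℝ :=
  essSup (fun x => |dphi φ (ρ x) ^ 2 * G x + dphi φ (ρ x) * H x|)
    (μ.restrict (sublevel ρ (4 * n) \ sublevel ρ k))

/-- `Â_n(φ)`, where `G = Γ(ρ, ρ)` and `H = N(ρ)`. -/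
def aHat (μ : Measure E) (ρ G H : E → ℝ) (φ : ℝ → ℝ) (n : ℕ) : ℝ :=
  (√(aCoef μ ρ G n) + bCoef μ ρ G φ n) * √(μ.real (annulus ρ n))
    + (eLpNorm H 2 (μ.restrict (annulus ρ n))).toReal

/-- `limsup_n e^{-φ(2n) + c_n T} Â_n(φ) / n = 0`, with `c_n` the essential supremum over
`E_{4n} \ E_k`; the upper limit is taken in the extended reals. -/
def Criterion (μ : Measure E) (ρ G H : E → ℝ) (φ : ℝ → ℝ) (τ : ℝ) (k : ℕ) : Prop :=
  limsup (fun n : ℕ => ((Real.exp (-φ (2 * n) + cCoef μ ρ G H φ k n * τ) / n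
    * aHat μ ρ G H φ n : ℝ) : EReal)) atTop = 0

end Criterion

end DivFreePerturbation

end

noncomputable section

namespace DivFreePerturbation

/-! ## Weak limits of bounded sequences -/

section Weak

open scoped RealInnerProductSpace

variable {H F : Type*} [NormedAddCommGroup H] [InnerProductSpace ℝ H] [CompleteSpace H]
  [NormedAddCommGroup F] [InnerProductSpace ℝ F] [CompleteSpace F]

/-! Within a time `τ` the local semigroups move little mass out of a large sublevel set, uniformly
in the domain `V_n`. Fix `m` and take a cutoff `θ(ρ)`, equal to 1 on `E_{2m}` and 0 off `E_{4m}`.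
Take also a weight `e^{2ψ(ρ)}`, where `ψ` is a truncation of `φ` that vanishes on `E_k`, is constant
beyond `E_{4m}` and is at least `φ(2m) - φ(k+1)` beyond `E_{2m}`. Along a bounded orbit `v` in the
domain of the local generator put `F = ∫ v² e^{2ψ(ρ)}`, `I = ∫ v θ(ρ)` and `Q = ∫ Γ(e^ψ v, e^ψ v)`.
The representation in (H2) is tested with `e^{2ψ} v` and with `θ(ρ)`. The derivation `N` is moved by
the Leibniz rule together with `∫ N = 0`. The result (`exists_energy_bound`) is

`F' ≤ 2 c_m F - 2 Q` and `I' ≥ -l (Q + F) - D² / (4 l)` for every `l > 0`,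

where `D` can be taken of order `e^{-φ(2m)} Â_m / m`, up to a small positive correction. With `l = λ
e^{-(2 c_m + 2) s}` and `λ = D e^{(c_m + 1) τ}` the unknown energy `Q` cancels in the derivative of
`(λ/2) e^{-(2 c_m + 2) s} F - I`. So `I` decreases by at most a constant times `λ`
(`integral_orbit_ge_of_generatorMaps`). Up to constants and a term `1/m` this is the quantity in the
criterion, and it does not depend on `n ≥ m` (`exists_mass_loss`).

The horizon `τ` of the criterion may be shorter than `t`. Therefore `t` is cut into steps of length
at most `τ`. After each step the function is cut off to some `V_J` and the estimate is restarted
there (`exists_tight`). The restart is legitimate because the starting index of the suprema `c_n`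
changes them by a bounded amount only (`Criterion.of_index`); this also gives the passage from `f`
to `g` in (ii). Since the local semigroups increase to `T̂_t`, the operator `T̂_t` keeps the mass of
bounded functions supported in a sublevel set, and by Fatou that of all non-negative functions
(`preservesMass_adj`). Assertion (i) follows by splitting into positive and negative parts. By
duality `T_t 1 = 1`, and the semigroup law carries this to all times
(`conservative_of_preservesMass_adj`).

The calculus behind the energy inequalities has to be derived from the axioms. Strong locality and
the energy formula give `Γ(u, ·) = 0` on open sets where the bounded function `u` is constant. Since
`M u - u²/2 = ∫_0^M min(u, a) da` for `0 ≤ u ≤ M`, Riemann sums of truncations, bounded in energy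
and hence weakly convergent, show that squares lie in the domain. For continuous `u` they also yield
`Γ(u², z) = 2 u Γ(u, z)`. Polynomials, Weierstrass approximation and regularity then give the chain
rule (`exists_comp`) and the Leibniz rule (`gamma_mul`). -/

theorem exists_weak_limit_ultrafilter (J : H →L[ℝ] F) {x : ℕ → H} {C : ℝ} (hC : ∀ k, ‖x k‖ ≤ C)
    {y : F} (hy : Tendsto (fun k => J (x k)) atTop (𝓝 y)) (U : Ultrafilter ℕ)
    (hU : (U : Filter ℕ) ≤ atTop) :
    ∃ v : H, J v = y ∧ ∀ h : H, Tendsto (fun k => ⟪x k, h⟫) U (𝓝 ⟪v, h⟫) := by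
  let c : ℕ → WeakDual ℝ H := fun k => StrongDual.toWeakDual (InnerProductSpace.toDual ℝ H (x k))
  have hc := WeakDual.isCompact_closedBall (𝕜 := ℝ) (E := H) 0 C
  obtain ⟨Λ, -, hΛ⟩ := hc.ultrafilter_le_nhds (U.map c) (by
    rw [le_principal_iff, Ultrafilter.mem_coe, Ultrafilter.mem_map]
    refine Filter.univ_mem' fun k => ?_
    simp only [mem_preimage, Metric.mem_closedBall, dist_zero_right, c]
    simpa using hC k)
  have hΛ' : Tendsto c U (𝓝 Λ) := hΛ
  let v : H := (InnerProductSpace.toDual ℝ H).symm (WeakDual.toStrongDual Λ)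
  have hv : ∀ h : H, Tendsto (fun k => ⟪x k, h⟫) U (𝓝 ⟪v, h⟫) := by
    intro h
    have h1 := ((WeakDual.eval_continuous h).tendsto Λ).comp hΛ'
    have h2 : ⟪v, h⟫ = Λ h := by
      simp [v]
    rw [h2]
    exact h1
  refine ⟨v, ?_, hv⟩
  refine ext_inner_right ℝ fun z => ?_
  have h1 := hv (J.adjoint z)
  simp only [ContinuousLinearMap.adjoint_inner_right] at h1
  exact tendsto_nhds_unique h1 ((hy.mono_left hU).inner tendsto_const_nhds)

/-- By Banach–Alaoglu every ultrafilter finer than `atTop` has a weak limit, and `J` sends it to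
`y`, as testing with the adjoint of `J` shows. Injectivity of `J` makes all these limits equal, so
the whole sequence converges weakly without passing to a subsequence. -/
theorem exists_weak_limit (J : H →L[ℝ] F) (hJ : Function.Injective J) {x : ℕ → H} {C : ℝ}
    (hC : ∀ k, ‖x k‖ ≤ C) {y : F} (hy : Tendsto (fun k => J (x k)) atTop (𝓝 y)) :
    ∃ v : H, J v = y ∧ ∀ ℓ : H →L[ℝ] ℝ, Tendsto (fun k => ℓ (x k)) atTop (𝓝 (ℓ v)) := by
  obtain ⟨v, hv, -⟩ := exists_weak_limit_ultrafilter J hC hy (hyperfilter ℕ) Nat.hyperfilter_le_atTop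
  refine ⟨v, hv, fun ℓ => ?_⟩
  rw [tendsto_iff_ultrafilter]
  intro U hU
  obtain ⟨w, hw, hlim⟩ := exists_weak_limit_ultrafilter J hC hy U hU
  obtain rfl : w = v := hJ (hw.trans hv.symm)
  have h1 := hlim ((InnerProductSpace.toDual ℝ H).symm ℓ)
  have h2 : ∀ z : H, ⟪z, (InnerProductSpace.toDual ℝ H).symm ℓ⟫ = ℓ z := fun z => by
    rw [real_inner_comm, InnerProductSpace.toDual_symm_apply]
  simpa only [h2] using h1

end Weak

/-! ## The energy space -/

section Energy

open scoped RealInnerProductSpace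

variable {E : Type*} [MeasurableSpace E] {μ : Measure E}

namespace SymmDirichletForm

/-- The inner product `𝓔₁` on the domain. -/
@[reducible]
def energyCore (𝓔 : SymmDirichletForm μ) : InnerProductSpace.Core ℝ 𝓔.dom where
  inner u v := 𝓔.form u v + ⟪(u : Lp ℝ 2 μ), (v : Lp ℝ 2 μ)⟫
  conj_inner_symm u v := by
    simp only [conj_trivial]
    rw [𝓔.symm, real_inner_comm]
  re_inner_nonneg u := add_nonneg (𝓔.nonneg u) real_inner_self_nonneg
  add_left u v w := by
    simp only [map_add, LinearMap.add_apply, Submodule.coe_add, inner_add_left]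
    ring
  smul_left u v r := by
    simp only [map_smul, LinearMap.smul_apply, Submodule.coe_smul, real_inner_smul_left,
      smul_eq_mul, conj_trivial]
    ring
  definite u hu := by
    have h1 := 𝓔.nonneg u
    have h2 : 0 ≤ ⟪(u : Lp ℝ 2 μ), (u : Lp ℝ 2 μ)⟫ := real_inner_self_nonneg
    have h3 : ⟪(u : Lp ℝ 2 μ), (u : Lp ℝ 2 μ)⟫ = 0 := by
      have h4 : 𝓔.form u u + ⟪(u : Lp ℝ 2 μ), (u : Lp ℝ 2 μ)⟫ = 0 := hu
      linarith
    exact Subtype.ext (inner_self_eq_zero.1 h3)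

/-- The domain of a form, as a Hilbert space for `𝓔₁`. -/
def EnergySpace (𝓔 : SymmDirichletForm μ) : Type _ := 𝓔.dom

/-- The type synonym keeps this norm apart from the `L²` norm that `𝓔.dom` inherits as a submodule.
-/
instance (𝓔 : SymmDirichletForm μ) : NormedAddCommGroup 𝓔.EnergySpace :=
  𝓔.energyCore.toNormedAddCommGroup

instance (𝓔 : SymmDirichletForm μ) : InnerProductSpace ℝ 𝓔.EnergySpace :=
  InnerProductSpace.ofCore 𝓔.energyCore.toCore

/-- The identity between the domain and the energy space. -/
def toEnergy (𝓔 : SymmDirichletForm μ) : 𝓔.dom ≃ₗ[ℝ] 𝓔.EnergySpace where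
  toFun u := u
  invFun u := u
  map_add' _ _ := rfl
  map_smul' _ _ := rfl
  left_inv _ := rfl
  right_inv _ := rfl

variable (𝓔 : SymmDirichletForm μ)

theorem inner_toEnergy (u v : 𝓔.dom) : ⟪𝓔.toEnergy u, 𝓔.toEnergy v⟫ =
    𝓔.form u v + ⟪(u : Lp ℝ 2 μ), (v : Lp ℝ 2 μ)⟫ := rfl

theorem energy_norm_sq (u : 𝓔.dom) :
    ‖𝓔.toEnergy u‖ ^ 2 = 𝓔.form u u + ‖(u : Lp ℝ 2 μ)‖ ^ 2 := by
  rw [← real_inner_self_eq_norm_sq, ← real_inner_self_eq_norm_sq, inner_toEnergy]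

theorem norm_le_energy_norm (u : 𝓔.dom) : ‖(u : Lp ℝ 2 μ)‖ ≤ ‖𝓔.toEnergy u‖ := by
  refine le_of_sq_le_sq ?_ (norm_nonneg _)
  rw [energy_norm_sq]
  linarith [𝓔.nonneg u]

theorem sqrt_form_le_energy_norm (u : 𝓔.dom) : √(𝓔.form u u) ≤ ‖𝓔.toEnergy u‖ := by
  refine Real.sqrt_le_iff.2 ⟨norm_nonneg _, ?_⟩
  rw [energy_norm_sq]
  nlinarith [sq_nonneg ‖(u : Lp ℝ 2 μ)‖]

instance : CompleteSpace 𝓔.EnergySpace := by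
  refine Metric.complete_of_cauchySeq_tendsto fun u hu => ?_
  let v : ℕ → 𝓔.dom := fun k => 𝓔.toEnergy.symm (u k)
  have hv : ∀ k, 𝓔.toEnergy (v k) = u k := fun k => 𝓔.toEnergy.apply_symm_apply _
  obtain ⟨w, hw⟩ := 𝓔.closed v (by
    intro ε hε
    obtain ⟨M, hM⟩ := Metric.cauchySeq_iff.1 hu (√ε) (Real.sqrt_pos.2 hε)
    refine ⟨M, fun m hm k hk => ?_⟩
    have h1 := hM m hm k hk
    rw [dist_eq_norm, ← hv, ← hv, ← map_sub] at h1
    rw [← energy_norm_sq]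
    calc ‖𝓔.toEnergy (v m - v k)‖ ^ 2 < √ε ^ 2 := by gcongr
      _ = ε := Real.sq_sqrt hε.le)
  refine ⟨𝓔.toEnergy w, ?_⟩
  rw [tendsto_iff_norm_sub_tendsto_zero]
  have h2 := (Real.continuous_sqrt.tendsto 0).comp hw
  rw [Real.sqrt_zero] at h2
  refine h2.congr fun k => ?_
  rw [Function.comp_apply, ← energy_norm_sq, Real.sqrt_sq (norm_nonneg _), map_sub, hv]

/-- The embedding of the energy space into `L²`. -/
def energyEmb : 𝓔.EnergySpace →L[ℝ] Lp ℝ 2 μ :=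
  LinearMap.mkContinuous (𝓔.dom.subtype.comp 𝓔.toEnergy.symm.toLinearMap) 1 fun u => by
    rw [one_mul]
    exact 𝓔.norm_le_energy_norm (𝓔.toEnergy.symm u)

theorem energyEmb_injective : Function.Injective 𝓔.energyEmb := fun _ _ h => Subtype.ext h

variable {𝓔}

/-- An `L²`-convergent sequence that is bounded in energy has its limit in the domain, and
converges weakly for the energy. -/
theorem exists_energy_limit {u : ℕ → 𝓔.dom} {C : ℝ} (hC : ∀ k, 𝓔.form (u k) (u k) ≤ C)
    {x : Lp ℝ 2 μ} (hx : Tendsto (fun k => (u k : Lp ℝ 2 μ)) atTop (𝓝 x)) :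
    ∃ v : 𝓔.dom, (v : Lp ℝ 2 μ) = x ∧ ∀ ℓ : 𝓔.dom →ₗ[ℝ] ℝ,
      (∃ A : ℝ, 0 ≤ A ∧ ∀ z, |ℓ z| ≤ A * √(𝓔.form z z)) →
        Tendsto (fun k => ℓ (u k)) atTop (𝓝 (ℓ v)) := by
  obtain ⟨B, hB⟩ := (Metric.isBounded_range_of_tendsto _ hx).exists_norm_le
  have hbd : ∀ k, ‖𝓔.toEnergy (u k)‖ ≤ √(C + B ^ 2) := fun k => by
    refine Real.le_sqrt_of_sq_le ?_
    rw [energy_norm_sq]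
    have := hB _ (mem_range_self k)
    gcongr
    exact hC k
  obtain ⟨v, hv, hlim⟩ := exists_weak_limit 𝓔.energyEmb 𝓔.energyEmb_injective hbd hx
  refine ⟨𝓔.toEnergy.symm v, hv, ?_⟩
  rintro ℓ ⟨A, hA, hℓ⟩
  let ℓ' : 𝓔.EnergySpace →L[ℝ] ℝ :=
    LinearMap.mkContinuous (ℓ.comp 𝓔.toEnergy.symm.toLinearMap) A fun z =>
      (hℓ _).trans (mul_le_mul_of_nonneg_left (𝓔.sqrt_form_le_energy_norm (𝓔.toEnergy.symm z)) hA)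
  exact hlim ℓ'

end SymmDirichletForm
end Energy
/-! ## Products of bounded elements of the domain -/

section Algebra

variable {E : Type*} [MeasurableSpace E] {μ : Measure E}

theorem ae_all_coeFn_sum {ι : Type*} {p : ℝ≥0∞} (s : Finset ι) (f : ι → Lp ℝ p μ) :
    ∀ᵐ x ∂μ, (∑ i ∈ s, f i : Lp ℝ p μ) x = ∑ i ∈ s, f i x := by
  filter_upwards [Lp.coeFn_finsetSum s f] with x hx
  rw [hx, Finset.sum_apply]

/-- Bounds for the Riemann sums of `a ↦ min x a` on `[0, j h]`. -/
theorem riemann_min_bounds {h : ℝ} (hh : 0 ≤ h) (j : ℕ) : ∀ x : ℝ, 0 ≤ x → x ≤ j * h →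
    0 ≤ h * ∑ i ∈ Finset.range j, min x ((i + 1 : ℕ) * h) - (j * h * x - x ^ 2 / 2) ∧
      h * ∑ i ∈ Finset.range j, min x ((i + 1 : ℕ) * h) - (j * h * x - x ^ 2 / 2) ≤ h * x := by
  induction j with
  | zero =>
    intro x h0 h1
    have : x = 0 := le_antisymm (by simpa using h1) h0
    simp [this]
  | succ j ih =>
    intro x h0 h1
    rw [Finset.sum_range_succ, min_eq_left h1]
    push_cast at h1 ⊢
    rcases le_total x (j * h) with hx | hx
    · have := ih x h0 hx
      push_cast at this
      constructor <;> nlinarith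
    · have hj : (0 : ℝ) ≤ j * h := by positivity
      have := ih (j * h) hj le_rfl
      -- Beyond `j h` all the earlier caps are already reached, so these terms agree with those at
      -- `x = j h`.
      have h2 : ∑ i ∈ Finset.range j, min x (((i : ℝ) + 1) * h) =
          ∑ i ∈ Finset.range j, min (j * h) (((i + 1 : ℕ) : ℝ) * h) := by
        refine Finset.sum_congr rfl fun i hi => ?_
        have hij : ((i + 1 : ℕ) : ℝ) ≤ j := by exact_mod_cast Finset.mem_range.1 hi
        have h3 : ((i + 1 : ℕ) : ℝ) * h ≤ j * h := mul_le_mul_of_nonneg_right hij hh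
        rw [min_eq_right h3, min_eq_right]
        · push_cast; ring
        · push_cast at h3 ⊢; linarith
      rw [h2]
      constructor <;> nlinarith

namespace SymmDirichletForm

variable {𝓔 : SymmDirichletForm μ}

theorem form_sq_le (u v : 𝓔.dom) : 𝓔.form u v ^ 2 ≤ 𝓔.form u u * 𝓔.form v v :=
  LinearMap.BilinForm.apply_sq_le_of_symm 𝓔.form 𝓔.nonneg ⟨fun u v => 𝓔.symm u v⟩ u v

theorem exists_trunc (u : 𝓔.dom) {a : ℝ} (ha : 0 < a) : ∃ v : 𝓔.dom,
    (∀ᵐ x ∂μ, (v : Lp ℝ 2 μ) x = min (max ((u : Lp ℝ 2 μ) x) 0) a) ∧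
      𝓔.form v v ≤ 𝓔.form u u := by
  obtain ⟨v, hv, hE⟩ := 𝓔.markov (a⁻¹ • u)
  refine ⟨a • v, ?_, ?_⟩
  · filter_upwards [hv, Lp.coeFn_smul a (v : Lp ℝ 2 μ), Lp.coeFn_smul a⁻¹ (u : Lp ℝ 2 μ)]
      with x hx h1 h2
    rw [Submodule.coe_smul] at hx ⊢
    rw [h1, Pi.smul_apply, hx, h2, Pi.smul_apply, smul_eq_mul, smul_eq_mul,
      mul_min_of_nonneg _ _ ha.le, mul_max_of_nonneg _ _ ha.le, mul_zero, mul_one,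
      mul_inv_cancel_left₀ ha.ne']
  · simp only [map_smul, LinearMap.smul_apply, smul_eq_mul] at hE ⊢
    have h3 := mul_le_mul_of_nonneg_left hE (mul_self_nonneg a)
    calc a * (a * 𝓔.form v v) = a * a * 𝓔.form v v := by ring
      _ ≤ a * a * (a⁻¹ * (a⁻¹ * 𝓔.form u u)) := h3
      _ = 𝓔.form u u := by field_simp

/-- Truncations `T j i = min u ((i + 1) M / (j + 1))` whose Riemann sums have bounded energy and
converge in `L²` to `M u - u² / 2`. -/
theorem exists_riemann_sums (u : 𝓔.dom) {M : ℝ} (hM : 0 < M)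
    (hu : ∀ᵐ x ∂μ, 0 ≤ (u : Lp ℝ 2 μ) x ∧ (u : Lp ℝ 2 μ) x ≤ M) :
    ∃ (T : ℕ → ℕ → 𝓔.dom) (y : Lp ℝ 2 μ) (C : ℝ),
      (∀ j i, ∀ᵐ x ∂μ, (T j i : Lp ℝ 2 μ) x =
        min ((u : Lp ℝ 2 μ) x) ((i + 1 : ℕ) * (M / (j + 1 : ℕ)))) ∧
      (∀ᵐ x ∂μ, y x = M * (u : Lp ℝ 2 μ) x - (u : Lp ℝ 2 μ) x ^ 2 / 2) ∧
      (∀ j : ℕ, 𝓔.form ((M / (j + 1 : ℕ)) • ∑ i ∈ Finset.range (j + 1), T j i)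
        ((M / (j + 1 : ℕ)) • ∑ i ∈ Finset.range (j + 1), T j i) ≤ C) ∧
      Tendsto (fun j : ℕ => (((M / (j + 1 : ℕ)) • ∑ i ∈ Finset.range (j + 1), T j i : 𝓔.dom) :
        Lp ℝ 2 μ)) atTop (𝓝 y) := by
  -- The positivity of `a` is placed under the existential so that `choose` gives a function of `a`
  -- alone.
  have htr : ∀ a : ℝ, ∃ v : 𝓔.dom, 0 < a →
      (∀ᵐ x ∂μ, (v : Lp ℝ 2 μ) x = min (max ((u : Lp ℝ 2 μ) x) 0) a) ∧
      𝓔.form v v ≤ 𝓔.form u u := fun a => by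
    by_cases ha : 0 < a
    · obtain ⟨v, hv⟩ := 𝓔.exists_trunc u ha
      exact ⟨v, fun _ => hv⟩
    · exact ⟨0, fun h => absurd h ha⟩
  choose T hT using htr
  let h : ℕ → ℝ := fun j => M / (j + 1 : ℕ)
  have hpos : ∀ j, 0 < h j := fun j => by positivity
  have hpos' : ∀ j i : ℕ, 0 < ((i + 1 : ℕ) : ℝ) * h j := fun j i =>
    mul_pos (by positivity) (hpos j)
  have hjh : ∀ j, ((j + 1 : ℕ) : ℝ) * h j = M := fun j => mul_div_cancel₀ M (by positivity)
  let s : ℕ → 𝓔.dom := fun j => h j • ∑ i ∈ Finset.range (j + 1), T ((i + 1 : ℕ) * h j)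
  have hs : ∀ j, ∀ᵐ x ∂μ, ((s j : 𝓔.dom) : Lp ℝ 2 μ) x =
      h j * ∑ i ∈ Finset.range (j + 1), min ((u : Lp ℝ 2 μ) x) ((i + 1 : ℕ) * h j) := fun j => by
    have h1 : ∀ᵐ x ∂μ, ∀ i : ℕ, (T ((i + 1 : ℕ) * h j) : Lp ℝ 2 μ) x =
        min (max ((u : Lp ℝ 2 μ) x) 0) ((i + 1 : ℕ) * h j) :=
      ae_all_iff.2 fun i => (hT _ (hpos' j i)).1
    filter_upwards [h1, hu, Lp.coeFn_smul (h j)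
      ((∑ i ∈ Finset.range (j + 1), T ((i + 1 : ℕ) * h j) : 𝓔.dom) : Lp ℝ 2 μ),
      ae_all_coeFn_sum (Finset.range (j + 1)) fun i : ℕ => (T ((i + 1 : ℕ) * h j) : Lp ℝ 2 μ)]
      with x hx hux h2 h3
    simp only [s, Submodule.coe_smul]
    rw [h2, Pi.smul_apply, smul_eq_mul, AddSubmonoidClass.coe_finsetSum, h3]
    congr 1
    refine Finset.sum_congr rfl fun i _ => ?_
    rw [hx i, max_eq_left hux.1]
  have hE : ∀ j, 𝓔.form (s j) (s j) ≤ M ^ 2 * 𝓔.form u u := fun j => by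
    -- Truncation lowers the energy, so by Cauchy–Schwarz every mixed term is at most `𝓔(u, u)`.
    -- There are `(j + 1)²` of them, each weighted by `h²`, whence the bound `M² 𝓔(u, u)` for all
    -- `j`.
    have h1 : ∀ i i' : ℕ, 𝓔.form (T ((i + 1 : ℕ) * h j)) (T ((i' + 1 : ℕ) * h j)) ≤ 𝓔.form u u := by
      intro i i'
      refine le_of_sq_le_sq ((form_sq_le _ _).trans ?_) (𝓔.nonneg u)
      rw [sq]
      exact mul_le_mul (hT _ (hpos' j i)).2 (hT _ (hpos' j i')).2 (𝓔.nonneg _) (𝓔.nonneg _)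
    have h2 : 𝓔.form (s j) (s j) = h j * (h j * ∑ i ∈ Finset.range (j + 1),
        ∑ i' ∈ Finset.range (j + 1), 𝓔.form (T ((i + 1 : ℕ) * h j)) (T ((i' + 1 : ℕ) * h j))) := by
      simp only [s, map_smul, LinearMap.smul_apply, smul_eq_mul, map_sum, LinearMap.sum_apply, ← Finset.mul_sum]
      rw [Finset.sum_comm]
    rw [h2]
    have h3 : ∑ i ∈ Finset.range (j + 1), ∑ i' ∈ Finset.range (j + 1),
        𝓔.form (T ((i + 1 : ℕ) * h j)) (T ((i' + 1 : ℕ) * h j)) ≤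
        ((j + 1 : ℕ) : ℝ) * (((j + 1 : ℕ) : ℝ) * 𝓔.form u u) := by
      calc _ ≤ ∑ i ∈ Finset.range (j + 1), ∑ i' ∈ Finset.range (j + 1), 𝓔.form u u :=
            Finset.sum_le_sum fun i _ => Finset.sum_le_sum fun i' _ => h1 i i'
        _ = _ := by simp
    calc _ ≤ h j * (h j * (((j + 1 : ℕ) : ℝ) * (((j + 1 : ℕ) : ℝ) * 𝓔.form u u))) := by
          have := (hpos j).le
          gcongr
      _ = (((j + 1 : ℕ) : ℝ) * h j) ^ 2 * 𝓔.form u u := by ring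
      _ = _ := by rw [hjh]
  have hsqmem : MemLp (fun x => (u : Lp ℝ 2 μ) x ^ 2) 2 μ := by
    refine (Lp.memLp (u : Lp ℝ 2 μ)).of_le_mul (c := M)
      ((Lp.aestronglyMeasurable _).pow 2) ?_
    filter_upwards [hu] with x hx
    rw [Real.norm_eq_abs, Real.norm_eq_abs, abs_of_nonneg (sq_nonneg _), abs_of_nonneg hx.1]
    nlinarith
  let y : Lp ℝ 2 μ := M • (u : Lp ℝ 2 μ) - (2⁻¹ : ℝ) • hsqmem.toLp
  have hy : ∀ᵐ x ∂μ, y x = M * (u : Lp ℝ 2 μ) x - (u : Lp ℝ 2 μ) x ^ 2 / 2 := by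
    filter_upwards [Lp.coeFn_sub (M • (u : Lp ℝ 2 μ)) ((2⁻¹ : ℝ) • hsqmem.toLp),
      Lp.coeFn_smul M (u : Lp ℝ 2 μ), Lp.coeFn_smul (2⁻¹ : ℝ) hsqmem.toLp, hsqmem.coeFn_toLp]
      with x h1 h2 h3 h4
    simp only [y]
    rw [h1, Pi.sub_apply, h2, h3, Pi.smul_apply, Pi.smul_apply, h4, smul_eq_mul, smul_eq_mul]
    ring
  have hlim : Tendsto (fun j => (s j : Lp ℝ 2 μ)) atTop (𝓝 y) := by
    rw [tendsto_iff_norm_sub_tendsto_zero]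
    -- The pointwise error is at most `h * u`, which is small in `L²` even if `μ` is infinite; a
    -- uniform error `h` would not suffice.
    have h0 : Tendsto (fun j => h j * ‖(u : Lp ℝ 2 μ)‖) atTop (𝓝 0) := by
      have : Tendsto h atTop (𝓝 0) :=
        (tendsto_const_div_atTop_nhds_zero_nat M).comp (tendsto_add_atTop_nat 1)
      simpa using this.mul_const ‖(u : Lp ℝ 2 μ)‖
    refine squeeze_zero (fun _ => norm_nonneg _) (fun j => ?_) h0
    refine Lp.norm_le_mul_norm_of_ae_le_mul ?_
    filter_upwards [hs j, hy, hu, Lp.coeFn_sub (s j : Lp ℝ 2 μ) y] with x h1 h2 h3 h4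
    rw [h4, Pi.sub_apply, h1, h2, Real.norm_eq_abs, Real.norm_eq_abs, abs_of_nonneg h3.1]
    have h5 := riemann_min_bounds (hpos j).le (j + 1) _ h3.1 (by rw [hjh]; exact h3.2)
    rw [hjh] at h5
    rw [abs_of_nonneg h5.1]
    exact h5.2
  refine ⟨fun j i => T ((i + 1 : ℕ) * h j), y, _, fun j i => ?_, hy, hE, hlim⟩
  filter_upwards [(hT _ (hpos' j i)).1, hu] with x h1 h2
  rw [h1, max_eq_left h2.1]

/-- Riemann sums for `∫_0^M min(u, a) da = M u - u²/2` have bounded energy, so their `L²` limit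
stays in the domain, and `u²` is twice the difference between `M u` and this limit. -/
theorem exists_sq_of_nonneg (u : 𝓔.dom) {M : ℝ} (hM : 0 < M)
    (hu : ∀ᵐ x ∂μ, 0 ≤ (u : Lp ℝ 2 μ) x ∧ (u : Lp ℝ 2 μ) x ≤ M) :
    ∃ v : 𝓔.dom, ∀ᵐ x ∂μ, (v : Lp ℝ 2 μ) x = (u : Lp ℝ 2 μ) x ^ 2 := by
  obtain ⟨T, y, C, -, hy, hE, hlim⟩ := exists_riemann_sums u hM hu
  obtain ⟨v, hv, -⟩ := exists_energy_limit hE hlim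
  refine ⟨(2 : ℝ) • (M • u - v), ?_⟩
  filter_upwards [hy, Lp.coeFn_sub (M • (u : Lp ℝ 2 μ)) y, Lp.coeFn_smul M (u : Lp ℝ 2 μ),
    Lp.coeFn_smul (2 : ℝ) (M • (u : Lp ℝ 2 μ) - y)] with x h1 h2 h3 h4
  simp only [Submodule.coe_smul, Submodule.coe_sub, hv]
  rw [h4, Pi.smul_apply, h2, Pi.sub_apply, h3, h1, Pi.smul_apply, smul_eq_mul, smul_eq_mul]
  ring

theorem coe_add_ae (u v : 𝓔.dom) : ∀ᵐ x ∂μ, ((u + v : 𝓔.dom) : Lp ℝ 2 μ) x =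
    (u : Lp ℝ 2 μ) x + (v : Lp ℝ 2 μ) x :=
  Lp.coeFn_add (u : Lp ℝ 2 μ) (v : Lp ℝ 2 μ)

theorem coe_sub_ae (u v : 𝓔.dom) : ∀ᵐ x ∂μ, ((u - v : 𝓔.dom) : Lp ℝ 2 μ) x =
    (u : Lp ℝ 2 μ) x - (v : Lp ℝ 2 μ) x :=
  Lp.coeFn_sub (u : Lp ℝ 2 μ) (v : Lp ℝ 2 μ)

theorem coe_neg_ae (u : 𝓔.dom) : ∀ᵐ x ∂μ, ((-u : 𝓔.dom) : Lp ℝ 2 μ) x = -(u : Lp ℝ 2 μ) x :=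
  Lp.coeFn_neg (u : Lp ℝ 2 μ)

theorem coe_smul_ae (c : ℝ) (u : 𝓔.dom) : ∀ᵐ x ∂μ, ((c • u : 𝓔.dom) : Lp ℝ 2 μ) x =
    c * (u : Lp ℝ 2 μ) x :=
  Lp.coeFn_smul c (u : Lp ℝ 2 μ)

theorem dom_ext {u v : 𝓔.dom} (h : ∀ᵐ x ∂μ, (u : Lp ℝ 2 μ) x = (v : Lp ℝ 2 μ) x) : u = v :=
  Subtype.ext (Lp.ext h)

end SymmDirichletForm

theorem EssBdd.exists_pos {u : E → ℝ} (hu : EssBdd μ u) :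
    ∃ M : ℝ, 0 < M ∧ ∀ᵐ x ∂μ, |u x| ≤ M := by
  obtain ⟨C, hC⟩ := hu
  refine ⟨max C 1, by positivity, ?_⟩
  filter_upwards [hC] with x hx using hx.trans (le_max_left _ _)

theorem EssBdd.congr {u v : E → ℝ} (hu : EssBdd μ u) (h : ∀ᵐ x ∂μ, v x = u x) : EssBdd μ v := by
  obtain ⟨C, hC⟩ := hu
  exact ⟨C, by filter_upwards [hC, h] with x h1 h2; rwa [h2]⟩

theorem EssBdd.add {u v : E → ℝ} (hu : EssBdd μ u) (hv : EssBdd μ v) :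
    EssBdd μ (fun x => u x + v x) := by
  obtain ⟨C, hC⟩ := hu
  obtain ⟨D, hD⟩ := hv
  refine ⟨C + D, ?_⟩
  filter_upwards [hC, hD] with x h1 h2 using (abs_add_le _ _).trans (add_le_add h1 h2)

theorem EssBdd.mul {u v : E → ℝ} (hu : EssBdd μ u) (hv : EssBdd μ v) :
    EssBdd μ (fun x => u x * v x) := by
  obtain ⟨C, hC⟩ := hu
  obtain ⟨D, hD⟩ := hv
  refine ⟨C * D, ?_⟩
  filter_upwards [hC, hD] with x h1 h2
  rw [abs_mul]
  exact mul_le_mul h1 h2 (abs_nonneg _) ((abs_nonneg _).trans h1)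

theorem EssBdd.const_mul (c : ℝ) {u : E → ℝ} (hu : EssBdd μ u) : EssBdd μ (fun x => c * u x) :=
  EssBdd.mul ⟨|c|, ae_of_all _ fun _ => le_rfl⟩ hu

namespace SymmDirichletForm

variable {𝓔 : SymmDirichletForm μ}

/-- `u² = (u⁺)² + (u⁻)²`, and both parts are truncations at the bound `M`, of `u` and of `-u`. -/
theorem exists_sq (u : 𝓔.dom) (hu : EssBdd μ (u : Lp ℝ 2 μ)) :
    ∃ v : 𝓔.dom, ∀ᵐ x ∂μ, (v : Lp ℝ 2 μ) x = (u : Lp ℝ 2 μ) x ^ 2 := by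
  obtain ⟨M, hM, hu⟩ := hu.exists_pos
  obtain ⟨p, hp, -⟩ := 𝓔.exists_trunc u hM
  obtain ⟨n, hn, -⟩ := 𝓔.exists_trunc (-u) hM
  obtain ⟨p2, hp2⟩ := exists_sq_of_nonneg p hM (by
    filter_upwards [hp] with x hx
    rw [hx]
    exact ⟨le_min (le_max_right _ _) hM.le, min_le_right _ _⟩)
  obtain ⟨n2, hn2⟩ := exists_sq_of_nonneg n hM (by
    filter_upwards [hn] with x hx
    rw [hx]
    exact ⟨le_min (le_max_right _ _) hM.le, min_le_right _ _⟩)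
  refine ⟨p2 + n2, ?_⟩
  filter_upwards [hu, hp, hn, hp2, hn2, coe_add_ae p2 n2, coe_neg_ae u] with x h0 h1 h2 h3 h4 h5 h6
  rw [h5, h3, h4, h1, h2, h6]
  have h7 := abs_le.1 h0
  rcases le_total 0 ((u : Lp ℝ 2 μ) x) with h | h
  · rw [max_eq_left h, max_eq_right (by linarith), min_eq_left h7.2, min_eq_left hM.le]
    ring
  · rw [max_eq_right h, max_eq_left (by linarith), min_eq_left hM.le, min_eq_left (by linarith)]
    ring

theorem exists_mul (u v : 𝓔.dom) (hu : EssBdd μ (u : Lp ℝ 2 μ)) (hv : EssBdd μ (v : Lp ℝ 2 μ)) :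
    ∃ w : 𝓔.dom, ∀ᵐ x ∂μ, (w : Lp ℝ 2 μ) x = (u : Lp ℝ 2 μ) x * (v : Lp ℝ 2 μ) x := by
  obtain ⟨a, ha⟩ := exists_sq u hu
  obtain ⟨b, hb⟩ := exists_sq v hv
  obtain ⟨c, hc⟩ := exists_sq (u + v) ((hu.add hv).congr (coe_add_ae u v))
  refine ⟨(2⁻¹ : ℝ) • (c - (a + b)), ?_⟩
  filter_upwards [ha, hb, hc, coe_add_ae u v, coe_add_ae a b, coe_sub_ae c (a + b),
    coe_smul_ae (2⁻¹ : ℝ) (c - (a + b))] with x h1 h2 h3 h4 h5 h6 h7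
  rw [h7, h6, h5, h3, h4, h1, h2]
  ring

end SymmDirichletForm
end Algebra
/-! ## The carré du champ -/

section Gamma

variable {E : Type*} [TopologicalSpace E] [MeasurableSpace E] {μ : Measure E}
  {𝓔 : SymmDirichletForm μ}

namespace SymmDirichletForm

namespace CarreDuChamp

variable (Γ : 𝓔.CarreDuChamp)

theorem integrable (u v : 𝓔.dom) : Integrable (Γ.gamma u v) μ :=
  L1.integrable_coeFn _

theorem gamma_add_left_ae (u v z : 𝓔.dom) :
    ∀ᵐ x ∂μ, Γ.gamma (u + v) z x = Γ.gamma u z x + Γ.gamma v z x := by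
  rw [map_add, LinearMap.add_apply]
  exact Lp.coeFn_add _ _

theorem gamma_sub_left_ae (u v z : 𝓔.dom) :
    ∀ᵐ x ∂μ, Γ.gamma (u - v) z x = Γ.gamma u z x - Γ.gamma v z x := by
  rw [map_sub, LinearMap.sub_apply]
  exact Lp.coeFn_sub _ _

theorem gamma_smul_left_ae (c : ℝ) (u z : 𝓔.dom) :
    ∀ᵐ x ∂μ, Γ.gamma (c • u) z x = c * Γ.gamma u z x := by
  rw [map_smul, LinearMap.smul_apply]
  exact Lp.coeFn_smul _ _

/-- Pointwise Cauchy–Schwarz inequality. -/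
theorem gamma_sq_le_ae (u z : 𝓔.dom) :
    ∀ᵐ x ∂μ, Γ.gamma u z x ^ 2 ≤ Γ.gamma u u x * Γ.gamma z z x := by
  -- Rational `q` keep the exceptional sets countable in number; the inequality passes to real `q`
  -- by continuity, and the discriminant gives the claim.
  have h : ∀ q : ℚ, ∀ᵐ x ∂μ,
      0 ≤ Γ.gamma z z x * ((q : ℝ) * q) + 2 * Γ.gamma u z x * q + Γ.gamma u u x := fun q => by
    have h1 : Γ.gamma (u + (q : ℝ) • z) (u + (q : ℝ) • z) =
        Γ.gamma u u + ((2 * q : ℝ) • Γ.gamma u z + (q * q : ℝ) • Γ.gamma z z) := by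
      simp only [map_add, map_smul, LinearMap.add_apply, LinearMap.smul_apply]
      rw [Γ.symm z u]
      module
    have h2 := Γ.nonneg (u + (q : ℝ) • z)
    rw [h1] at h2
    filter_upwards [h2, Lp.coeFn_add (Γ.gamma u u)
        ((2 * q : ℝ) • Γ.gamma u z + (q * q : ℝ) • Γ.gamma z z),
      Lp.coeFn_add ((2 * q : ℝ) • Γ.gamma u z) ((q * q : ℝ) • Γ.gamma z z),
      Lp.coeFn_smul (2 * q : ℝ) (Γ.gamma u z), Lp.coeFn_smul (q * q : ℝ) (Γ.gamma z z)]
      with x h3 h4 h5 h6 h7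
    rw [h4, Pi.add_apply, h5, Pi.add_apply, h6, h7, Pi.smul_apply, Pi.smul_apply, smul_eq_mul,
      smul_eq_mul] at h3
    linarith
  filter_upwards [ae_all_iff.2 h] with x hx
  have hcl : IsClosed {r : ℝ | 0 ≤ Γ.gamma z z x * (r * r) + 2 * Γ.gamma u z x * r + Γ.gamma u u x} :=
    isClosed_le continuous_const (by fun_prop)
  have hall : ∀ r : ℝ, 0 ≤ Γ.gamma z z x * (r * r) + 2 * Γ.gamma u z x * r + Γ.gamma u u x := by
    intro r
    have := hcl.closure_subset_iff.2 (range_subset_iff.2 hx : range ((↑) : ℚ → ℝ) ⊆ _)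
    rw [Rat.denseRange_cast.closure_range] at this
    exact this (mem_univ r)
  have := discrim_le_zero hall
  rw [discrim] at this
  nlinarith

theorem abs_gamma_le_ae (u z : 𝓔.dom) :
    ∀ᵐ x ∂μ, |Γ.gamma u z x| ≤ √(Γ.gamma u u x) * √(Γ.gamma z z x) := by
  filter_upwards [Γ.gamma_sq_le_ae u z, Γ.nonneg u] with x h1 h2
  rw [← Real.sqrt_mul h2]
  exact Real.abs_le_sqrt h1

/-- For a bounded function `g`, the functional `u ↦ ∫ g Γ(u, z)` is bounded in energy. -/
theorem abs_integral_mul_gamma_le (u z : 𝓔.dom) {g : E → ℝ} {C : ℝ}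
    (hC : ∀ᵐ x ∂μ, |g x| ≤ C) (hC0 : 0 ≤ C) :
    ∫ x, |g x * Γ.gamma u z x| ∂μ ≤ C * (√(𝓔.form u u) * √(𝓔.form z z)) := by
  have hsq : ∀ v : 𝓔.dom, MemLp (fun x => √(Γ.gamma v v x)) 2 μ := fun v => by
    rw [memLp_two_iff_integrable_sq
      (Γ.integrable v v).1.aemeasurable.sqrt.aestronglyMeasurable]
    refine (Γ.integrable v v).congr ?_
    filter_upwards [Γ.nonneg v] with x hx
    rw [Real.sq_sqrt hx]
  have hint : ∀ v : 𝓔.dom, ∫ x, √(Γ.gamma v v x) ^ (2 : ℝ) ∂μ = 𝓔.form v v := fun v => by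
    rw [Γ.form_eq]
    refine integral_congr_ae ?_
    filter_upwards [Γ.nonneg v] with x hx
    rw [Real.rpow_two, Real.sq_sqrt hx]
  have h1 := integral_mul_le_Lp_mul_Lq_of_nonneg (μ := μ) Real.HolderConjugate.two_two
    (f := fun x => √(Γ.gamma u u x)) (g := fun x => √(Γ.gamma z z x))
    (ae_of_all _ fun x => Real.sqrt_nonneg _) (ae_of_all _ fun x => Real.sqrt_nonneg _)
    (by simpa using hsq u) (by simpa using hsq z)
  rw [hint, hint, ← Real.sqrt_eq_rpow, ← Real.sqrt_eq_rpow] at h1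
  calc ∫ x, |g x * Γ.gamma u z x| ∂μ
      ≤ ∫ x, C * (√(Γ.gamma u u x) * √(Γ.gamma z z x)) ∂μ := by
        refine integral_mono_of_nonneg (ae_of_all _ fun x => abs_nonneg _)
          (((hsq u).integrable_mul (hsq z)).const_mul C) ?_
        filter_upwards [hC, Γ.abs_gamma_le_ae u z] with x h2 h3
        rw [abs_mul]
        exact mul_le_mul h2 h3 (abs_nonneg _) hC0
    _ ≤ _ := by
        rw [integral_const_mul]
        exact mul_le_mul_of_nonneg_left h1 hC0

end CarreDuChamp

end SymmDirichletForm

/-- The complement of the support of a measure is null because the space is hereditarily Lindelöf.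
-/
theorem ae_eq_zero_of_notMem_supp [HereditarilyLindelofSpace E] [OpensMeasurableSpace E]
    {u : E → ℝ} (hu : AEMeasurable u μ) : ∀ᵐ x ∂μ, x ∉ supp μ u → u x = 0 := by
  have h1 : (μ.withDensity fun x => ‖u x‖ₑ) (supp μ u)ᶜ = 0 := Measure.measure_compl_support
  have h2 := (ae_withDensity_iff' hu.enorm).1 (measure_eq_zero_iff_ae_notMem.1 h1)
  filter_upwards [h2] with x hx hxs
  by_contra h
  exact hx (by simpa using h) hxs

theorem supp_subset_of_isClosed [OpensMeasurableSpace E] {u : E → ℝ} {C : Set E}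
    (hC : IsClosed C) (hu : ∀ᵐ x ∂μ, x ∉ C → u x = 0) : supp μ u ⊆ C := by
  rw [← compl_subset_compl]
  refine Measure.subset_compl_support_of_isOpen hC.isOpen_compl ?_
  rw [withDensity_apply _ hC.isOpen_compl.measurableSet]
  refine lintegral_eq_zero_of_ae_eq_zero ?_
  filter_upwards [ae_restrict_of_ae hu, ae_restrict_mem hC.isOpen_compl.measurableSet]
    with x h1 h2
  simp [h1 h2]

end Gamma

/-! ## Locality of the carré du champ -/

section Locality

variable {E : Type*} [MetricSpace E] [LocallyCompactSpace E] [MeasurableSpace E] {μ : Measure E} {𝓔 : SymmDirichletForm μ}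

namespace SymmDirichletForm

/-- Cutoff functions in `D(𝓔) ∩ C_0(E)`. -/
theorem IsRegular.exists_cutoff (hreg : 𝓔.IsRegular) {F O : Set E} (hF : IsCompact F)
    (hO : IsOpen O) (hFO : F ⊆ O) :
    ∃ (f : 𝓔.dom) (g : E → ℝ), Continuous g ∧ HasCompactSupport g ∧ (f : Lp ℝ 2 μ) =ᵐ[μ] g ∧
      (∀ x, 0 ≤ g x ∧ g x ≤ 1) ∧ (∀ x ∈ F, g x = 1) ∧ tsupport g ⊆ O := by
  obtain ⟨L, hL, hFL, hLO⟩ := exists_compact_between hF hO hFO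
  obtain ⟨h, hF1, hL0, hcs, h01⟩ := exists_continuous_one_zero_of_isCompact hF
    isOpen_interior.isClosed_compl (disjoint_compl_right_iff_subset.2 hFL)
  obtain ⟨w, g, hg, hgc, hwg, hhg⟩ := hreg.dense_unif h h.continuous hcs (1 / 4) (by norm_num)
  obtain ⟨p, hp, -⟩ := 𝓔.exists_trunc w (show (0 : ℝ) < 3 / 4 by norm_num)
  obtain ⟨q, hq, -⟩ := 𝓔.exists_trunc w (show (0 : ℝ) < 1 / 4 by norm_num)
  -- `g` is within `1/4` of a Urysohn function `h`. Cutting away the values below `1/4` and above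
  -- `3/4` and rescaling gives exactly 0 where `h = 0` and exactly 1 where `h = 1`.
  let g' : E → ℝ := fun x => 2 * (min (max (g x) 0) (3 / 4) - min (max (g x) 0) (1 / 4))
  have hzero : ∀ x, x ∉ interior L → g' x = 0 := fun x hx => by
    have h1 := abs_lt.1 (hhg x)
    have h2 : h x = 0 := hL0 hx
    have h3 : max (g x) 0 ≤ 1 / 4 := max_le (by linarith) (by norm_num)
    simp only [g']
    rw [min_eq_left h3, min_eq_left (by linarith)]
    ring
  have hsub : Function.support g' ⊆ L := fun x hx => by
    by_contra hxL
    exact hx (hzero x fun h => hxL (interior_subset h))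
  refine ⟨(2 : ℝ) • (p - q), g', by fun_prop, ?_, ?_, ?_, ?_, ?_⟩
  · exact HasCompactSupport.intro hL fun x hx => hzero x fun h => hx (interior_subset h)
  · filter_upwards [hp, hq, hwg, coe_sub_ae p q, coe_smul_ae 2 (p - q)] with x h1 h2 h3 h4 h5
    rw [h5, h4, h1, h2, h3]
  · intro x
    simp only [g']
    have h0 : 0 ≤ max (g x) 0 := le_max_right _ _
    rcases le_total (max (g x) 0) (1 / 4) with h1 | h1
    · rw [min_eq_left h1, min_eq_left (by linarith)]
      norm_num
    · rw [min_eq_right h1]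
      have h2 := min_le_right (max (g x) 0) (3 / 4)
      have h3 : 1 / 4 ≤ min (max (g x) 0) (3 / 4) := le_min h1 (by norm_num)
      constructor <;> linarith
  · intro x hx
    have h1 := abs_lt.1 (hhg x)
    have h2 : h x = 1 := hF1 hx
    have h3 : 3 / 4 ≤ max (g x) 0 := le_max_of_le_left (by linarith)
    simp only [g']
    rw [min_eq_right h3, min_eq_right (by linarith)]
    norm_num
  · exact (closure_minimal hsub hL.isClosed).trans hLO


/-- For a cutoff `f` supported in `O`, both terms `𝓔(u, f u)` and `𝓔(u², f)` of the energy formula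
vanish by strong locality, since `u` and `u²` are constant near `supp f`. Hence `∫ f Γ(u, u) = 0`.
Second countability passes from neighbourhoods of points to `O`. -/
theorem CarreDuChamp.gamma_self_eq_zero_of_const [SecondCountableTopology E] [BorelSpace E]
    (Γ : 𝓔.CarreDuChamp) (hreg : 𝓔.IsRegular)
    (hloc : 𝓔.IsStronglyLocal) (u : 𝓔.dom) (hu : EssBdd μ (u : Lp ℝ 2 μ)) {O : Set E}
    (hO : IsOpen O) {c : ℝ} (hc : ∀ᵐ x ∂μ.restrict O, (u : Lp ℝ 2 μ) x = c) :
    ∀ᵐ x ∂μ, x ∈ O → Γ.gamma u u x = 0 := by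
  rw [ae_iff]
  refine measure_null_of_locally_null _ fun x hx => ?_
  have hxO : x ∈ O := by
    by_contra h
    exact hx fun h' => absurd h' h
  obtain ⟨F, hF, hxF, hFO⟩ := exists_compact_subset hO hxO
  obtain ⟨f, g, hg, hgc, hfg, hg01, hg1, hgO⟩ := hreg.exists_cutoff hF hO hFO
  obtain ⟨v, hv⟩ := exists_sq u hu
  have hc' := (ae_restrict_iff' hO.measurableSet).1 hc
  have hg0 : ∀ y, y ∉ O → g y = 0 := fun y hy => image_eq_zero_of_notMem_tsupport fun h => hy (hgO h)
  have hsupp : supp μ (f : Lp ℝ 2 μ) ⊆ O := by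
    refine (supp_subset_of_isClosed (isClosed_tsupport g) ?_).trans hgO
    filter_upwards [hfg] with y hy hyn
    rw [hy, image_eq_zero_of_notMem_tsupport hyn]
  -- Here `f u = c f`: on `O` one has `u = c`, and off `O` the cutoff vanishes.
  have he := Γ.energy u f v (c • f) g hu hg ⟨1, fun y => by
      rw [abs_of_nonneg (hg01 y).1]; exact (hg01 y).2⟩ hfg hv (by
    filter_upwards [hfg, hc', coe_smul_ae c f] with y h1 h2 h3
    rw [h3, h1]
    by_cases hy : y ∈ O
    · rw [h2 hy, mul_comm]
    · rw [hg0 y hy, zero_mul, mul_zero])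
  have h1 : 𝓔.form u f = 0 := hloc u f c O hO hsupp hc
  have h2 : 𝓔.form v f = 0 := hloc v f (c ^ 2) O hO hsupp (by
    filter_upwards [hc, ae_restrict_of_ae hv] with y h1 h2
    rw [h2, h1])
  rw [map_smul, h1, h2, smul_zero, mul_zero, sub_zero, mul_eq_zero, or_iff_right two_ne_zero,
    integral_eq_zero_iff_of_nonneg_ae] at he
  · refine ⟨F ∩ _, inter_mem (mem_nhdsWithin_of_mem_nhds (mem_interior_iff_mem_nhds.1 hxF))
      self_mem_nhdsWithin, ?_⟩
    rw [measure_eq_zero_iff_ae_notMem]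
    filter_upwards [he] with y hy
    rintro ⟨hyF, hy'⟩
    refine hy' fun _ => ?_
    simpa [hg1 y hyF] using hy
  · filter_upwards [Γ.nonneg u] with y hy using mul_nonneg (hg01 y).1 hy
  · exact (Γ.integrable u u).bdd_mul (c := 1) hg.aestronglyMeasurable (ae_of_all _ fun y => by
      rw [Real.norm_eq_abs, abs_of_nonneg (hg01 y).1]; exact (hg01 y).2)

theorem CarreDuChamp.gamma_eq_zero_of_const [SecondCountableTopology E] [BorelSpace E]
    (Γ : 𝓔.CarreDuChamp) (hreg : 𝓔.IsRegular)
    (hloc : 𝓔.IsStronglyLocal) (u z : 𝓔.dom) (hu : EssBdd μ (u : Lp ℝ 2 μ)) {O : Set E}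
    (hO : IsOpen O) {c : ℝ} (hc : ∀ᵐ x ∂μ, x ∈ O → (u : Lp ℝ 2 μ) x = c) :
    ∀ᵐ x ∂μ, x ∈ O → Γ.gamma u z x = 0 := by
  filter_upwards [Γ.gamma_self_eq_zero_of_const hreg hloc u hu hO
    ((ae_restrict_iff' hO.measurableSet).2 hc), Γ.gamma_sq_le_ae u z] with x h1 h2 hx
  rw [h1 hx, zero_mul] at h2
  exact pow_eq_zero_iff two_ne_zero |>.1 (le_antisymm h2 (sq_nonneg _))

end SymmDirichletForm
end Locality
/-! ## The chain rule for the carré du champ -/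

section Limit

variable {E : Type*} [TopologicalSpace E] [MeasurableSpace E] {μ : Measure E}
  {𝓔 : SymmDirichletForm μ}

namespace SymmDirichletForm

namespace CarreDuChamp

variable (Γ : 𝓔.CarreDuChamp)

/-- If `v k` is bounded in energy, converges in `L²`, and `Γ(v k, z)` converges in `L¹` for all `z`,
then these limits are the carré du champ of the limit. -/
theorem exists_of_tendsto {v : ℕ → 𝓔.dom} {C : ℝ} (hC : ∀ k, 𝓔.form (v k) (v k) ≤ C)
    {y : Lp ℝ 2 μ} (hy : Tendsto (fun k => (v k : Lp ℝ 2 μ)) atTop (𝓝 y)) {G : 𝓔.dom → E → ℝ}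
    (hG : ∀ z, Integrable (G z) μ)
    (hlim : ∀ z, Tendsto (fun k => ∫ x, |Γ.gamma (v k) z x - G z x| ∂μ) atTop (𝓝 0)) :
    ∃ w : 𝓔.dom, (w : Lp ℝ 2 μ) = y ∧ ∀ z, ∀ᵐ x ∂μ, Γ.gamma w z x = G z x := by
  obtain ⟨w, hw, hweak⟩ := exists_energy_limit hC hy
  refine ⟨w, hw, fun z => ?_⟩
  refine (Γ.integrable w z).ae_eq_of_forall_setIntegral_eq _ _ (hG z) fun s hs _ => ?_
  -- Integration of `Γ(·, z)` over a set `s` is bounded in energy, so it converges along the weakly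
  -- convergent sequence. The assumed `L¹` limit gives a second value for the same limit, and
  -- letting `s` vary identifies the densities.
  let ℓ : 𝓔.dom →ₗ[ℝ] ℝ :=
    { toFun := fun u => ∫ x in s, Γ.gamma u z x ∂μ
      map_add' := fun u u' => by
        rw [← integral_add (Γ.integrable u z).integrableOn (Γ.integrable u' z).integrableOn]
        exact integral_congr_ae (ae_restrict_of_ae (Γ.gamma_add_left_ae u u' z))
      map_smul' := fun c u => by
        rw [RingHom.id_apply, smul_eq_mul, ← integral_const_mul]
        exact integral_congr_ae (ae_restrict_of_ae (Γ.gamma_smul_left_ae c u z)) }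
  have hℓ : ∀ u, |ℓ u| ≤ √(𝓔.form z z) * √(𝓔.form u u) := fun u => by
    have h1 := Γ.abs_integral_mul_gamma_le u z (g := fun _ => 1) (C := 1)
      (ae_of_all _ fun _ => by simp) zero_le_one
    simp only [one_mul] at h1
    calc |ℓ u| ≤ ∫ x in s, |Γ.gamma u z x| ∂μ := abs_integral_le_integral_abs
      _ ≤ ∫ x, |Γ.gamma u z x| ∂μ :=
        setIntegral_le_integral (Γ.integrable u z).abs (ae_of_all _ fun _ => abs_nonneg _)
      _ ≤ _ := h1
      _ = _ := mul_comm _ _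
  refine tendsto_nhds_unique (hweak ℓ ⟨_, Real.sqrt_nonneg _, hℓ⟩) ?_
  rw [tendsto_iff_norm_sub_tendsto_zero]
  refine squeeze_zero (fun _ => norm_nonneg _) (fun k => ?_) (hlim z)
  have hint := (Γ.integrable (v k) z).sub (hG z)
  change ‖∫ x in s, Γ.gamma (v k) z x ∂μ - _‖ ≤ _
  rw [← integral_sub (Γ.integrable (v k) z).integrableOn (hG z).integrableOn]
  exact abs_integral_le_integral_abs.trans
    (setIntegral_le_integral hint.abs (ae_of_all _ fun _ => abs_nonneg _))

end CarreDuChamp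

/-- `g` is a continuous version of `u` with compact support. -/
structure IsCoreVersion (u : 𝓔.dom) (g : E → ℝ) : Prop where
  continuous : Continuous g
  hasCompactSupport : HasCompactSupport g
  ae_eq : ∀ᵐ x ∂μ, (u : Lp ℝ 2 μ) x = g x

theorem IsCoreVersion.exists_bound {u : 𝓔.dom} {g : E → ℝ} (h : IsCoreVersion u g) :
    ∃ C : ℝ, 0 < C ∧ ∀ x, |g x| ≤ C := by
  obtain ⟨C, hC⟩ := h.hasCompactSupport.exists_bound_of_continuous h.continuous
  exact ⟨max C 1, by positivity, fun x => (hC x).trans (le_max_left _ _)⟩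

theorem IsCoreVersion.essBdd {u : 𝓔.dom} {g : E → ℝ} (h : IsCoreVersion u g) :
    EssBdd μ (u : Lp ℝ 2 μ) := by
  obtain ⟨C, -, hC⟩ := h.exists_bound
  exact ⟨C, by filter_upwards [h.ae_eq] with x hx; rw [hx]; exact hC x⟩

theorem IsCoreVersion.add {u v : 𝓔.dom} {g k : E → ℝ} (hu : IsCoreVersion u g)
    (hv : IsCoreVersion v k) : IsCoreVersion (u + v) (fun x => g x + k x) where
  continuous := hu.continuous.add hv.continuous
  hasCompactSupport := hu.hasCompactSupport.add hv.hasCompactSupport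
  ae_eq := by
    filter_upwards [hu.ae_eq, hv.ae_eq, coe_add_ae u v] with x h1 h2 h3
    rw [h3, h1, h2]

theorem IsCoreVersion.smul (c : ℝ) {u : 𝓔.dom} {g : E → ℝ} (hu : IsCoreVersion u g) :
    IsCoreVersion (c • u) (fun x => c * g x) where
  continuous := continuous_const.mul hu.continuous
  hasCompactSupport := hu.hasCompactSupport.mul_left
  ae_eq := by
    filter_upwards [hu.ae_eq, coe_smul_ae c u] with x h1 h3
    rw [h3, h1]

end SymmDirichletForm

open Classical in
-- Counterpart of `riemann_min_bounds` for the derivative: `1_{x < a}` is the derivative of `min x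
-- a` in `x`, and its integral over `a` in `[0, j h]` is `j h - x`.
theorem abs_riemann_count_sub_le {h : ℝ} (hh : 0 < h) (j : ℕ) : ∀ x : ℝ, 0 ≤ x → x ≤ j * h →
    |h * ∑ i ∈ Finset.range j, (if x < (i + 1 : ℕ) * h then (1 : ℝ) else 0) - (j * h - x)| ≤ h := by
  induction j with
  | zero =>
    intro x h0 h1
    have : x = 0 := le_antisymm (by simpa using h1) h0
    simp [this, hh.le]
  | succ j ih =>
    intro x h0 h1
    rw [Finset.sum_range_succ]
    by_cases hx : x ≤ j * h
    · have h2 := ih x h0 hx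
      rw [if_pos (show x < ((j + 1 : ℕ) : ℝ) * h by push_cast; linarith)]
      convert h2 using 2
      push_cast
      ring
    · push Not at hx
      rw [Finset.sum_eq_zero, zero_add]
      · push_cast at h1 ⊢
        split_ifs
        · rw [abs_le]; constructor <;> linarith
        · rw [abs_le]; constructor <;> linarith
      · intro i hi
        rw [if_neg]
        have hij : ((i + 1 : ℕ) : ℝ) ≤ j := by exact_mod_cast Finset.mem_range.1 hi
        have h3 : ((i + 1 : ℕ) : ℝ) * h ≤ j * h := mul_le_mul_of_nonneg_right hij hh.le
        linarith

end Limit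

/-! ### Truncations, squares and products of continuous elements -/

section ChainRule

variable {E : Type*} [MetricSpace E] [LocallyCompactSpace E] [SecondCountableTopology E]
  [MeasurableSpace E] [BorelSpace E] {μ : Measure E}
  {𝓔 : SymmDirichletForm μ}

namespace SymmDirichletForm

variable (Γ : 𝓔.CarreDuChamp) (hreg : 𝓔.IsRegular) (hloc : 𝓔.IsStronglyLocal)
include hreg hloc

open Classical in
-- Continuity of `g` makes `{g < a}` and `{g > a}` open. On the first `v - u` vanishes, on the
-- second `v` is constant, so locality decides `Γ(v, z)` there; the remaining level set is null.
theorem IsCoreVersion.gamma_min {u : 𝓔.dom} {g : E → ℝ} (hu : IsCoreVersion u g) {a : ℝ}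
    (ha : μ {x | g x = a} = 0) {v : 𝓔.dom}
    (hv : ∀ᵐ x ∂μ, (v : Lp ℝ 2 μ) x = min ((u : Lp ℝ 2 μ) x) a) (z : 𝓔.dom) :
    ∀ᵐ x ∂μ, Γ.gamma v z x = (if g x < a then 1 else 0) * Γ.gamma u z x := by
  have hvb : EssBdd μ (v : Lp ℝ 2 μ) := by
    obtain ⟨C, hC⟩ := hu.essBdd
    refine ⟨C + |a|, ?_⟩
    filter_upwards [hC, hv] with x h1 h2
    rw [h2]
    have := abs_le.1 h1
    have h3 := neg_abs_le a
    have h4 := le_abs_self a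
    have h5 := abs_nonneg a
    rw [abs_le]
    refine ⟨le_min (by linarith) (by linarith), (min_le_left _ _).trans (by linarith)⟩
  have hdb : EssBdd μ ((v - u : 𝓔.dom) : Lp ℝ 2 μ) := by
    refine (hvb.add (hu.essBdd.const_mul (-1))).congr ?_
    filter_upwards [coe_sub_ae v u] with x h1
    rw [h1]; ring
  have h1 := Γ.gamma_eq_zero_of_const hreg hloc v z hvb
    (O := {x | a < g x}) (isOpen_lt continuous_const hu.continuous) (c := a) (by
      filter_upwards [hv, hu.ae_eq] with x h1 h2 h3
      rw [h1, h2, min_eq_right (le_of_lt h3)])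
  have h2 := Γ.gamma_eq_zero_of_const hreg hloc (v - u) z hdb
    (O := {x | g x < a}) (isOpen_lt hu.continuous continuous_const) (c := 0) (by
      filter_upwards [hv, hu.ae_eq, coe_sub_ae v u] with x h1 h2 h3 h4
      rw [h3, h1, h2, min_eq_left (le_of_lt h4), sub_self])
  filter_upwards [h1, h2, Γ.gamma_sub_left_ae v u z, measure_eq_zero_iff_ae_notMem.1 ha]
    with x h1 h2 h3 h4
  rcases lt_trichotomy (g x) a with h | h | h
  · rw [if_pos h, one_mul]
    have := h2 h
    linarith
  · exact absurd h h4
  · rw [if_neg h.not_gt, zero_mul, h1 h]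

open Classical in
-- By `gamma_min`, `Γ` of the Riemann sum of truncations is `Γ(u, z)` times a count of levels, which
-- tends uniformly to `M - g`. Thus `M u - u²/2` has carré du champ `(M - g) Γ(u, z)`.
theorem IsCoreVersion.exists_sq_of_nonneg [IsFiniteMeasureOnCompacts μ] {u : 𝓔.dom} {g : E → ℝ}
    (hu : IsCoreVersion u g)
    (h0 : ∀ x, 0 ≤ g x) : ∃ w : 𝓔.dom, IsCoreVersion w (fun x => g x ^ 2) ∧
      ∀ z, ∀ᵐ x ∂μ, Γ.gamma w z x = 2 * g x * Γ.gamma u z x := by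
  obtain ⟨C, hC0, hC⟩ := hu.exists_bound
  -- Only countably many level sets of `g` have positive measure, so some `M` above the bound of `g`
  -- makes all the levels `(i + 1) M / (j + 1)` null.
  obtain ⟨M, hMC, hM⟩ : ∃ M : ℝ, C < M ∧ ∀ j i : ℕ,
      μ {x | g x = (i + 1 : ℕ) * (M / (j + 1 : ℕ))} = 0 := by
    have hbad : {t : ℝ | 0 < μ {x | g x = t}}.Countable :=
      Measure.countable_meas_level_set_pos hu.continuous.measurable
    have hcount : (⋃ j : ℕ, ⋃ i : ℕ, (fun M : ℝ => (i + 1 : ℕ) * (M / (j + 1 : ℕ))) ⁻¹'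
        {t : ℝ | 0 < μ {x | g x = t}}).Countable := by
      refine countable_iUnion fun j => countable_iUnion fun i => hbad.preimage ?_
      intro a b hab
      have hi : ((i + 1 : ℕ) : ℝ) ≠ 0 := by positivity
      have hj : ((j + 1 : ℕ) : ℝ) ≠ 0 := by positivity
      exact (div_left_inj' hj).1 (mul_left_cancel₀ hi hab)
    obtain ⟨M, hM1, hM2⟩ := (hcount.dense_compl ℝ).exists_mem_open isOpen_Ioi ⟨C + 1, lt_add_one C⟩
    refine ⟨M, hM2, fun j i => ?_⟩
    simp only [mem_compl_iff, mem_iUnion, mem_preimage, mem_ofPred_eq, not_exists] at hM1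
    exact not_lt.1 (hM1 j i) |>.antisymm bot_le
  have hM0 : 0 < M := hC0.trans hMC
  have hgM : ∀ x, g x ≤ M := fun x => (le_abs_self _).trans ((hC x).trans hMC.le)
  obtain ⟨T, y, B, hT, hy, hE, hlim⟩ := exists_riemann_sums u hM0 (by
    filter_upwards [hu.ae_eq] with x hx
    rw [hx]
    exact ⟨h0 x, hgM x⟩)
  have hG : ∀ z, Integrable (fun x => (M - g x) * Γ.gamma u z x) μ := fun z => by
    refine (Γ.integrable u z).bdd_mul (c := M) (by
      exact (continuous_const.sub hu.continuous).aestronglyMeasurable) (ae_of_all _ fun x => ?_)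
    rw [Real.norm_eq_abs, abs_le]
    have := h0 x
    have := hgM x
    constructor <;> linarith
  obtain ⟨w, hw, hwG⟩ := Γ.exists_of_tendsto hE hlim hG fun z => by
    have h1 : Tendsto (fun j : ℕ => M / (j + 1 : ℕ) * ∫ x, |Γ.gamma u z x| ∂μ) atTop (𝓝 0) := by
      have : Tendsto (fun j : ℕ => M / (j + 1 : ℕ)) atTop (𝓝 0) :=
        (tendsto_const_div_atTop_nhds_zero_nat M).comp (tendsto_add_atTop_nat 1)
      simpa using this.mul_const (∫ x, |Γ.gamma u z x| ∂μ)
    refine squeeze_zero (fun j => integral_nonneg fun x => abs_nonneg _) (fun j => ?_) h1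
    rw [← integral_const_mul]
    refine integral_mono_ae ((Γ.integrable _ z).sub (hG z)).abs
      ((Γ.integrable u z).abs.const_mul _) ?_
    have h2 : ∀ᵐ x ∂μ, ∀ i, Γ.gamma (T j i) z x =
        (if g x < (i + 1 : ℕ) * (M / (j + 1 : ℕ)) then 1 else 0) * Γ.gamma u z x :=
      ae_all_iff.2 fun i => hu.gamma_min Γ hreg hloc (hM j i) (hT j i) z
    have h3 : ∀ᵐ x ∂μ, Γ.gamma (∑ i ∈ Finset.range (j + 1), T j i) z x =
        ∑ i ∈ Finset.range (j + 1), Γ.gamma (T j i) z x := by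
      rw [map_sum, LinearMap.sum_apply]
      exact ae_all_coeFn_sum _ _
    filter_upwards [h2, h3, Γ.gamma_smul_left_ae (M / (j + 1 : ℕ))
      (∑ i ∈ Finset.range (j + 1), T j i) z] with x h2 h3 h4
    have hh : 0 < M / (j + 1 : ℕ) := by positivity
    have hjh : ((j + 1 : ℕ) : ℝ) * (M / (j + 1 : ℕ)) = M := mul_div_cancel₀ M (by positivity)
    have h5 := abs_riemann_count_sub_le hh (j + 1) (g x) (h0 x) (by rw [hjh]; exact hgM x)
    rw [hjh] at h5
    rw [h4, h3, Finset.sum_congr rfl fun i _ => h2 i, ← Finset.sum_mul, ← mul_assoc, ← sub_mul,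
      abs_mul]
    exact mul_le_mul_of_nonneg_right h5 (abs_nonneg _)
  refine ⟨(2 : ℝ) • (M • u - w), ⟨hu.continuous.pow 2, ?_, ?_⟩, fun z => ?_⟩
  · exact hu.hasCompactSupport.comp_left (g := fun y : ℝ => y ^ 2) (by norm_num)
  · filter_upwards [hy, hu.ae_eq, coe_sub_ae (M • u) w, coe_smul_ae M u,
      coe_smul_ae 2 (M • u - w)] with x h1 h2 h3 h4 h5
    rw [h5, h3, h4, hw, h1, h2]
    ring
  · filter_upwards [hwG z, Γ.gamma_sub_left_ae (M • u) w z, Γ.gamma_smul_left_ae M u z,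
      Γ.gamma_smul_left_ae 2 (M • u - w) z] with x h1 h2 h3 h4
    rw [h4, h2, h3, h1]
    ring

/-- Let `k` be a cutoff equal to 1 on the support of `g`. Then `g + M k ≥ 0` and `g² = (g + M k)² -
2 M g - M² k²`, where both squares are of non-negative functions. In the formula for `Γ` the terms
with `Γ(c, z)` go away where `g ≠ 0`, since `k = 1` on that open set. -/
theorem IsCoreVersion.exists_sq [IsFiniteMeasureOnCompacts μ] {u : 𝓔.dom} {g : E → ℝ}
    (hu : IsCoreVersion u g) : ∃ w : 𝓔.dom, IsCoreVersion w (fun x => g x ^ 2) ∧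
      ∀ z, ∀ᵐ x ∂μ, Γ.gamma w z x = 2 * g x * Γ.gamma u z x := by
  obtain ⟨M, hM0, hM⟩ := hu.exists_bound
  obtain ⟨c, k, hk, hkc, hck, hk01, hk1, -⟩ := hreg.exists_cutoff hu.hasCompactSupport isOpen_univ
    (subset_univ _)
  have hc : IsCoreVersion c k := ⟨hk, hkc, hck⟩
  have hgk : ∀ x, g x ≠ 0 → k x = 1 := fun x hx => hk1 x (subset_tsupport g hx)
  have hsum := hu.add (hc.smul M)
  obtain ⟨w, hw, hwΓ⟩ := hsum.exists_sq_of_nonneg Γ hreg hloc fun x => by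
    by_cases hx : g x = 0
    · rw [hx, zero_add]; exact mul_nonneg hM0.le (hk01 x).1
    · rw [hgk x hx]; have := abs_le.1 (hM x); linarith
  obtain ⟨w', hw', hwΓ'⟩ := hc.exists_sq_of_nonneg Γ hreg hloc fun x => (hk01 x).1
  have key := (hw.add (hu.smul (-(2 * M)))).add (hw'.smul (-M ^ 2))
  have heq : (fun x => (g x + M * k x) ^ 2 + -(2 * M) * g x + -M ^ 2 * k x ^ 2) =
      fun x => g x ^ 2 := by
    ext x
    by_cases hx : g x = 0
    · rw [hx]; ring
    · rw [hgk x hx]; ring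
  rw [heq] at key
  refine ⟨_, key, fun z => ?_⟩
  have h1 := Γ.gamma_eq_zero_of_const hreg hloc u z hu.essBdd (O := (tsupport g)ᶜ)
    (isClosed_tsupport g).isOpen_compl (c := 0) (by
      filter_upwards [hu.ae_eq] with x hx hxs
      rw [hx, image_eq_zero_of_notMem_tsupport hxs])
  have h2 := Γ.gamma_eq_zero_of_const hreg hloc c z hc.essBdd (O := {x | g x ≠ 0})
    (isOpen_ne_fun hu.continuous continuous_const) (c := 1) (by
      filter_upwards [hc.ae_eq] with x hx hxs
      rw [hx, hgk x hxs])
  filter_upwards [h1, h2, hwΓ z, hwΓ' z, Γ.gamma_add_left_ae (w + -(2 * M) • u) (-M ^ 2 • w') z,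
    Γ.gamma_add_left_ae w (-(2 * M) • u) z, Γ.gamma_smul_left_ae (-(2 * M)) u z,
    Γ.gamma_smul_left_ae (-M ^ 2) w' z, Γ.gamma_add_left_ae u (M • c) z,
    Γ.gamma_smul_left_ae M c z] with x h1 h2 h3 h4 h5 h6 h7 h8 h9 h10
  rw [h5, h6, h7, h8, h3, h4, h9, h10]
  by_cases hx : g x = 0
  · rw [hx]
    by_cases hs : x ∈ tsupport g
    · rw [hk1 x hs]; ring
    · rw [h1 hs]; ring
  · rw [hgk x hx, h2 hx]; ring

theorem IsCoreVersion.exists_mul [IsFiniteMeasureOnCompacts μ] {u v : 𝓔.dom} {g k : E → ℝ}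
    (hu : IsCoreVersion u g) (hv : IsCoreVersion v k) :
    ∃ w : 𝓔.dom, IsCoreVersion w (fun x => g x * k x) ∧
      ∀ z, ∀ᵐ x ∂μ, Γ.gamma w z x = g x * Γ.gamma v z x + k x * Γ.gamma u z x := by
  obtain ⟨a, ha, haΓ⟩ := hu.exists_sq Γ hreg hloc
  obtain ⟨b, hb, hbΓ⟩ := hv.exists_sq Γ hreg hloc
  obtain ⟨c, hc, hcΓ⟩ := (hu.add hv).exists_sq Γ hreg hloc
  have key := ((hc.add (ha.smul (-1))).add (hb.smul (-1))).smul 2⁻¹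
  have heq : (fun x => 2⁻¹ * ((g x + k x) ^ 2 + -1 * g x ^ 2 + -1 * k x ^ 2)) =
      fun x => g x * k x := by
    ext x; ring
  rw [heq] at key
  refine ⟨_, key, fun z => ?_⟩
  filter_upwards [haΓ z, hbΓ z, hcΓ z, Γ.gamma_smul_left_ae 2⁻¹ (c + (-1 : ℝ) • a + (-1 : ℝ) • b) z,
    Γ.gamma_add_left_ae (c + (-1 : ℝ) • a) ((-1 : ℝ) • b) z,
    Γ.gamma_add_left_ae c ((-1 : ℝ) • a) z, Γ.gamma_smul_left_ae (-1) a z,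
    Γ.gamma_smul_left_ae (-1) b z, Γ.gamma_add_left_ae u v z] with x h1 h2 h3 h4 h5 h6 h7 h8 h9
  rw [h4, h5, h6, h7, h8, h1, h2, h3, h9]
  ring

end SymmDirichletForm
end ChainRule
-- Polynomial approximation of `C¹` functions
-- The factor `X` normalizes the antiderivative to vanish at 0. Constants need not lie in the
-- domain, and vanishing at 0 preserves compact support under composition.
theorem exists_polynomial_antiderivative (q : Polynomial ℝ) :
    ∃ p : Polynomial ℝ, (Polynomial.X * p).derivative = q := by
  induction q using Polynomial.induction_on' with
  | add p q hp hq =>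
    obtain ⟨p', hp'⟩ := hp
    obtain ⟨q', hq'⟩ := hq
    exact ⟨p' + q', by rw [mul_add, Polynomial.derivative_add, hp', hq']⟩
  | monomial n a =>
    refine ⟨Polynomial.monomial n (a / (n + 1)), ?_⟩
    rw [Polynomial.X_mul_monomial, Polynomial.derivative_monomial]
    congr 1
    push_cast
    field_simp

/-- A `C¹` function vanishing at `0` is approximated on bounded intervals by polynomials vanishing
at `0`, together with the derivative. -/
theorem exists_polynomial_near {η : ℝ → ℝ} (hη : ContDiff ℝ 1 η) (hη0 : η 0 = 0) {M ε : ℝ}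
    (hM : 0 ≤ M) (hε : 0 < ε) : ∃ p : Polynomial ℝ, ∀ x ∈ Icc (-M) M,
      |(Polynomial.X * p).derivative.eval x - deriv η x| ≤ ε ∧
      |(Polynomial.X * p).eval x - η x| ≤ ε * |x| := by
  obtain ⟨q, hq⟩ := exists_polynomial_near_of_continuousOn (-M) M (deriv η)
    (hη.continuous_deriv le_rfl).continuousOn ε hε
  obtain ⟨p, hp⟩ := exists_polynomial_antiderivative q
  have hdiff : ∀ x, HasDerivAt (fun y => (Polynomial.X * p).eval y - η y)
      (q.eval x - deriv η x) x := fun x => by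
    have h1 := (Polynomial.X * p).hasDerivAt x
    rw [hp] at h1
    exact h1.sub (hη.differentiable one_ne_zero x).hasDerivAt
  refine ⟨p, fun x hx => ⟨by rw [hp]; exact (hq x hx).le, ?_⟩⟩
  -- The mean value inequality from 0 gives an error proportional to `|x|`, as needed for
  -- convergence in `L²` of an infinite measure.
  have h := Convex.norm_image_sub_le_of_norm_deriv_le (C := ε) (s := Icc (-M) M) (x := 0) (y := x)
    (fun y _ => (hdiff y).differentiableAt) (fun y hy => by
      rw [(hdiff y).deriv]; exact (hq y hy).le) (convex_Icc _ _)
    ⟨by linarith, hM⟩ hx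
  simpa [hη0] using h

/-! ### From polynomials to `C¹` functions -/

section ChainRule

variable {E : Type*} [MetricSpace E] [LocallyCompactSpace E] [SecondCountableTopology E]
  [MeasurableSpace E] [BorelSpace E] {μ : Measure E} [IsFiniteMeasureOnCompacts μ]
  {𝓔 : SymmDirichletForm μ}

namespace SymmDirichletForm

variable (Γ : 𝓔.CarreDuChamp) (hreg : 𝓔.IsRegular) (hloc : 𝓔.IsStronglyLocal)
include hreg hloc

/-- Induction on the degree: one more factor `X` is a product with `u`, handled by
`IsCoreVersion.exists_mul`. -/
theorem IsCoreVersion.exists_polynomial {u : 𝓔.dom} {g : E → ℝ} (hu : IsCoreVersion u g)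
    (p : Polynomial ℝ) : ∃ w : 𝓔.dom, IsCoreVersion w (fun x => (Polynomial.X * p).eval (g x)) ∧
      ∀ z, ∀ᵐ x ∂μ, Γ.gamma w z x = (Polynomial.X * p).derivative.eval (g x) * Γ.gamma u z x := by
  induction p using Polynomial.induction_on with
  | C a =>
    have h := hu.smul a
    refine ⟨a • u, ?_, fun z => ?_⟩
    · simp only [Polynomial.eval_mul, Polynomial.eval_X, Polynomial.eval_C]
      simpa only [mul_comm] using h
    · filter_upwards [Γ.gamma_smul_left_ae a u z] with x hx
      rw [hx, Polynomial.derivative_mul, Polynomial.derivative_X, Polynomial.derivative_C]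
      simp only [one_mul, mul_zero, add_zero, Polynomial.eval_C]
  | add p q hp hq =>
    obtain ⟨v, hv, hvΓ⟩ := hp
    obtain ⟨w, hw, hwΓ⟩ := hq
    refine ⟨v + w, by simpa [mul_add] using hv.add hw, fun z => ?_⟩
    filter_upwards [hvΓ z, hwΓ z, Γ.gamma_add_left_ae v w z] with x h1 h2 h3
    rw [h3, h1, h2, mul_add, Polynomial.derivative_add, Polynomial.eval_add, add_mul]
  | monomial n a ih =>
    obtain ⟨v, hv, hvΓ⟩ := ih
    obtain ⟨w, hw, hwΓ⟩ := hu.exists_mul Γ hreg hloc hv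
    have heq : (Polynomial.X * (Polynomial.C a * Polynomial.X ^ (n + 1)) : Polynomial ℝ) =
        Polynomial.X * (Polynomial.X * (Polynomial.C a * Polynomial.X ^ n)) := by ring
    refine ⟨w, ?_, fun z => ?_⟩
    · rw [heq]
      simp only [Polynomial.eval_mul (p := Polynomial.X)
        (q := Polynomial.X * (Polynomial.C a * Polynomial.X ^ n)), Polynomial.eval_X]
      exact hw
    · filter_upwards [hvΓ z, hwΓ z] with x h1 h2
      rw [h2, h1, heq]
      generalize (Polynomial.X * (Polynomial.C a * Polynomial.X ^ n) : Polynomial ℝ) = r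
      rw [Polynomial.derivative_mul, Polynomial.derivative_X, Polynomial.eval_add,
        Polynomial.eval_mul, Polynomial.eval_mul, Polynomial.eval_one, Polynomial.eval_X]
      ring

omit [LocallyCompactSpace E] [SecondCountableTopology E] [BorelSpace E]
  [IsFiniteMeasureOnCompacts μ] hreg hloc in
-- Using the formula for `z = w` and again for `z = u` gives `Γ(w, w) = q² Γ(u, u)`. This supplies
-- the energy bounds for the weak limits below.
theorem form_le_of_gamma {u w : 𝓔.dom} {q : E → ℝ} {L : ℝ} (hL : ∀ᵐ x ∂μ, |q x| ≤ L)
    (h : ∀ z, ∀ᵐ x ∂μ, Γ.gamma w z x = q x * Γ.gamma u z x) :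
    𝓔.form w w ≤ L ^ 2 * 𝓔.form u u := by
  rw [Γ.form_eq, Γ.form_eq, ← integral_const_mul]
  refine integral_mono_ae (Γ.integrable w w) ((Γ.integrable u u).const_mul _) ?_
  filter_upwards [hL, h w, h u, Γ.nonneg u] with x h1 h2 h3 h4
  rw [h2, Γ.symm u w, h3, ← mul_assoc, ← sq, ← sq_abs]
  have := abs_nonneg (q x)
  gcongr

/-- Polynomials close to `η` together with their derivatives on the range of `g` give elements of
bounded energy converging in `L²`. Their carré du champ converges in `L¹` because the derivatives
converge uniformly. -/
theorem IsCoreVersion.exists_comp {u : 𝓔.dom} {g : E → ℝ} (hu : IsCoreVersion u g)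
    {η : ℝ → ℝ} (hη : ContDiff ℝ 1 η) (hη0 : η 0 = 0) :
    ∃ w : 𝓔.dom, (∀ᵐ x ∂μ, (w : Lp ℝ 2 μ) x = η (g x)) ∧
      ∀ z, ∀ᵐ x ∂μ, Γ.gamma w z x = deriv η (g x) * Γ.gamma u z x := by
  obtain ⟨M, hM0, hM⟩ := hu.exists_bound
  have hgM : ∀ x, g x ∈ Icc (-M) M := fun x => abs_le.1 (hM x)
  have hd : Continuous (deriv η) := hη.continuous_deriv le_rfl
  obtain ⟨L, hL⟩ := isCompact_Icc.exists_bound_of_continuousOn (s := Icc (-M) M) hd.continuousOn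
  have hp : ∀ k : ℕ, ∃ p : Polynomial ℝ, ∀ x ∈ Icc (-M) M,
      |(Polynomial.X * p).derivative.eval x - deriv η x| ≤ 1 / ((k : ℝ) + 1) ∧
      |(Polynomial.X * p).eval x - η x| ≤ 1 / ((k : ℝ) + 1) * |x| := fun k =>
    exists_polynomial_near hη hη0 hM0.le Nat.one_div_pos_of_nat
  choose p hp using hp
  choose v hv hvΓ using fun k => hu.exists_polynomial Γ hreg hloc (p k)
  have hLg : ∀ x, |deriv η (g x)| ≤ L := fun x => hL _ (hgM x)
  have hymem : MemLp (fun x => η (g x)) 2 μ := by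
    have hc : Continuous fun x => η (g x) := hη.continuous.comp hu.continuous
    exact hc.memLp_of_hasCompactSupport (hu.hasCompactSupport.comp_left hη0)
  have hone : ∀ k : ℕ, 1 / ((k : ℝ) + 1) ≤ 1 := fun k => by
    rw [div_le_one (by positivity)]
    linarith [(Nat.cast_nonneg k : (0 : ℝ) ≤ k)]
  have hE : ∀ k, 𝓔.form (v k) (v k) ≤ (L + 1) ^ 2 * 𝓔.form u u := fun k =>
    form_le_of_gamma Γ (ae_of_all _ fun x => by
      have h1 := (hp k (g x) (hgM x)).1
      have h2 := hLg x
      calc _ = |((Polynomial.X * p k).derivative.eval (g x) - deriv η (g x)) + deriv η (g x)| := by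
            rw [sub_add_cancel]
        _ ≤ _ := abs_add_le _ _
        _ ≤ L + 1 := by linarith [hone k]) (hvΓ k)
  have hlim : Tendsto (fun k => (v k : Lp ℝ 2 μ)) atTop (𝓝 hymem.toLp) := by
    rw [tendsto_iff_norm_sub_tendsto_zero]
    have h0 : Tendsto (fun k : ℕ => 1 / ((k : ℝ) + 1) * ‖(u : Lp ℝ 2 μ)‖) atTop (𝓝 0) := by
      simpa using tendsto_one_div_add_atTop_nhds_zero_nat.mul_const ‖(u : Lp ℝ 2 μ)‖
    refine squeeze_zero (fun _ => norm_nonneg _) (fun k => ?_) h0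
    refine Lp.norm_le_mul_norm_of_ae_le_mul ?_
    filter_upwards [(hv k).ae_eq, hymem.coeFn_toLp, hu.ae_eq,
      Lp.coeFn_sub (v k : Lp ℝ 2 μ) hymem.toLp] with x h1 h2 h3 h4
    rw [h4, Pi.sub_apply, h1, h2, h3]
    exact (hp k (g x) (hgM x)).2
  obtain ⟨w, hw, hwΓ⟩ := Γ.exists_of_tendsto hE hlim (G := fun z x => deriv η (g x) * Γ.gamma u z x)
    (fun z => (Γ.integrable u z).bdd_mul (c := L)
      (hd.comp hu.continuous).aestronglyMeasurable (ae_of_all _ hLg)) fun z => by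
    have h0 : Tendsto (fun k : ℕ => 1 / ((k : ℝ) + 1) * ∫ x, |Γ.gamma u z x| ∂μ) atTop (𝓝 0) := by
      simpa using tendsto_one_div_add_atTop_nhds_zero_nat.mul_const (∫ x, |Γ.gamma u z x| ∂μ)
    refine squeeze_zero (fun j => integral_nonneg fun x => abs_nonneg _) (fun k => ?_) h0
    rw [← integral_const_mul]
    refine integral_mono_of_nonneg (ae_of_all _ fun x => abs_nonneg _)
      ((Γ.integrable u z).abs.const_mul _) ?_
    filter_upwards [hvΓ k z] with x h1
    rw [h1, ← sub_mul, abs_mul]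
    exact mul_le_mul_of_nonneg_right (hp k (g x) (hgM x)).1 (abs_nonneg _)
  refine ⟨w, ?_, hwΓ⟩
  filter_upwards [hymem.coeFn_toLp] with x hx
  rw [hw, hx]

omit [SecondCountableTopology E] [LocallyCompactSpace E] [BorelSpace E]
  [IsFiniteMeasureOnCompacts μ] hloc in
theorem exists_core_seq (u : 𝓔.dom) : ∃ (v : ℕ → 𝓔.dom) (g : ℕ → E → ℝ),
    (∀ k, IsCoreVersion (v k) (g k)) ∧
    Tendsto (fun k => 𝓔.form (v k - u) (v k - u)) atTop (𝓝 0) ∧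
    Tendsto (fun k => (v k : Lp ℝ 2 μ)) atTop (𝓝 u) := by
  choose v g hg hgc hvg hE using fun k : ℕ =>
    hreg.dense_form u (1 / ((k : ℝ) + 1)) Nat.one_div_pos_of_nat
  have hsymm : ∀ k, 𝓔.form (v k - u) (v k - u) = 𝓔.form (u - v k) (u - v k) := fun k => by
    rw [← neg_sub u (v k), map_neg, map_neg, LinearMap.neg_apply, neg_neg]
  refine ⟨v, g, fun k => ⟨hg k, hgc k, hvg k⟩, ?_, ?_⟩
  · refine squeeze_zero (fun k => 𝓔.nonneg _) (fun k => ?_)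
      tendsto_one_div_add_atTop_nhds_zero_nat
    rw [hsymm]
    have := hE k
    nlinarith [sq_nonneg ‖((u - v k : 𝓔.dom) : Lp ℝ 2 μ)‖]
  · rw [tendsto_iff_norm_sub_tendsto_zero]
    have h1 := (Real.continuous_sqrt.tendsto 0).comp
      (tendsto_one_div_add_atTop_nhds_zero_nat (𝕜 := ℝ))
    rw [Real.sqrt_zero] at h1
    refine squeeze_zero (fun k => norm_nonneg _) (fun k => ?_) h1
    rw [Function.comp_apply, norm_sub_rev]
    refine Real.le_sqrt_of_sq_le ?_
    have := hE k
    have h2 := 𝓔.nonneg (u - v k)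
    rw [Submodule.coe_sub] at this
    linarith

/-- The chain rule for the carré du champ. -/
theorem exists_comp (u : 𝓔.dom) {η : ℝ → ℝ} (hη : ContDiff ℝ 1 η) (hη0 : η 0 = 0) {L : ℝ}
    (hL : ∀ r, |deriv η r| ≤ L) :
    ∃ w : 𝓔.dom, (∀ᵐ x ∂μ, (w : Lp ℝ 2 μ) x = η ((u : Lp ℝ 2 μ) x)) ∧
      ∀ z, ∀ᵐ x ∂μ, Γ.gamma w z x = deriv η ((u : Lp ℝ 2 μ) x) * Γ.gamma u z x := by
  have hd : Continuous (deriv η) := hη.continuous_deriv le_rfl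
  have hlip : ∀ a b, |η a - η b| ≤ L * |a - b| := fun a b => by
    have h := Convex.norm_image_sub_le_of_norm_deriv_le (f := η) (C := L) (s := univ) (x := b)
      (y := a) (fun y _ => hη.differentiable one_ne_zero y) (fun y _ => hL y) convex_univ trivial
      trivial
    exact h
  have hL0 : 0 ≤ L := (abs_nonneg _).trans (hL 0)
  obtain ⟨v', g', hv', hvE', hvu'⟩ := exists_core_seq hreg u
  -- An a.e. convergent subsequence is needed so that `deriv η (g k)` converges pointwise.
  obtain ⟨ns, hns, hae⟩ := (tendstoInMeasure_of_tendsto_Lp hvu').exists_seq_tendsto_ae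
  let v : ℕ → 𝓔.dom := fun k => v' (ns k)
  let g : ℕ → E → ℝ := fun k => g' (ns k)
  have hv : ∀ k, IsCoreVersion (v k) (g k) := fun k => hv' _
  have hvE : Tendsto (fun k => 𝓔.form (v k - u) (v k - u)) atTop (𝓝 0) :=
    hvE'.comp hns.tendsto_atTop
  have hvu : Tendsto (fun k => (v k : Lp ℝ 2 μ)) atTop (𝓝 u) := hvu'.comp hns.tendsto_atTop
  choose w hw hwΓ using fun k => (hv k).exists_comp Γ hreg hloc hη hη0
  obtain ⟨B, hB⟩ := (Metric.isBounded_range_of_tendsto _ hvE).exists_norm_le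
  have hEv : ∀ k, 𝓔.form (v k) (v k) ≤ 2 * B + 2 * 𝓔.form u u := fun k => by
    have h1 : 𝓔.form (v k - u) (v k - u) ≤ B := (le_abs_self _).trans (hB _ (mem_range_self k))
    -- `𝓔(v - 2u, v - 2u) ≥ 0` is the inequality `𝓔(v, v) ≤ 2 𝓔(v - u, v - u) + 2 𝓔(u, u)` after
    -- expansion.
    have h2 := 𝓔.nonneg (v k - u - u)
    simp only [map_sub, LinearMap.sub_apply, 𝓔.symm u (v k)] at h1 h2
    linarith
  have hE : ∀ k, 𝓔.form (w k) (w k) ≤ L ^ 2 * (2 * B + 2 * 𝓔.form u u) := fun k =>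
    (form_le_of_gamma Γ (ae_of_all _ fun x => hL _) (hwΓ k)).trans
      (mul_le_mul_of_nonneg_left (hEv k) (sq_nonneg L))
  have hymem : MemLp (fun x => η ((u : Lp ℝ 2 μ) x)) 2 μ := by
    refine (Lp.memLp (u : Lp ℝ 2 μ)).of_le_mul (c := L)
      (hη.continuous.comp_aestronglyMeasurable (Lp.aestronglyMeasurable _)) (ae_of_all _ fun x => ?_)
    have := hlip ((u : Lp ℝ 2 μ) x) 0
    rwa [hη0, sub_zero, sub_zero] at this
  have hlim : Tendsto (fun k => (w k : Lp ℝ 2 μ)) atTop (𝓝 hymem.toLp) := by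
    rw [tendsto_iff_norm_sub_tendsto_zero] at hvu ⊢
    have h0 := hvu.const_mul L
    rw [mul_zero] at h0
    refine squeeze_zero (fun _ => norm_nonneg _) (fun k => ?_) h0
    refine Lp.norm_le_mul_norm_of_ae_le_mul ?_
    filter_upwards [hw k, hymem.coeFn_toLp, (hv k).ae_eq,
      Lp.coeFn_sub (w k : Lp ℝ 2 μ) hymem.toLp, Lp.coeFn_sub (v k : Lp ℝ 2 μ) u] with x h1 h2 h3 h4 h5
    rw [h4, Pi.sub_apply, h1, h2, h5, Pi.sub_apply, h3]
    exact hlip _ _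
  have hmeas : AEStronglyMeasurable (fun x => deriv η ((u : Lp ℝ 2 μ) x)) μ :=
    hd.comp_aestronglyMeasurable (Lp.aestronglyMeasurable _)
  obtain ⟨y, hy, hyΓ⟩ := Γ.exists_of_tendsto hE hlim
    (G := fun z x => deriv η ((u : Lp ℝ 2 μ) x) * Γ.gamma u z x)
    (fun z => (Γ.integrable u z).bdd_mul (c := L) hmeas (ae_of_all _ fun x => hL _)) fun z => by
    -- The difference is split as `η'(g_k) Γ(v_k - u, z) + (η'(g_k) - η'(u)) Γ(u, z)`. The first
    -- term is small in energy, the second by dominated convergence.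
    have h1 : Tendsto (fun k => L * (√(𝓔.form (v k - u) (v k - u)) * √(𝓔.form z z))) atTop
        (𝓝 0) := by
      have := (((Real.continuous_sqrt.tendsto 0).comp hvE).mul_const √(𝓔.form z z)).const_mul L
      simpa using this
    have h2 : Tendsto (fun k => ∫ x, |(deriv η (g k x) - deriv η ((u : Lp ℝ 2 μ) x)) *
        Γ.gamma u z x| ∂μ) atTop (𝓝 (∫ x, (0 : ℝ) ∂μ)) := by
      refine tendsto_integral_of_dominated_convergence (fun x => 2 * L * |Γ.gamma u z x|)
        (fun k => ?_) ((Γ.integrable u z).abs.const_mul _) (fun k => ae_of_all _ fun x => ?_) ?_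
      · exact ((((hd.comp (hv k).continuous).aestronglyMeasurable).sub hmeas).mul
          (Γ.integrable u z).1).norm
      · rw [Real.norm_eq_abs, abs_abs, abs_mul]
        refine mul_le_mul_of_nonneg_right ?_ (abs_nonneg _)
        have h3 := abs_le.1 (hL (g k x))
        have h4 := abs_le.1 (hL ((u : Lp ℝ 2 μ) x))
        rw [abs_le]
        constructor <;> linarith
      · filter_upwards [hae, ae_all_iff.2 fun k => (hv k).ae_eq] with x h3 h4
        have h5 : Tendsto (fun k => g k x) atTop (𝓝 ((u : Lp ℝ 2 μ) x)) :=
          h3.congr fun k => h4 k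
        have h6 := (((hd.tendsto _).comp h5).sub_const (deriv η ((u : Lp ℝ 2 μ) x))).mul_const
          (Γ.gamma u z x)
        rw [sub_self, zero_mul] at h6
        simpa using h6.abs
    rw [integral_zero] at h2
    have h3 := h1.add h2
    rw [add_zero] at h3
    refine squeeze_zero (fun j => integral_nonneg fun x => abs_nonneg _) (fun k => ?_) h3
    have h4 := Γ.abs_integral_mul_gamma_le (v k - u) z (g := fun x => deriv η (g k x))
      (ae_of_all _ fun x => hL _) hL0
    refine le_trans ?_ (add_le_add_left h4 _)
    have hi1 : Integrable (fun x => deriv η (g k x) * Γ.gamma (v k - u) z x) μ :=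
      (Γ.integrable _ z).bdd_mul (c := L)
        (hd.comp (hv k).continuous).aestronglyMeasurable (ae_of_all _ fun x => hL _)
    have hi2 : Integrable (fun x => (deriv η (g k x) - deriv η ((u : Lp ℝ 2 μ) x)) *
        Γ.gamma u z x) μ :=
      (Γ.integrable _ z).bdd_mul (c := L + L)
        (((hd.comp (hv k).continuous).aestronglyMeasurable).sub hmeas)
        (ae_of_all _ fun x => (norm_sub_le _ _).trans (add_le_add (hL _) (hL _)))
    rw [← integral_add hi1.abs hi2.abs]
    refine integral_mono_of_nonneg (ae_of_all _ fun x => abs_nonneg _) (hi1.abs.add hi2.abs) ?_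
    filter_upwards [hwΓ k z, Γ.gamma_sub_left_ae (v k) u z] with x h5 h6
    refine le_trans (le_of_eq ?_) (abs_add_le _ _)
    rw [h5, h6]
    congr 1
    ring
  refine ⟨y, ?_, hyΓ⟩
  filter_upwards [hymem.coeFn_toLp] with x hx
  rw [hy, hx]

end SymmDirichletForm
end ChainRule
-- Primitives and truncated squares
theorem exists_primitive {d : ℝ → ℝ} (hd : Continuous d) : ∃ η : ℝ → ℝ, ContDiff ℝ 1 η ∧
    deriv η = d ∧ ∀ x, η x = ∫ y in (0 : ℝ)..x, d y := by
  have h : ∀ x, HasDerivAt (fun x => ∫ y in (0 : ℝ)..x, d y) (d x) x := fun x =>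
    intervalIntegral.integral_hasDerivAt_right (hd.intervalIntegrable _ _)
      hd.aestronglyMeasurable.stronglyMeasurableAtFilter hd.continuousAt
  have hderiv : deriv (fun x => ∫ y in (0 : ℝ)..x, d y) = d := funext fun x => (h x).deriv
  refine ⟨_, contDiff_one_iff_deriv.2 ⟨fun x => (h x).differentiableAt, ?_⟩, hderiv, fun x => rfl⟩
  rw [hderiv]
  exact hd

/-- The derivative `2x` is clamped to `[-2M, 2M]`, which makes the global Lipschitz chain rule
applicable to squares of functions bounded by `M`. -/
theorem exists_truncated_sq {M : ℝ} (hM : 0 ≤ M) : ∃ η : ℝ → ℝ, ContDiff ℝ 1 η ∧ η 0 = 0 ∧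
    (∀ r, |deriv η r| ≤ 2 * M) ∧ ∀ x, |x| ≤ M → η x = x ^ 2 ∧ deriv η x = 2 * x := by
  have hclamp : ∀ x, |x| ≤ M → max (-M) (min x M) = x := fun x hx => by
    have := abs_le.1 hx
    rw [min_eq_left this.2, max_eq_right this.1]
  obtain ⟨η, hη, hd, hint⟩ := exists_primitive (d := fun x => 2 * max (-M) (min x M)) (by fun_prop)
  refine ⟨η, hη, by simp [hint], fun r => ?_, fun x hx => ⟨?_, ?_⟩⟩
  · rw [hd, abs_mul, abs_two]
    refine mul_le_mul_of_nonneg_left (abs_le.2 ⟨le_max_left _ _, max_le (by linarith) ?_⟩) zero_le_two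
    exact min_le_right _ _
  · rw [hint, intervalIntegral.integral_congr (g := fun y => 2 * y)]
    · rw [intervalIntegral.integral_const_mul, integral_id]
      ring
    · intro y hy
      have hy' : |y| ≤ M := by
        have h1 := abs_sub_left_of_mem_uIcc hy
        rw [sub_zero, sub_zero] at h1
        exact h1.trans hx
      simp only
      rw [hclamp y hy']
  · rw [hd]
    simp only
    rw [hclamp x hx]

/-- Clear for `r > M`; the endpoint `r = M` follows from continuity of the derivative. -/
theorem deriv_eq_zero_of_eq_zero_on_Ici {α : ℝ → ℝ} (hα : ContDiff ℝ 1 α) {M c : ℝ}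
    (h : ∀ r, M ≤ r → α r = c) {r : ℝ} (hr : M ≤ r) : deriv α r = 0 := by
  have hcl : IsClosed {x | deriv α x = 0} :=
    isClosed_eq (hα.continuous_deriv le_rfl) continuous_const
  have hsub : Ioi M ⊆ {x | deriv α x = 0} := fun x hx => by
    have : α =ᶠ[𝓝 x] fun _ => c := by
      filter_upwards [isOpen_Ioi.mem_nhds hx] with y hy using h y (le_of_lt hy)
    simp [this.deriv_eq]
  have := hcl.closure_subset_iff.2 hsub
  rw [closure_Ioi] at this
  exact this hr

/-! ### The Leibniz rule for bounded elements, and functions of `ρ` -/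

section Leibniz

variable {E : Type*} [MetricSpace E] [LocallyCompactSpace E] [SecondCountableTopology E]
  [MeasurableSpace E] [BorelSpace E] {μ : Measure E} [IsFiniteMeasureOnCompacts μ]
  {𝓔 : SymmDirichletForm μ}

namespace SymmDirichletForm

section

variable (Γ : 𝓔.CarreDuChamp) (hreg : 𝓔.IsRegular) (hloc : 𝓔.IsStronglyLocal)
include hreg hloc

/-- For bounded `u` the square is a truncated square, so the chain rule extends the formula from
continuous elements; `gamma_mul` is its polarization. -/
theorem gamma_sq {u w : 𝓔.dom} (hu : EssBdd μ (u : Lp ℝ 2 μ))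
    (hw : ∀ᵐ x ∂μ, (w : Lp ℝ 2 μ) x = (u : Lp ℝ 2 μ) x ^ 2) (z : 𝓔.dom) :
    ∀ᵐ x ∂μ, Γ.gamma w z x = 2 * (u : Lp ℝ 2 μ) x * Γ.gamma u z x := by
  obtain ⟨M, hM0, hM⟩ := hu.exists_pos
  obtain ⟨η, hη, hη0, hL, hsq⟩ := exists_truncated_sq hM0.le
  obtain ⟨w', hw', hΓ⟩ := exists_comp Γ hreg hloc u hη hη0 hL
  have : w = w' := dom_ext (by
    filter_upwards [hw, hw', hM] with x h1 h2 h3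
    rw [h1, h2, (hsq _ h3).1])
  subst this
  filter_upwards [hΓ z, hM] with x h1 h2
  rw [h1, (hsq _ h2).2]

/-- The Leibniz rule for the carré du champ. -/
theorem gamma_mul {u v w : 𝓔.dom} (hu : EssBdd μ (u : Lp ℝ 2 μ)) (hv : EssBdd μ (v : Lp ℝ 2 μ))
    (hw : ∀ᵐ x ∂μ, (w : Lp ℝ 2 μ) x = (u : Lp ℝ 2 μ) x * (v : Lp ℝ 2 μ) x) (z : 𝓔.dom) :
    ∀ᵐ x ∂μ, Γ.gamma w z x =
      (u : Lp ℝ 2 μ) x * Γ.gamma v z x + (v : Lp ℝ 2 μ) x * Γ.gamma u z x := by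
  obtain ⟨a, ha⟩ := exists_sq u hu
  obtain ⟨b, hb⟩ := exists_sq v hv
  have huv : EssBdd μ ((u + v : 𝓔.dom) : Lp ℝ 2 μ) := (hu.add hv).congr (coe_add_ae u v)
  obtain ⟨c, hc⟩ := exists_sq (u + v) huv
  have : w = (2⁻¹ : ℝ) • (c - (a + b)) := dom_ext (by
    filter_upwards [hw, ha, hb, hc, coe_add_ae u v, coe_add_ae a b, coe_sub_ae c (a + b),
      coe_smul_ae (2⁻¹ : ℝ) (c - (a + b))] with x h0 h1 h2 h3 h4 h5 h6 h7
    rw [h0, h7, h6, h5, h3, h4, h1, h2]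
    ring)
  subst this
  filter_upwards [gamma_sq Γ hreg hloc hu ha z, gamma_sq Γ hreg hloc hv hb z,
    gamma_sq Γ hreg hloc huv hc z, coe_add_ae u v, Γ.gamma_smul_left_ae (2⁻¹ : ℝ) (c - (a + b)) z,
    Γ.gamma_sub_left_ae c (a + b) z, Γ.gamma_add_left_ae a b z, Γ.gamma_add_left_ae u v z]
    with x h1 h2 h3 h4 h5 h6 h7 h8
  rw [h5, h6, h7, h1, h2, h3, h4, h8]
  ring

end

/-! ## Functions of the exhaustion function -/

section

omit [LocallyCompactSpace E] [SecondCountableTopology E] [BorelSpace E]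
  [IsFiniteMeasureOnCompacts μ]

variable {N : Lp ℝ 2 μ →ₗ.[ℝ] (E →ₘ[μ] ℝ)} (hN : 𝓔.IsDivFreeDerivation N)

/-- The value of `N` at a bounded element of the domain of the form. -/
def IsDivFreeDerivation.val (u : Lp ℝ 2 μ) (hu : 𝓔.MemBdd u) : E →ₘ[μ] ℝ :=
  N ⟨u, hN.dom_le u hu⟩

theorem IsDivFreeDerivation.val_add {u v w : Lp ℝ 2 μ} (hu : 𝓔.MemBdd u) (hv : 𝓔.MemBdd v)
    (hw : 𝓔.MemBdd w) (h : w = u + v) :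
    ∀ᵐ x ∂μ, hN.val w hw x = hN.val u hu x + hN.val v hv x := by
  have : hN.val w hw = hN.val u hu + hN.val v hv := by
    rw [val, val, val, ← LinearPMap.map_add]
    congr 1
    exact Subtype.ext h
  rw [this]
  exact AEEqFun.coeFn_add _ _

theorem IsDivFreeDerivation.val_smul {u w : Lp ℝ 2 μ} (c : ℝ) (hu : 𝓔.MemBdd u)
    (hw : 𝓔.MemBdd w) (h : w = c • u) :
    ∀ᵐ x ∂μ, hN.val w hw x = c * hN.val u hu x := by
  have : hN.val w hw = c • hN.val u hu := by
    rw [val, val, ← LinearPMap.map_smul]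
    congr 1
    exact Subtype.ext h
  rw [this]
  exact AEEqFun.coeFn_smul _ _

theorem IsDivFreeDerivation.val_mul {u v w : Lp ℝ 2 μ} (hu : 𝓔.MemBdd u) (hv : 𝓔.MemBdd v)
    (hw : 𝓔.MemBdd w) (h : ∀ᵐ x ∂μ, w x = u x * v x) :
    ∀ᵐ x ∂μ, hN.val w hw x = v x * hN.val u hu x + u x * hN.val v hv x :=
  hN.leibniz ⟨u, hN.dom_le u hu⟩ ⟨v, hN.dom_le v hv⟩ ⟨w, hN.dom_le w hw⟩ hu hv hw h

theorem IsDivFreeDerivation.val_eq_zero {u : Lp ℝ 2 μ} (hu : 𝓔.MemBdd u) {c : ℝ} {B : Set E}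
    (hB : MeasurableSet B) (h : ∀ᵐ x ∂μ, x ∈ B → u x = c) :
    ∀ᵐ x ∂μ, x ∈ B → hN.val u hu x = 0 :=
  (ae_restrict_iff' hB).1 (hN.isLocal ⟨u, hN.dom_le u hu⟩ hu c B hB ((ae_restrict_iff' hB).2 h))

omit [MeasurableSpace E] in
theorem isOpen_sublevel {ρ : E → ℝ} (hρ : Continuous ρ) (r : ℝ) : IsOpen (sublevel ρ r) :=
  isOpen_lt hρ continuous_const

omit [MeasurableSpace E] in
theorem closure_sublevel_subset {ρ : E → ℝ} (hρ : Continuous ρ) (r : ℝ) :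
    closure (sublevel ρ r) ⊆ {x | ρ x ≤ r} :=
  closure_minimal (fun x hx => show ρ x ≤ r from le_of_lt hx) (isClosed_le hρ continuous_const)

end

variable (Γ : 𝓔.CarreDuChamp) (hreg : 𝓔.IsRegular) (hloc : 𝓔.IsStronglyLocal)
  {N : Lp ℝ 2 μ →ₗ.[ℝ] (E →ₘ[μ] ℝ)} (hN : 𝓔.IsDivFreeDerivation N)
  {ρ : E → ℝ} (hρ : 𝓔.IsExhaustion ρ)

/-- An element of the domain that agrees with the exhaustion function on `E_{M+1}`. -/
def IsExhaustion.approxDom (hρ : 𝓔.IsExhaustion ρ) (M : ℕ) : 𝓔.dom :=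
  ⟨hρ.approx M, (hρ.approx_spec M).1.1⟩

omit [LocallyCompactSpace E] [SecondCountableTopology E] [IsFiniteMeasureOnCompacts μ] in
theorem IsExhaustion.approxDom_ae (hρ : 𝓔.IsExhaustion ρ) (M : ℕ) :
    ∀ᵐ x ∂μ, ρ x < M + 1 → (hρ.approxDom M : Lp ℝ 2 μ) x = ρ x := by
  have h := (ae_restrict_iff' (isOpen_sublevel hρ.continuous _).measurableSet).1
    (hρ.approx_spec M).2
  filter_upwards [h] with x hx hxM
  exact hx (by simpa [sublevel] using hxM)

omit [LocallyCompactSpace E] [SecondCountableTopology E] [IsFiniteMeasureOnCompacts μ] in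
theorem IsExhaustion.approxDom_memBdd (hρ : 𝓔.IsExhaustion ρ) (M : ℕ) :
    𝓔.MemBdd (hρ.approxDom M : Lp ℝ 2 μ) := (hρ.approx_spec M).1

omit [IsFiniteMeasureOnCompacts μ] in
include hreg hloc in
theorem gamma_congr_of_eq_on {u v : 𝓔.dom} (hu : EssBdd μ (u : Lp ℝ 2 μ))
    (hv : EssBdd μ (v : Lp ℝ 2 μ)) {O : Set E} (hO : IsOpen O)
    (h : ∀ᵐ x ∂μ, x ∈ O → (u : Lp ℝ 2 μ) x = (v : Lp ℝ 2 μ) x) (z : 𝓔.dom) :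
    ∀ᵐ x ∂μ, x ∈ O → Γ.gamma u z x = Γ.gamma v z x := by
  have hb : EssBdd μ ((u - v : 𝓔.dom) : Lp ℝ 2 μ) := by
    refine (hu.add (hv.const_mul (-1))).congr ?_
    filter_upwards [coe_sub_ae u v] with x hx
    rw [hx]; ring
  filter_upwards [Γ.gamma_eq_zero_of_const hreg hloc (u - v) z hb hO (c := 0) (by
    filter_upwards [h, coe_sub_ae u v] with x h1 h2 h3
    rw [h2, h1 h3, sub_self]), Γ.gamma_sub_left_ae u v z] with x h1 h2 h3
  have := h1 h3
  linarith

omit [IsFiniteMeasureOnCompacts μ] in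
include hreg hloc in
-- The definition of `gammaLoc` switches approximant with the integer part of `ρ`. By locality the
-- approximants with index `j ≤ M` have the same carré du champ on `E_{j+1}`, so a single one serves
-- on all of `E_{M+1}`.
theorem CarreDuChamp.gammaLoc_ae (M : ℕ) : ∀ᵐ x ∂μ, ρ x < M + 1 →
    Γ.gammaLoc hρ x = Γ.gamma (hρ.approxDom M) (hρ.approxDom M) x := by
  have h : ∀ j : ℕ, ∀ᵐ x ∂μ, j ≤ M → ρ x < j + 1 →
      Γ.gamma (hρ.approxDom j) (hρ.approxDom j) x =
        Γ.gamma (hρ.approxDom M) (hρ.approxDom M) x := fun j => by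
    by_cases hj : j ≤ M
    · have heq : ∀ᵐ x ∂μ, x ∈ sublevel ρ (j + 1) →
          (hρ.approxDom j : Lp ℝ 2 μ) x = (hρ.approxDom M : Lp ℝ 2 μ) x := by
        filter_upwards [hρ.approxDom_ae j, hρ.approxDom_ae M] with x h1 h2 h3
        have hjM : (j : ℝ) ≤ M := by exact_mod_cast hj
        have h4 : ρ x < j + 1 := h3
        rw [h1 h4, h2 (by linarith)]
      have h1 := fun z => gamma_congr_of_eq_on Γ hreg hloc (hρ.approxDom_memBdd j).2
        (hρ.approxDom_memBdd M).2 (isOpen_sublevel hρ.continuous _) heq z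
      filter_upwards [h1 (hρ.approxDom j), h1 (hρ.approxDom M)] with x h2 h3 _ h4
      rw [h2 h4, Γ.symm, h3 h4]
    · exact ae_of_all _ fun x h => absurd h hj
  filter_upwards [ae_all_iff.2 h] with x hx hxM
  have h1 : ⌊ρ x⌋₊ ≤ M := by
    have := Nat.floor_le (hρ.nonneg x)
    have h2 : (⌊ρ x⌋₊ : ℝ) < (M + 1 : ℕ) := by push_cast; linarith
    exact Nat.lt_succ_iff.1 (by exact_mod_cast h2)
  exact hx ⌊ρ x⌋₊ h1 (Nat.lt_floor_add_one _)

omit [LocallyCompactSpace E] [SecondCountableTopology E] [IsFiniteMeasureOnCompacts μ] in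
theorem IsDivFreeDerivation.nLoc_ae (M : ℕ) : ∀ᵐ x ∂μ, ρ x < M + 1 →
    hN.nLoc hρ x = hN.val (hρ.approxDom M) (hρ.approxDom_memBdd M) x := by
  have h : ∀ j : ℕ, ∀ᵐ x ∂μ, j ≤ M → ρ x < j + 1 →
      hN.val (hρ.approxDom j) (hρ.approxDom_memBdd j) x =
        hN.val (hρ.approxDom M) (hρ.approxDom_memBdd M) x := fun j => by
    by_cases hj : j ≤ M
    · have hb : 𝓔.MemBdd ((hρ.approxDom j + (-1 : ℝ) • hρ.approxDom M : 𝓔.dom) : Lp ℝ 2 μ) := by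
        refine ⟨Subtype.coe_prop _,
          ((hρ.approxDom_memBdd j).2.add ((hρ.approxDom_memBdd M).2.const_mul (-1))).congr ?_⟩
        filter_upwards [coe_add_ae (hρ.approxDom j) ((-1 : ℝ) • hρ.approxDom M),
          coe_smul_ae (-1) (hρ.approxDom M)] with x h1 h2
        rw [h1, h2]
      have hb' : 𝓔.MemBdd (((-1 : ℝ) • hρ.approxDom M : 𝓔.dom) : Lp ℝ 2 μ) :=
        ⟨Subtype.coe_prop _, ((hρ.approxDom_memBdd M).2.const_mul (-1)).congr (coe_smul_ae _ _)⟩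
      have hz := hN.val_eq_zero hb (c := 0)
        (isOpen_sublevel hρ.continuous (j + 1)).measurableSet (by
        filter_upwards [hρ.approxDom_ae j, hρ.approxDom_ae M,
          coe_add_ae (hρ.approxDom j) ((-1 : ℝ) • hρ.approxDom M),
          coe_smul_ae (-1) (hρ.approxDom M)] with x h1 h2 h5 h6 h3
        have hjM : (j : ℝ) ≤ M := by exact_mod_cast hj
        have h4 : ρ x < j + 1 := h3
        rw [h5, h6, h1 h4, h2 (by linarith)]
        ring)
      filter_upwards [hz, hN.val_add (hρ.approxDom_memBdd j) hb' hb rfl,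
        hN.val_smul (-1) (hρ.approxDom_memBdd M) hb' rfl] with x h1 h2 h3 _ h4
      have := h1 h4
      linarith
    · exact ae_of_all _ fun x h => absurd h hj
  filter_upwards [ae_all_iff.2 h] with x hx hxM
  have h1 : ⌊ρ x⌋₊ ≤ M := by
    have := Nat.floor_le (hρ.nonneg x)
    have h2 : (⌊ρ x⌋₊ : ℝ) < (M + 1 : ℕ) := by push_cast; linarith
    exact Nat.lt_succ_iff.1 (by exact_mod_cast h2)
  exact hx ⌊ρ x⌋₊ h1 (Nat.lt_floor_add_one _)

include hreg hloc in
/-- Compactly supported functions of the exhaustion function are in the domain, with the chain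
rule for `Γ` and `N`. -/
theorem IsExhaustion.exists_comp {α : ℝ → ℝ} (hα : ContDiff ℝ 1 α) {C : ℝ}
    (hC : ∀ r, |α r| ≤ C ∧ |deriv α r| ≤ C) {M : ℕ} (hM : 0 < M)
    (hαM : ∀ r : ℝ, M ≤ r → α r = 0) :
    ∃ (U : 𝓔.dom) (hU : 𝓔.MemBdd (U : Lp ℝ 2 μ)), (∀ᵐ x ∂μ, (U : Lp ℝ 2 μ) x = α (ρ x)) ∧
      (∀ z, ∀ᵐ x ∂μ, Γ.gamma U z x = deriv α (ρ x) * Γ.gamma (hρ.approxDom M) z x) ∧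
      ∀ᵐ x ∂μ, hN.val U hU x =
        deriv α (ρ x) * hN.val (hρ.approxDom M) (hρ.approxDom_memBdd M) x := by
  have hαM' : ∀ r : ℝ, M ≤ r → deriv α r = 0 := fun r hr =>
    deriv_eq_zero_of_eq_zero_on_Ici hα hαM hr
  have hM' : (0 : ℝ) < M := by exact_mod_cast hM
  set R := hρ.approxDom M with hR
  have hRb : 𝓔.MemBdd (R : Lp ℝ 2 μ) := hρ.approxDom_memBdd M
  -- The chain rule requires a function vanishing at 0. The constant is put back as `α(0) c` with a
  -- cutoff `c`, so in the end `U = α(R) c`.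
  let η : ℝ → ℝ := fun r => α r - α 0
  have hη : ContDiff ℝ 1 η := hα.sub contDiff_const
  have hdη : deriv η = deriv α := by
    ext r
    exact deriv_sub_const _
  obtain ⟨A, hA, hAΓ⟩ := SymmDirichletForm.exists_comp Γ hreg hloc R hη (sub_self _) (L := C)
    fun r => by rw [hdη]; exact (hC r).2
  have hC0 : 0 ≤ C := (abs_nonneg _).trans (hC 0).1
  have hηb : ∀ r, |η r| ≤ 2 * C := fun r => by
    have h1 := abs_le.1 (hC r).1
    have h2 := abs_le.1 (hC 0).1
    exact abs_le.2 ⟨by simp only [η]; linarith, by simp only [η]; linarith⟩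
  have hAb : 𝓔.MemBdd (A : Lp ℝ 2 μ) :=
    ⟨A.2, 2 * C, by filter_upwards [hA] with x hx; rw [hx]; exact hηb _⟩
  have hAN : ∀ᵐ x ∂μ, hN.val A hAb x = deriv η ((R : Lp ℝ 2 μ) x) * hN.val R hRb x :=
    hN.chain ⟨R, hN.dom_le R hRb⟩ ⟨A, hN.dom_le A hAb⟩ hRb hAb η hη
      ⟨2 * C, fun r => ⟨hηb r, by rw [hdη]; linarith [(hC r).2]⟩⟩ hA
  -- `R` is uncontrolled beyond `E_{M+1}`, so the cutoff is 1 on `E_M` and supported in `E_{M+1}`.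
  obtain ⟨c, k, hk, hkc, hck, hk01, hk1, hkO⟩ := hreg.exists_cutoff (hρ.relCompact M hM')
    (isOpen_sublevel hρ.continuous (M + 1)) fun x hx => by
      have h1 : ρ x ≤ M := closure_sublevel_subset hρ.continuous _ hx
      show ρ x < M + 1
      linarith
  have hc : IsCoreVersion c k := ⟨hk, hkc, hck⟩
  have hcb : 𝓔.MemBdd (c : Lp ℝ 2 μ) := ⟨c.2, hc.essBdd⟩
  have hcM : ∀ᵐ x ∂μ, x ∈ sublevel ρ M → (c : Lp ℝ 2 μ) x = 1 := by
    filter_upwards [hc.ae_eq] with x hx hxM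
    rw [hx, hk1 x (subset_closure hxM)]
  have hcM' : ∀ᵐ x ∂μ, x ∈ (tsupport k)ᶜ → (c : Lp ℝ 2 μ) x = 0 := by
    filter_upwards [hc.ae_eq] with x hx hxM
    rw [hx, image_eq_zero_of_notMem_tsupport hxM]
  obtain ⟨P, hP⟩ := SymmDirichletForm.exists_mul A c hAb.2 hcb.2
  have hPb : 𝓔.MemBdd (P : Lp ℝ 2 μ) := ⟨P.2, (hAb.2.mul hcb.2).congr hP⟩
  have hSb : 𝓔.MemBdd ((α 0 • c : 𝓔.dom) : Lp ℝ 2 μ) :=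
    ⟨Subtype.coe_prop _, (hcb.2.const_mul _).congr (coe_smul_ae _ _)⟩
  have hUb : 𝓔.MemBdd ((P + α 0 • c : 𝓔.dom) : Lp ℝ 2 μ) :=
    ⟨Subtype.coe_prop _, (hPb.2.add hSb.2).congr (coe_add_ae _ _)⟩
  -- Three regions: inside `E_M` the cutoff is 1; beyond it `α(ρ) = 0`, and either `R` still equals
  -- `ρ` or the cutoff already vanishes.
  have htri : ∀ᵐ x ∂μ, (ρ x < M ∧ (R : Lp ℝ 2 μ) x = ρ x ∧ (c : Lp ℝ 2 μ) x = 1) ∨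
      (M ≤ ρ x ∧ (R : Lp ℝ 2 μ) x = ρ x) ∨
      (M ≤ ρ x ∧ x ∈ (tsupport k)ᶜ ∧ (c : Lp ℝ 2 μ) x = 0) := by
    filter_upwards [hcM, hcM', hρ.approxDom_ae M] with x h1 h2 h3
    rcases lt_or_ge (ρ x) M with h | h
    · exact Or.inl ⟨h, h3 (by linarith), h1 h⟩
    · rcases lt_or_ge (ρ x) (M + 1) with h' | h'
      · exact Or.inr (Or.inl ⟨h, h3 h'⟩)
      · have : x ∈ (tsupport k)ᶜ := fun hx => (not_lt.2 h') (hkO hx)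
        exact Or.inr (Or.inr ⟨h, this, h2 this⟩)
  refine ⟨P + α 0 • c, hUb, ?_, fun z => ?_, ?_⟩
  · filter_upwards [htri, coe_add_ae P (α 0 • c), coe_smul_ae (α 0) c, hP, hA]
      with x h1 h2 h3 h4 h5
    rw [h2, h3, h4, h5]
    rcases h1 with ⟨h6, h7, h8⟩ | ⟨h6, h7⟩ | ⟨h6, h7, h8⟩
    · rw [h7, h8]; simp only [η]; ring
    · rw [h7]; simp only [η]; rw [hαM _ h6]; ring
    · rw [h8, hαM _ h6]; ring
  · filter_upwards [htri, Γ.gamma_add_left_ae P (α 0 • c) z, Γ.gamma_smul_left_ae (α 0) c z,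
      gamma_mul Γ hreg hloc hAb.2 hcb.2 hP z, hAΓ z, hA,
      Γ.gamma_eq_zero_of_const hreg hloc c z hcb.2 (isOpen_sublevel hρ.continuous M) hcM,
      Γ.gamma_eq_zero_of_const hreg hloc c z hcb.2 (isClosed_tsupport k).isOpen_compl hcM']
      with x h1 h2 h3 h4 h5 h6 h7 h8
    rw [h2, h3, h4, h5, h6, hdη]
    rcases h1 with ⟨h9, h10, h11⟩ | ⟨h9, h10⟩ | ⟨h9, h10, h11⟩
    · rw [h7 h9, h10, h11]; ring
    · rw [h10, hαM' _ h9]; simp only [η]; rw [hαM _ h9]; ring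
    · rw [h8 h10, h11, hαM' _ h9]; ring
  · filter_upwards [htri, hN.val_add hPb hSb hUb rfl, hN.val_smul (α 0) hcb hSb rfl,
      hN.val_mul hAb hcb hPb hP, hAN, hA,
      hN.val_eq_zero hcb (isOpen_sublevel hρ.continuous M).measurableSet hcM,
      hN.val_eq_zero hcb (isClosed_tsupport k).isOpen_compl.measurableSet hcM']
      with x h1 h2 h3 h4 h5 h6 h7 h8
    rw [h2, h3, h4, h5, h6, hdη]
    rcases h1 with ⟨h9, h10, h11⟩ | ⟨h9, h10⟩ | ⟨h9, h10, h11⟩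
    · rw [h7 h9, h10, h11]; ring
    · rw [h10, hαM' _ h9]; simp only [η]; rw [hαM _ h9]; ring
    · rw [h8 h10, h11, hαM' _ h9]; ring

end SymmDirichletForm
end Leibniz
/-! ## Contraction semigroups -/

section Banach

variable {X : Type*} [NormedAddCommGroup X] [NormedSpace ℝ X]
  {S : ℝ → X →L[ℝ] X}

namespace IsC0ContractionSemigroup

variable (hS : IsC0ContractionSemigroup S)
include hS

theorem apply_add {s t : ℝ} (hs : 0 ≤ s) (ht : 0 ≤ t) (x : X) : S (s + t) x = S s (S t x) := by
  rw [hS.add s t hs ht, ContinuousLinearMap.comp_apply]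

theorem zero_apply (x : X) : S 0 x = x := by
  rw [hS.zero, ContinuousLinearMap.id_apply]

theorem norm_sub_le {s r : ℝ} (hs : 0 ≤ s) (hr : 0 ≤ r) (x : X) :
    ‖S s x - S r x‖ ≤ ‖S |s - r| x - x‖ := by
  wlog h : r ≤ s generalizing s r
  · rw [norm_sub_rev, abs_sub_comm]
    exact this hr hs (le_of_not_ge h)
  · rw [abs_of_nonneg (sub_nonneg.2 h)]
    have h1 : S s x = S r (S (s - r) x) := by
      rw [← hS.apply_add hr (sub_nonneg.2 h), add_sub_cancel]
    rw [h1, ← map_sub]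
    exact hS.contraction r hr _

/-- Contractivity reduces continuity at any time to continuity at 0. The `max r 0` is there because
`S` is arbitrary at negative times. -/
theorem continuous_orbit (x : X) : Continuous fun r : ℝ => S (max r 0) x := by
  have h0 : Tendsto (fun t => ‖S |t| x - x‖) (𝓝 0) (𝓝 0) := by
    rw [Metric.tendsto_nhds]
    intro ε hε
    have h1 := Metric.tendsto_nhds.1 (hS.strongly_continuous x) ε hε
    rw [eventually_nhdsWithin_iff, Metric.eventually_nhds_iff] at h1
    obtain ⟨δ, hδ, h1⟩ := h1
    rw [Metric.eventually_nhds_iff]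
    refine ⟨δ, hδ, fun t ht => ?_⟩
    rw [dist_zero_right, Real.norm_of_nonneg (norm_nonneg _)]
    rcases eq_or_ne t 0 with rfl | h
    · simpa [hS.zero_apply] using hε
    · rw [← dist_eq_norm]
      refine h1 ?_ (abs_pos.2 h)
      simpa using ht
  refine continuous_iff_continuousAt.2 fun r => ?_
  rw [ContinuousAt, tendsto_iff_norm_sub_tendsto_zero]
  have h2 : Tendsto (fun s : ℝ => max s 0 - max r 0) (𝓝 r) (𝓝 0) := by
    have : Continuous fun s : ℝ => max s 0 - max r 0 := by fun_prop
    simpa using this.tendsto r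
  exact squeeze_zero (fun _ => norm_nonneg _)
    (fun s => hS.norm_sub_le (le_max_right _ _) (le_max_right _ _) x) (h0.comp h2)

theorem continuousOn_orbit (x : X) : ContinuousOn (fun r : ℝ => S r x) (Ici 0) :=
  (hS.continuous_orbit x).continuousOn.congr fun r hr => by
    simp only
    rw [max_eq_left (show (0 : ℝ) ≤ r from hr)]

theorem generatorMaps_orbit {x y : X} (h : GeneratorMaps S x y) {s : ℝ} (hs : 0 ≤ s) :
    GeneratorMaps S (S s x) (S s y) := by
  refine (((S s).continuous.tendsto y).comp h).congr' ?_
  filter_upwards [self_mem_nhdsWithin] with t ht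
  have ht' : 0 ≤ t := le_of_lt ht
  rw [Function.comp_apply, map_smul, map_sub, ← hS.apply_add hs ht', ← hS.apply_add ht' hs,
    add_comm]

theorem hasDerivWithinAt_orbit {x y : X} (h : GeneratorMaps S x y) {s : ℝ} (hs : 0 ≤ s) :
    HasDerivWithinAt (fun r => S r x) (S s y) (Ici s) s := by
  rw [← hasDerivWithinAt_Ioi_iff_Ici, hasDerivWithinAt_iff_tendsto_slope' self_notMem_Ioi]
  have h1 := hS.generatorMaps_orbit h hs
  have h2 : Tendsto (fun r : ℝ => r - s) (𝓝[>] s) (𝓝[>] 0) := by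
    refine tendsto_nhdsWithin_iff.2 ⟨?_, ?_⟩
    · have : Continuous fun r : ℝ => r - s := by fun_prop
      simpa using (this.tendsto s).mono_left nhdsWithin_le_nhds
    · filter_upwards [self_mem_nhdsWithin] with r hr using sub_pos.2 (show s < r from hr)
  refine (h1.comp h2).congr' ?_
  filter_upwards [self_mem_nhdsWithin] with r hr
  have hr' : 0 ≤ r - s := (sub_pos.2 hr).le
  rw [Function.comp_apply, slope_def_module, ← hS.apply_add hr' hs, sub_add_cancel]

/-- `S_t` shifts the interval of integration, so `S_t ∫_0^ε - ∫_0^ε` is `∫_ε^{ε+t} - ∫_0^t`, and its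
quotient by `t` tends to `S_ε x - x`. -/
theorem generatorMaps_average [CompleteSpace X] (x : X) {ε : ℝ} (hε : 0 < ε) :
    GeneratorMaps S (ε⁻¹ • ∫ r in (0 : ℝ)..ε, S (max r 0) x) (ε⁻¹ • (S ε x - x)) := by
  have hc := hS.continuous_orbit x
  let c : ℝ → X := fun r => S (max r 0) x
  have hF : ∀ a, HasDerivAt (fun b => ∫ r in (0 : ℝ)..b, c r) (c a) a := fun a =>
    intervalIntegral.integral_hasDerivAt_right (hc.intervalIntegrable _ _)
      hc.aestronglyMeasurable.stronglyMeasurableAtFilter hc.continuousAt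
  have h1 := (hasDerivAt_iff_tendsto_slope_zero.1 (hF ε)).mono_left
    (nhdsWithin_mono (0 : ℝ) (show Ioi (0 : ℝ) ⊆ {0}ᶜ from fun t ht => ne_of_gt ht))
  have h2 := (hasDerivAt_iff_tendsto_slope_zero.1 (hF 0)).mono_left
    (nhdsWithin_mono (0 : ℝ) (show Ioi (0 : ℝ) ⊆ {0}ᶜ from fun t ht => ne_of_gt ht))
  have h3 := (h1.sub h2).const_smul ε⁻¹
  have hce : c ε = S ε x := by simp only [c]; rw [max_eq_left hε.le]
  have hc0 : c 0 = x := by simp only [c]; rw [max_self, hS.zero_apply]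
  rw [hce, hc0] at h3
  refine h3.congr' ?_
  filter_upwards [self_mem_nhdsWithin] with t ht
  have ht' : 0 ≤ t := le_of_lt ht
  have h4 : S t (∫ r in (0 : ℝ)..ε, c r) =
      (∫ r in (0 : ℝ)..ε + t, c r) - ∫ r in (0 : ℝ)..t, c r := by
    rw [← (S t).intervalIntegral_comp_comm (hc.intervalIntegrable _ _),
      intervalIntegral.integral_interval_sub_left (hc.intervalIntegrable _ _)
        (hc.intervalIntegrable _ _)]
    have h5 : ∀ r ∈ uIcc 0 ε, S t (c r) = c (r + t) := fun r hr => by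
      rw [uIcc_of_le hε.le] at hr
      simp only [c]
      rw [max_eq_left hr.1, max_eq_left (add_nonneg hr.1 ht'), add_comm r t, hS.apply_add ht' hr.1]
    rw [intervalIntegral.integral_congr h5, intervalIntegral.integral_comp_add_right, zero_add]
  have h6 : (∫ r in (0 : ℝ)..0, c r) = 0 := intervalIntegral.integral_same
  rw [map_smul]
  change _ = t⁻¹ • (ε⁻¹ • S t (∫ r in (0 : ℝ)..ε, c r) - ε⁻¹ • ∫ r in (0 : ℝ)..ε, c r)
  rw [h4, h6, zero_add, sub_zero]
  module

theorem tendsto_average [CompleteSpace X] (x : X) :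
    Tendsto (fun ε : ℝ => ε⁻¹ • ∫ r in (0 : ℝ)..ε, S (max r 0) x) (𝓝[>] 0) (𝓝 x) := by
  have hc := hS.continuous_orbit x
  have hF : HasDerivAt (fun b => ∫ r in (0 : ℝ)..b, S (max r 0) x) (S (max 0 0) x) 0 :=
    intervalIntegral.integral_hasDerivAt_right (hc.intervalIntegrable _ _)
      hc.aestronglyMeasurable.stronglyMeasurableAtFilter hc.continuousAt
  have h2 := (hasDerivAt_iff_tendsto_slope_zero.1 hF).mono_left
    (nhdsWithin_mono (0 : ℝ) (show Ioi (0 : ℝ) ⊆ {0}ᶜ from fun t ht => ne_of_gt ht))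
  rw [max_self, hS.zero_apply] at h2
  simpa using h2

theorem average_mem [CompleteSpace X] (x : X) {ε : ℝ} (hε : 0 < ε) {D : Set X} (hD : Convex ℝ D)
    (hcl : IsClosed D) (hx : ∀ r, 0 ≤ r → S r x ∈ D) :
    ε⁻¹ • ∫ r in (0 : ℝ)..ε, S (max r 0) x ∈ D := by
  have h1 : ε⁻¹ • ∫ r in (0 : ℝ)..ε, S (max r 0) x = ⨍ r in Ioc 0 ε, S (max r 0) x := by
    rw [setAverage_eq, intervalIntegral.integral_of_le hε.le]
    simp [hε.le]
  rw [h1]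
  refine hD.set_average_mem hcl (by simp [hε]) (by simp)
    (ae_of_all _ fun r => hx _ (le_max_right _ _)) ?_
  exact ((hS.continuous_orbit x).integrableOn_Icc).mono_set Ioc_subset_Icc_self

end IsC0ContractionSemigroup

end Banach

/-! ### Sub-Markovian semigroups on `L^p` of a finite measure space -/

section LpSemigroup

variable {E : Type*} [MeasurableSpace E] {ν : Measure E} {p : ℝ≥0∞} [hp : Fact (1 ≤ p)]

theorem IsSubMarkovian.bounds {A : Lp ℝ p ν →L[ℝ] Lp ℝ p ν} (hA : IsSubMarkovian A) {M : ℝ}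
    (hM : 0 < M) {f : Lp ℝ p ν} (hf : ∀ᵐ x ∂ν, 0 ≤ f x ∧ f x ≤ M) :
    ∀ᵐ x ∂ν, 0 ≤ A f x ∧ A f x ≤ M := by
  have h := hA (M⁻¹ • f) (by
    filter_upwards [hf, Lp.coeFn_smul M⁻¹ f] with x h1 h2
    rw [h2, Pi.smul_apply, smul_eq_mul]
    refine ⟨mul_nonneg (inv_nonneg.2 hM.le) h1.1, ?_⟩
    rw [inv_mul_le_iff₀ hM, mul_one]
    exact h1.2)
  rw [map_smul] at h
  filter_upwards [h, Lp.coeFn_smul M⁻¹ (A f)] with x h1 h2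
  rw [h2, Pi.smul_apply, smul_eq_mul, inv_mul_le_iff₀ hM, mul_one] at h1
  exact ⟨by simpa using (mul_nonneg_iff_of_pos_left (inv_pos.2 hM)).1 h1.1, h1.2⟩

variable [IsFiniteMeasure ν]

omit hp in
theorem mem_Icc_const_iff {M : ℝ} (f : Lp ℝ p ν) :
    f ∈ Icc 0 (Lp.const p ν M) ↔ ∀ᵐ x ∂ν, 0 ≤ f x ∧ f x ≤ M := by
  rw [mem_Icc, ← Lp.coeFn_le, ← Lp.coeFn_le]
  constructor
  · rintro ⟨h1, h2⟩
    filter_upwards [h1, h2, Lp.coeFn_zero ℝ p ν, Lp.coeFn_const (p := p) (μ := ν) M]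
      with x h1 h2 h3 h4
    rw [h3] at h1
    rw [h4] at h2
    exact ⟨h1, h2⟩
  · intro h
    constructor
    · filter_upwards [h, Lp.coeFn_zero ℝ p ν] with x h1 h2
      rw [h2]
      exact h1.1
    · filter_upwards [h, Lp.coeFn_const (p := p) (μ := ν) M] with x h1 h2
      rw [h2]
      exact h1.2

omit hp in
theorem convex_Icc_const (M : ℝ) : Convex ℝ (Icc 0 (Lp.const p ν M)) := by
  intro f hf g hg a b ha hb hab
  rw [mem_Icc_const_iff] at hf hg ⊢
  filter_upwards [hf, hg, Lp.coeFn_add (a • f) (b • g), Lp.coeFn_smul a f, Lp.coeFn_smul b g]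
    with x h1 h2 h3 h4 h5
  rw [h3, Pi.add_apply, h4, h5, Pi.smul_apply, Pi.smul_apply, smul_eq_mul, smul_eq_mul]
  have h6 := mul_nonneg ha h1.1
  have h7 := mul_nonneg hb h2.1
  have h8 := mul_le_mul_of_nonneg_left h1.2 ha
  have h9 := mul_le_mul_of_nonneg_left h2.2 hb
  refine ⟨by linarith, ?_⟩
  calc _ ≤ a * M + b * M := add_le_add h8 h9
    _ = M := by rw [← add_mul, hab, one_mul]

/-- Bounded functions are approximated by bounded elements of the domain of the generator whose
images under the semigroup and the generator are bounded. -/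
theorem exists_bounded_generator_approx {S : ℝ → Lp ℝ p ν →L[ℝ] Lp ℝ p ν}
    (hS : IsC0ContractionSemigroup S) (hsub : ∀ s, 0 ≤ s → IsSubMarkovian (S s)) {M : ℝ}
    (hM : 0 < M) {f : Lp ℝ p ν} (hf : ∀ᵐ x ∂ν, 0 ≤ f x ∧ f x ≤ M) :
    ∃ g y : ℕ → Lp ℝ p ν, (∀ j, GeneratorMaps S (g j) (y j)) ∧
      (∀ j, ∀ᵐ x ∂ν, 0 ≤ g j x ∧ g j x ≤ M) ∧ (∀ j s, 0 ≤ s → EssBdd ν (S s (y j))) ∧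
      Tendsto g atTop (𝓝 f) := by
  let e : ℕ → ℝ := fun j => 1 / ((j : ℝ) + 1)
  have he : ∀ j, 0 < e j := fun j => Nat.one_div_pos_of_nat
  refine ⟨fun j => (e j)⁻¹ • ∫ r in (0 : ℝ)..e j, S (max r 0) f,
    fun j => (e j)⁻¹ • (S (e j) f - f), fun j => hS.generatorMaps_average f (he j), fun j => ?_,
    fun j s hs => ?_, ?_⟩
  · rw [← mem_Icc_const_iff]
    exact hS.average_mem f (he j) (convex_Icc_const M) isClosed_Icc fun r hr =>
      (mem_Icc_const_iff _).2 ((hsub r hr).bounds hM hf)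
  · have h1 := (hsub s hs).bounds hM ((hsub _ (he j).le).bounds hM hf)
    have h2 := (hsub s hs).bounds hM hf
    -- The orbit of `y_j` is `1 / e_j` times a difference of two functions with values in `[0, M]`.
    refine ⟨(e j)⁻¹ * M, ?_⟩
    simp only [map_smul, map_sub]
    filter_upwards [h1, h2, Lp.coeFn_smul (e j)⁻¹ (S s (S (e j) f) - S s f),
      Lp.coeFn_sub (S s (S (e j) f)) (S s f)] with x h3 h4 h5 h6
    rw [h5, Pi.smul_apply, h6, Pi.sub_apply, smul_eq_mul, abs_mul,
      abs_of_pos (inv_pos.2 (he j))]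
    refine mul_le_mul_of_nonneg_left (abs_le.2 ⟨?_, ?_⟩) (inv_pos.2 (he j)).le <;> linarith
  · refine (hS.tendsto_average f).comp (tendsto_nhdsWithin_iff.2
      ⟨tendsto_one_div_add_atTop_nhds_zero_nat, Eventually.of_forall he⟩)

theorem Lp.integrable_of_isFiniteMeasure (f : Lp ℝ p ν) : Integrable f ν :=
  (Lp.memLp f).integrable hp.out

variable (ν p) in
-- Hölder's inequality on a finite measure space. It lets the arguments below use only bounded test
-- functions and treat all `p` at once.
theorem exists_integral_abs_le : ∃ C : ℝ, 0 ≤ C ∧ ∀ f : Lp ℝ p ν, ∫ x, |f x| ∂ν ≤ C * ‖f‖ := by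
  refine ⟨(ν univ ^ (1 / (1 : ℝ≥0∞).toReal - 1 / p.toReal)).toReal, ENNReal.toReal_nonneg, fun f => ?_⟩
  have h := eLpNorm_le_eLpNorm_mul_rpow_measure_univ (μ := ν) hp.out (Lp.aestronglyMeasurable f)
  have h1 : ∫ x, |f x| ∂ν = (eLpNorm f 1 ν).toReal := by
    rw [eLpNorm_one_eq_lintegral_enorm, ← integral_norm_eq_lintegral_enorm
      (Lp.aestronglyMeasurable f)]
    rfl
  have hexp : 0 ≤ 1 / (1 : ℝ≥0∞).toReal - 1 / p.toReal := by
    rcases eq_or_ne p ⊤ with rfl | hpt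
    · simp
    · have : 1 ≤ p.toReal := by
        rw [← ENNReal.toReal_one]
        exact (ENNReal.toReal_le_toReal ENNReal.one_ne_top hpt).2 hp.out
      rw [ENNReal.toReal_one, div_one, sub_nonneg, div_le_one (by linarith)]
      exact this
  rw [h1, Lp.norm_def, mul_comm, ← ENNReal.toReal_mul]
  refine ENNReal.toReal_mono (ENNReal.mul_ne_top (Lp.eLpNorm_ne_top f) ?_) h
  exact ENNReal.rpow_ne_top_of_nonneg hexp (measure_ne_top _ _)

theorem Lp.integrable_mul_of_bdd (f : Lp ℝ p ν) {b : E → ℝ} (hb : AEStronglyMeasurable b ν)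
    {B : ℝ} (hB : ∀ᵐ x ∂ν, |b x| ≤ B) : Integrable (fun x => f x * b x) ν :=
  (Lp.integrable_of_isFiniteMeasure f).mul_bdd (c := B) hb hB

theorem Lp.abs_integral_mul_le {C : ℝ} (hC : ∀ f : Lp ℝ p ν, ∫ x, |f x| ∂ν ≤ C * ‖f‖)
    (f : Lp ℝ p ν) {b : E → ℝ} (hb : AEStronglyMeasurable b ν)
    {B : ℝ} (hB0 : 0 ≤ B) (hB : ∀ᵐ x ∂ν, |b x| ≤ B) : |∫ x, f x * b x ∂ν| ≤ B * (C * ‖f‖) := by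
  calc |∫ x, f x * b x ∂ν| ≤ ∫ x, |f x * b x| ∂ν := abs_integral_le_integral_abs
    _ ≤ ∫ x, B * |f x| ∂ν := by
        refine integral_mono_ae (Lp.integrable_mul_of_bdd f hb hB).abs
          ((Lp.integrable_of_isFiniteMeasure f).abs.const_mul B) ?_
        filter_upwards [hB] with x hx
        rw [abs_mul, mul_comm]
        exact mul_le_mul_of_nonneg_right hx (abs_nonneg _)
    _ ≤ _ := by
        rw [integral_const_mul]
        exact mul_le_mul_of_nonneg_left (hC f) hB0

/-- Integration against a bounded function. -/
def testCLM (p : ℝ≥0∞) [Fact (1 ≤ p)] (b : E → ℝ) (hb : AEStronglyMeasurable b ν)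
    (hB : EssBdd ν b) : Lp ℝ p ν →L[ℝ] ℝ :=
  LinearMap.mkContinuousOfExistsBound
    { toFun := fun f => ∫ x, f x * b x ∂ν
      map_add' := fun f g => by
        rw [← integral_add (Lp.integrable_mul_of_bdd f hb hB.choose_spec)
          (Lp.integrable_mul_of_bdd g hb hB.choose_spec)]
        refine integral_congr_ae ?_
        filter_upwards [Lp.coeFn_add f g] with x hx
        rw [hx, Pi.add_apply, add_mul]
      map_smul' := fun c f => by
        rw [RingHom.id_apply, smul_eq_mul, ← integral_const_mul]
        refine integral_congr_ae ?_
        filter_upwards [Lp.coeFn_smul c f] with x hx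
        rw [hx, Pi.smul_apply, smul_eq_mul, mul_assoc] } (by
    obtain ⟨C, hC0, hC⟩ := exists_integral_abs_le ν p
    obtain ⟨B, hB0, hB⟩ := hB.exists_pos
    refine ⟨B * C, fun f => ?_⟩
    rw [mul_assoc]
    exact Lp.abs_integral_mul_le hC f hb hB0.le hB)

theorem testCLM_apply (b : E → ℝ) (hb : AEStronglyMeasurable b ν)
    (hB : EssBdd ν b) (f : Lp ℝ p ν) : testCLM p b hb hB f = ∫ x, f x * b x ∂ν := rfl

theorem abs_integral_sq_sub_le {C : ℝ} (hC : ∀ f : Lp ℝ p ν, ∫ x, |f x| ∂ν ≤ C * ‖f‖)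
    {f g h : Lp ℝ p ν} {M B : ℝ} {W : E → ℝ} (hf : ∀ᵐ x ∂ν, |f x| ≤ M) (hg : ∀ᵐ x ∂ν, |g x| ≤ M)
    (hM : 0 ≤ M) (hB : 0 ≤ B) (hW : AEStronglyMeasurable W ν) (hWB : ∀ᵐ x ∂ν, |W x| ≤ B) :
    |∫ x, h x * ((f x + g x) * W x) ∂ν| ≤ 2 * M * B * (C * ‖h‖) := by
  refine Lp.abs_integral_mul_le hC h (((Lp.aestronglyMeasurable f).add
    (Lp.aestronglyMeasurable g)).mul hW) (by positivity) ?_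
  filter_upwards [hf, hg, hWB] with x h1 h2 h3
  change |(f x + g x) * W x| ≤ _
  rw [abs_mul]
  refine mul_le_mul ((abs_add_le _ _).trans (by linarith)) h3 (abs_nonneg _) (by positivity)

/-- Differentiation of the weighted square of a bounded curve. -/
theorem hasDerivWithinAt_integral_sq {v : ℝ → Lp ℝ p ν} {y : Lp ℝ p ν} {s : ℝ}
    (hv : HasDerivWithinAt v y (Ici s) s) {M : ℝ} (hM : ∀ r, s ≤ r → ∀ᵐ x ∂ν, |v r x| ≤ M)
    (hy : EssBdd ν y) {W : E → ℝ} (hW : AEStronglyMeasurable W ν) (hWB : EssBdd ν W) :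
    HasDerivWithinAt (fun r => ∫ x, v r x ^ 2 * W x ∂ν) (2 * ∫ x, v s x * y x * W x ∂ν)
      (Ici s) s := by
  obtain ⟨C, hC0, hC⟩ := exists_integral_abs_le ν p
  obtain ⟨B, hB0, hB⟩ := hWB.exists_pos
  have hcont : Tendsto v (𝓝[>] s) (𝓝 (v s)) := hv.continuousWithinAt.mono_left
    (nhdsWithin_mono s Ioi_subset_Ici_self)
  rw [← hasDerivWithinAt_Ioi_iff_Ici, hasDerivWithinAt_iff_tendsto_slope' self_notMem_Ioi] at hv ⊢
  have hM0 : 0 ≤ max M 0 := le_max_right _ _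
  have hM' : ∀ r, s ≤ r → ∀ᵐ x ∂ν, |v r x| ≤ max M 0 := fun r hr => by
    filter_upwards [hM r hr] with x hx using hx.trans (le_max_left _ _)
  have hyW : EssBdd ν fun x => y x * W x := hy.mul ⟨B, hB⟩
  have hyWm : AEStronglyMeasurable (fun x => y x * W x) ν := (Lp.aestronglyMeasurable y).mul hW
  -- The slope of the weighted square is `∫ slope · (v_r + v_s) W`. Replacing `slope` by `y` costs
  -- this integral: one factor tends to 0 in `L^p`, the other is bounded, so `p = 1` is allowed.
  have h1 : Tendsto (fun r => ∫ x, (slope v s r - y : Lp ℝ p ν) x * ((v r x + v s x) * W x) ∂ν)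
      (𝓝[>] s) (𝓝 0) := by
    have h2 := tendsto_iff_norm_sub_tendsto_zero.1 hv
    have h3 : Tendsto (fun r => 2 * max M 0 * B * (C * ‖slope v s r - y‖)) (𝓝[>] s) (𝓝 0) := by
      simpa using (h2.const_mul C).const_mul (2 * max M 0 * B)
    refine squeeze_zero_norm' ?_ h3
    filter_upwards [self_mem_nhdsWithin] with r hr
    exact abs_integral_sq_sub_le hC (hM' r (le_of_lt hr)) (hM' s le_rfl) hM0 hB0.le hW hB
  have h2 : Tendsto (fun r => ∫ x, v r x * (y x * W x) ∂ν) (𝓝[>] s)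
      (𝓝 (∫ x, v s x * (y x * W x) ∂ν)) :=
    ((testCLM p _ hyWm hyW).continuous.tendsto (v s)).comp hcont
  have h3 := (h1.add (h2.add_const (∫ x, v s x * (y x * W x) ∂ν)))
  have h4 : 0 + (∫ x, v s x * (y x * W x) ∂ν + ∫ x, v s x * (y x * W x) ∂ν) =
      2 * ∫ x, v s x * y x * W x ∂ν := by
    simp only [mul_assoc]; ring
  rw [h4] at h3
  refine h3.congr' ?_
  filter_upwards [self_mem_nhdsWithin] with r hr
  have hr' : s ≤ r := le_of_lt hr
  have hsum : AEStronglyMeasurable (fun x => (v r x + v s x) * W x) ν :=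
    ((Lp.aestronglyMeasurable (v r)).add (Lp.aestronglyMeasurable (v s))).mul hW
  have hsumb : ∀ᵐ x ∂ν, |(v r x + v s x) * W x| ≤ 2 * max M 0 * B := by
    filter_upwards [hM' r hr', hM' s le_rfl, hB] with x h1 h2 h3
    rw [abs_mul]
    exact mul_le_mul ((abs_add_le _ _).trans (by linarith)) h3 (abs_nonneg _) (by positivity)
  have hsq : ∀ q, s ≤ q → Integrable (fun x => v q x ^ 2 * W x) ν := fun q hq => by
    have := Lp.integrable_mul_of_bdd (v q) ((Lp.aestronglyMeasurable (v q)).mul hW)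
      (B := max M 0 * B) (by
        filter_upwards [hM' q hq, hB] with x h1 h2
        rw [Pi.mul_apply, abs_mul]
        exact mul_le_mul h1 h2 (abs_nonneg _) hM0)
    refine this.congr (ae_of_all _ fun x => ?_)
    simp only [Pi.mul_apply]
    ring
  have hsl : slope (fun r => ∫ x, v r x ^ 2 * W x ∂ν) s r =
      ∫ x, (r - s)⁻¹ * (v r x ^ 2 * W x - v s x ^ 2 * W x) ∂ν := by
    rw [slope_def_module, ← integral_sub (hsq r hr') (hsq s le_rfl), smul_eq_mul,
      integral_const_mul]
  have hadd : Integrable (fun x => v r x * (y x * W x) + v s x * (y x * W x)) ν :=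
    (Lp.integrable_mul_of_bdd (v r) hyWm hyW.choose_spec).add
      (Lp.integrable_mul_of_bdd (v s) hyWm hyW.choose_spec)
  rw [hsl, ← integral_add (Lp.integrable_mul_of_bdd (v r) hyWm hyW.choose_spec)
      (Lp.integrable_mul_of_bdd (v s) hyWm hyW.choose_spec),
    ← integral_add (Lp.integrable_mul_of_bdd _ hsum hsumb) hadd]
  refine integral_congr_ae ?_
  filter_upwards [Lp.coeFn_sub (slope v s r) y, Lp.coeFn_smul (r - s)⁻¹ (v r - v s),
    Lp.coeFn_sub (v r) (v s)] with x h5 h6 h7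
  rw [h5, Pi.sub_apply, slope_def_module, h6, Pi.smul_apply, h7, Pi.sub_apply, smul_eq_mul]
  ring

theorem continuousOn_integral_sq {v : ℝ → Lp ℝ p ν} {D : Set ℝ} (hv : ContinuousOn v D) {M : ℝ}
    (hM : ∀ r ∈ D, ∀ᵐ x ∂ν, |v r x| ≤ M) {W : E → ℝ} (hW : AEStronglyMeasurable W ν)
    (hWB : EssBdd ν W) : ContinuousOn (fun r => ∫ x, v r x ^ 2 * W x ∂ν) D := by
  obtain ⟨C, hC0, hC⟩ := exists_integral_abs_le ν p
  obtain ⟨B, hB0, hB⟩ := hWB.exists_pos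
  have hM0 : 0 ≤ max M 0 := le_max_right _ _
  have hM' : ∀ r ∈ D, ∀ᵐ x ∂ν, |v r x| ≤ max M 0 := fun r hr => by
    filter_upwards [hM r hr] with x hx using hx.trans (le_max_left _ _)
  have hsq : ∀ q ∈ D, Integrable (fun x => v q x ^ 2 * W x) ν := fun q hq => by
    have := Lp.integrable_mul_of_bdd (v q) ((Lp.aestronglyMeasurable (v q)).mul hW)
      (B := max M 0 * B) (by
        filter_upwards [hM' q hq, hB] with x h1 h2
        rw [Pi.mul_apply, abs_mul]
        exact mul_le_mul h1 h2 (abs_nonneg _) hM0)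
    refine this.congr (ae_of_all _ fun x => ?_)
    simp only [Pi.mul_apply]
    ring
  intro s hs
  rw [ContinuousWithinAt, tendsto_iff_norm_sub_tendsto_zero]
  have h2 := tendsto_iff_norm_sub_tendsto_zero.1 (hv s hs)
  have h3 : Tendsto (fun r => 2 * max M 0 * B * (C * ‖v r - v s‖)) (𝓝[D] s) (𝓝 0) := by
    simpa using (h2.const_mul C).const_mul (2 * max M 0 * B)
  refine squeeze_zero' (Eventually.of_forall fun _ => norm_nonneg _) ?_ h3
  filter_upwards [self_mem_nhdsWithin] with r hr
  have h4 := abs_integral_sq_sub_le (h := v r - v s) hC (hM' r hr) (hM' s hs) hM0 hB0.le hW hB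
  refine le_trans (le_of_eq ?_) h4
  rw [Real.norm_eq_abs, ← integral_sub (hsq r hr) (hsq s hs)]
  congr 1
  refine integral_congr_ae ?_
  filter_upwards [Lp.coeFn_sub (v r) (v s)] with x h5
  rw [h5, Pi.sub_apply]
  ring

end LpSemigroup

/-! ## Weighted energy inequalities -/

theorem le_add_of_sq_le_mul {x a b : ℝ} (ha : 0 ≤ a) (hb : 0 ≤ b) (h : x ^ 2 ≤ 4 * (a * b)) :
    x ≤ a + b := by
  refine le_of_sq_le_sq (h.trans ?_) (by positivity)
  nlinarith [sq_nonneg (a - b)]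

/-- Young's inequality with a free parameter `l`, by completing the square; `l` is chosen depending
on time in `integral_orbit_ge_of_generatorMaps`. -/
theorem neg_le_mul_of_pos {l : ℝ} (hl : 0 < l) (X Y : ℝ) :
    -(l * X ^ 2) - Y ^ 2 / (4 * l) ≤ X * Y := by
  have h : 0 ≤ (2 * l * X + Y) ^ 2 / (4 * l) := by positivity
  have h2 : (2 * l * X + Y) ^ 2 / (4 * l) = l * X ^ 2 + X * Y + Y ^ 2 / (4 * l) := by
    field_simp
    ring
  linarith

section Weighted

variable {E : Type*} [MetricSpace E] [LocallyCompactSpace E] [SecondCountableTopology E]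
  [MeasurableSpace E] [BorelSpace E] {μ : Measure E} [IsFiniteMeasureOnCompacts μ]
  {𝓔 : SymmDirichletForm μ}

namespace SymmDirichletForm

variable (Γ : 𝓔.CarreDuChamp) (hreg : 𝓔.IsRegular) (hloc : 𝓔.IsStronglyLocal)
  {N : Lp ℝ 2 μ →ₗ.[ℝ] (E →ₘ[μ] ℝ)} (hN : 𝓔.IsDivFreeDerivation N)
  {ρ : E → ℝ} (hρ : 𝓔.IsExhaustion ρ)

include hreg hloc in
-- `e^ψ` itself need not lie in the domain, but `e^ψ - e^κ` vanishes beyond `M`, so `e^{ψ(ρ)} v = U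
-- v + e^κ v` with `U` from `IsExhaustion.exists_comp`.
theorem IsExhaustion.exists_exp_mul {ψ : ℝ → ℝ} (hψ : ContDiff ℝ 1 ψ) {C : ℝ}
    (hC : ∀ r, |ψ r| ≤ C ∧ |deriv ψ r| ≤ C) {M : ℕ} (hM : 0 < M) {κ : ℝ}
    (hψM : ∀ r : ℝ, M ≤ r → ψ r = κ) (v : 𝓔.dom) (hv : 𝓔.MemBdd (v : Lp ℝ 2 μ)) :
    ∃ (q : 𝓔.dom) (hq : 𝓔.MemBdd (q : Lp ℝ 2 μ)),
      (∀ᵐ x ∂μ, (q : Lp ℝ 2 μ) x = Real.exp (ψ (ρ x)) * (v : Lp ℝ 2 μ) x) ∧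
      (∀ z, ∀ᵐ x ∂μ, Γ.gamma q z x = Real.exp (ψ (ρ x)) * (Γ.gamma v z x +
        (v : Lp ℝ 2 μ) x * deriv ψ (ρ x) * Γ.gamma (hρ.approxDom M) z x)) ∧
      ∀ᵐ x ∂μ, hN.val q hq x = Real.exp (ψ (ρ x)) * (hN.val v hv x +
        (v : Lp ℝ 2 μ) x * deriv ψ (ρ x) *
          hN.val (hρ.approxDom M) (hρ.approxDom_memBdd M) x) := by
  let α : ℝ → ℝ := fun r => Real.exp (ψ r) - Real.exp κ
  have hα : ContDiff ℝ 1 α := hψ.exp.sub contDiff_const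
  have hdα : ∀ r, deriv α r = Real.exp (ψ r) * deriv ψ r := fun r =>
    (((hψ.differentiable one_ne_zero r).hasDerivAt.exp).sub_const _).deriv
  have hC0 : 0 ≤ C := (abs_nonneg _).trans (hC 0).1
  have hexp : ∀ r, Real.exp (ψ r) ≤ Real.exp C := fun r =>
    Real.exp_le_exp.2 ((le_abs_self _).trans (hC r).1)
  have hκ : Real.exp κ ≤ Real.exp C := by rw [← hψM M le_rfl]; exact hexp _
  have hαb : ∀ r, |α r| ≤ Real.exp C + Real.exp C * C ∧ |deriv α r| ≤ Real.exp C + Real.exp C * C := by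
    intro r
    have h1 : 0 ≤ Real.exp C * C := by positivity
    constructor
    · have := Real.exp_pos (ψ r)
      have := Real.exp_pos κ
      have := hexp r
      exact abs_le.2 ⟨by simp only [α]; linarith, by simp only [α]; linarith⟩
    · rw [hdα, abs_mul, abs_of_pos (Real.exp_pos _)]
      have h2 : Real.exp (ψ r) * |deriv ψ r| ≤ Real.exp C * C :=
        mul_le_mul (hexp r) (hC r).2 (abs_nonneg _) (Real.exp_pos _).le
      linarith [Real.exp_pos C]
  obtain ⟨U, hU, hUα, hUΓ, hUN⟩ := hρ.exists_comp Γ hreg hloc hN hα hαb hM fun r hr => by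
    simp only [α]
    rw [hψM r hr, sub_self]
  obtain ⟨P, hP⟩ := SymmDirichletForm.exists_mul U v hU.2 hv.2
  have hPb : 𝓔.MemBdd (P : Lp ℝ 2 μ) := ⟨P.2, (hU.2.mul hv.2).congr hP⟩
  have hSb : 𝓔.MemBdd ((Real.exp κ • v : 𝓔.dom) : Lp ℝ 2 μ) :=
    ⟨Subtype.coe_prop _, (hv.2.const_mul _).congr (coe_smul_ae _ _)⟩
  have hqb : 𝓔.MemBdd ((P + Real.exp κ • v : 𝓔.dom) : Lp ℝ 2 μ) :=
    ⟨Subtype.coe_prop _, (hPb.2.add hSb.2).congr (coe_add_ae _ _)⟩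
  refine ⟨P + Real.exp κ • v, hqb, ?_, fun z => ?_, ?_⟩
  · filter_upwards [coe_add_ae P (Real.exp κ • v), coe_smul_ae (Real.exp κ) v, hP, hUα]
      with x h1 h2 h3 h4
    rw [h1, h2, h3, h4]
    simp only [α]
    ring
  · filter_upwards [Γ.gamma_add_left_ae P (Real.exp κ • v) z, Γ.gamma_smul_left_ae (Real.exp κ) v z,
      gamma_mul Γ hreg hloc hU.2 hv.2 hP z, hUα, hUΓ z] with x h1 h2 h3 h4 h5
    rw [h1, h2, h3, h4, h5, hdα]
    simp only [α]
    ring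
  · filter_upwards [hN.val_add hPb hSb hqb rfl, hN.val_smul (Real.exp κ) hv hSb rfl,
      hN.val_mul hU hv hPb hP, hUα, hUN] with x h1 h2 h3 h4 h5
    rw [h1, h2, h3, h4, h5, hdα]
    simp only [α]
    ring

omit [LocallyCompactSpace E] [SecondCountableTopology E] [IsFiniteMeasureOnCompacts μ] in
/-- `N v` for an element of `D(𝓔)_b` that vanishes off a relatively compact sublevel set. -/
theorem IsDivFreeDerivation.integrable_val {v : Lp ℝ 2 μ} (hv : 𝓔.MemBdd v) {r : ℝ} (hr : 0 < r)
    (hρ : 𝓔.IsExhaustion ρ) (h0 : ∀ᵐ x ∂μ, x ∉ sublevel ρ r → v x = 0) :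
    Integrable (hN.val v hv) μ ∧ (∀ᵐ x ∂μ, x ∉ sublevel ρ r → hN.val v hv x = 0) ∧
      ∫ x, hN.val v hv x ∂μ = 0 := by
  have hopen := isOpen_sublevel hρ.continuous r
  have h1 := hN.val_eq_zero hv (B := (sublevel ρ r)ᶜ) hopen.measurableSet.compl h0
  have h2 := hN.loc_integrable ⟨v, hN.dom_le v hv⟩ hv _ hopen (hρ.relCompact r hr)
  have h3 : IsCompact (supp μ v) :=
    (hρ.relCompact r hr).of_isClosed_subset Measure.isClosed_support
      (supp_subset_of_isClosed isClosed_closure (by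
        filter_upwards [h0] with x hx hxc using hx fun h => hxc (subset_closure h)))
  refine ⟨?_, h1, hN.divFree ⟨v, hN.dom_le v hv⟩ hv h3⟩
  refine (integrable_indicator_iff hopen.measurableSet).2 h2 |>.congr ?_
  filter_upwards [h1] with x hx
  by_cases hxr : x ∈ sublevel ρ r
  · rw [indicator_of_mem hxr]; rfl
  · rw [indicator_of_notMem hxr, hx hxr]

set_option maxHeartbeats 1000000 in
include hreg hloc in
/-- The energy inequalities for an element of the domain of a local generator. -/
theorem exists_energy_bound {ψ θ : ℝ → ℝ} (hψ : ContDiff ℝ 1 ψ) {C : ℝ}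
    (hC : ∀ r, |ψ r| ≤ C ∧ |deriv ψ r| ≤ C) {M : ℕ} (hM : 0 < M) {κ : ℝ}
    (hψM : ∀ r : ℝ, M ≤ r → ψ r = κ) (hθ : ContDiff ℝ 1 θ)
    (hCθ : ∀ r, |θ r| ≤ C ∧ |deriv θ r| ≤ C) (hθM : ∀ r : ℝ, M ≤ r → θ r = 0)
    {R : ℝ} (hMR : M ≤ R) {c : ℝ}
    (hc : ∀ᵐ x ∂μ, deriv ψ (ρ x) ^ 2 * Γ.gammaLoc hρ x + deriv ψ (ρ x) * hN.nLoc hρ x ≤ c)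
    {D : ℝ} (hDint : Integrable (fun x => Real.exp (-ψ (ρ x)) ^ 2 * deriv θ (ρ x) ^ 2 *
      (Γ.gammaLoc hρ x + (deriv ψ (ρ x) * Γ.gammaLoc hρ x + hN.nLoc hρ x) ^ 2)) μ)
    (hD : ∫ x, Real.exp (-ψ (ρ x)) ^ 2 * deriv θ (ρ x) ^ 2 *
      (Γ.gammaLoc hρ x + (deriv ψ (ρ x) * Γ.gammaLoc hρ x + hN.nLoc hρ x) ^ 2) ∂μ ≤ D)
    {y : E → ℝ} {v : Lp ℝ 2 μ} (hv : 𝓔.MemBdd v)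
    (hv0 : ∀ᵐ x ∂μ, x ∉ sublevel ρ R → v x = 0)
    (hrep : ∀ (u : Lp ℝ 2 μ) (hu : 𝓔.MemBdd u), (∀ᵐ x ∂μ, x ∉ sublevel ρ R → u x = 0) →
        -∫ x in sublevel ρ R, y x * u x ∂μ =
          ∫ x, Γ.gamma ⟨u, hu.1⟩ ⟨v, hv.1⟩ x ∂μ
            + ∫ x in sublevel ρ R, u x * hN.val v hv x ∂μ) :
    ∃ Q : ℝ, 0 ≤ Q ∧
      ∫ x in sublevel ρ R, y x * (Real.exp (ψ (ρ x)) ^ 2 * v x) ∂μ ≤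
        c * (∫ x, v x ^ 2 * Real.exp (ψ (ρ x)) ^ 2 ∂μ) - Q ∧
      ∀ l : ℝ, 0 < l → -(l * (Q + ∫ x, v x ^ 2 * Real.exp (ψ (ρ x)) ^ 2 ∂μ)) - D / (4 * l) ≤
        ∫ x in sublevel ρ R, y x * θ (ρ x) ∂μ := by
  have hM' : (0 : ℝ) < M := by exact_mod_cast hM
  have hR0 : 0 < R := hM'.trans_le hMR
  have hmeasR : MeasurableSet (sublevel ρ R) := (isOpen_sublevel hρ.continuous R).measurableSet
  set v' : 𝓔.dom := ⟨v, hv.1⟩ with hv'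
  have hdψ : ∀ r : ℝ, M ≤ r → deriv ψ r = 0 := fun r hr =>
    deriv_eq_zero_of_eq_zero_on_Ici hψ hψM hr
  have hdθ : ∀ r : ℝ, M ≤ r → deriv θ r = 0 := fun r hr =>
    deriv_eq_zero_of_eq_zero_on_Ici hθ hθM hr
  obtain ⟨q, hq, hqv, hqΓ, hqN⟩ := hρ.exists_exp_mul Γ hreg hloc hN hψ hC hM hψM v' hv
  obtain ⟨q2, hq2, hq2v, hq2Γ, hq2N⟩ := hρ.exists_exp_mul Γ hreg hloc hN hψ hC hM hψM q hq
  obtain ⟨u, hu, huθ, huΓ, huN⟩ := hρ.exists_comp Γ hreg hloc hN hθ hCθ hM hθM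
  obtain ⟨P, hP⟩ := SymmDirichletForm.exists_mul q q hq.2 hq.2
  have hPb : 𝓔.MemBdd (P : Lp ℝ 2 μ) := ⟨P.2, (hq.2.mul hq.2).congr hP⟩
  obtain ⟨P', hP'⟩ := SymmDirichletForm.exists_mul u v' hu.2 hv.2
  have hPb' : 𝓔.MemBdd (P' : Lp ℝ 2 μ) := ⟨P'.2, (hu.2.mul hv.2).congr hP'⟩
  have hq0 : ∀ᵐ x ∂μ, x ∉ sublevel ρ R → (q : Lp ℝ 2 μ) x = 0 := by
    filter_upwards [hqv, hv0] with x h1 h2 h3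
    rw [h1]; simp only [hv']; rw [h2 h3, mul_zero]
  have hq20 : ∀ᵐ x ∂μ, x ∉ sublevel ρ R → (q2 : Lp ℝ 2 μ) x = 0 := by
    filter_upwards [hq2v, hq0] with x h1 h2 h3
    rw [h1, h2 h3, mul_zero]
  have hu0 : ∀ᵐ x ∂μ, x ∉ sublevel ρ R → (u : Lp ℝ 2 μ) x = 0 := by
    filter_upwards [huθ] with x h1 h2
    rw [h1, hθM]
    exact hMR.trans (not_lt.1 h2)
  have hP0 : ∀ᵐ x ∂μ, x ∉ sublevel ρ R → (P : Lp ℝ 2 μ) x = 0 := by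
    filter_upwards [hP, hq0] with x h1 h2 h3
    rw [h1, h2 h3, mul_zero]
  have hP0' : ∀ᵐ x ∂μ, x ∉ sublevel ρ R → (P' : Lp ℝ 2 μ) x = 0 := by
    filter_upwards [hP', hu0] with x h1 h2 h3
    rw [h1, h2 h3, zero_mul]
  obtain ⟨hNv, hNv0, -⟩ := hN.integrable_val hv hR0 hρ hv0
  obtain ⟨hNu, hNu0, -⟩ := hN.integrable_val hu hR0 hρ hu0
  obtain ⟨hNP, -, hNP0⟩ := hN.integrable_val hPb hR0 hρ hP0
  obtain ⟨hNP', -, hNP0'⟩ := hN.integrable_val hPb' hR0 hρ hP0'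
  have hset : ∀ f : E → ℝ, (∀ᵐ x ∂μ, x ∉ sublevel ρ R → f x = 0) →
      ∫ x in sublevel ρ R, f x ∂μ = ∫ x, f x ∂μ := fun f hf =>
    setIntegral_eq_integral_of_ae_compl_eq_zero hf
  have hsq : Integrable (fun x => v x ^ 2 * Real.exp (ψ (ρ x)) ^ 2) μ := by
    have h1 : Integrable (fun x => (q : Lp ℝ 2 μ) x ^ 2) μ := (Lp.memLp (q : Lp ℝ 2 μ)).integrable_sq
    refine h1.congr ?_
    filter_upwards [hqv] with x hx
    rw [hx, mul_pow, mul_comm]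
  have hloc' : ∀ᵐ x ∂μ, ρ x < M → Γ.gammaLoc hρ x = Γ.gamma (hρ.approxDom M) (hρ.approxDom M) x ∧
      hN.nLoc hρ x = hN.val (hρ.approxDom M) (hρ.approxDom_memBdd M) x := by
    filter_upwards [Γ.gammaLoc_ae hreg hloc hρ M, hN.nLoc_ae hρ M] with x h1 h2 h3
    exact ⟨h1 (by linarith), h2 (by linarith)⟩
  refine ⟨∫ x, Γ.gamma q q x ∂μ, integral_nonneg_of_ae (Γ.nonneg q), ?_, fun l hl => ?_⟩
  -- Test function `q2 = e^{2ψ} v`, with `q = e^ψ v` and `P = q²`.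
  · have h1 := hrep q2 hq2 hq20
    have h2 : ∫ x in sublevel ρ R, y x * (Real.exp (ψ (ρ x)) ^ 2 * v x) ∂μ =
        ∫ x in sublevel ρ R, y x * (q2 : Lp ℝ 2 μ) x ∂μ := by
      refine integral_congr_ae (ae_restrict_of_ae ?_)
      filter_upwards [hq2v, hqv] with x h3 h4
      rw [h3, h4, hv']
      ring
    have hb2 : EssBdd μ (q2 : Lp ℝ 2 μ) := hq2.2
    obtain ⟨B, hB⟩ := hb2
    have hi1 : Integrable (fun x => (q2 : Lp ℝ 2 μ) x * hN.val v hv x) μ :=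
      hNv.bdd_mul (c := B) (Lp.aestronglyMeasurable _) hB
    have hi2 := hNP.const_mul (2⁻¹ : ℝ)
    have h3 : ∫ x in sublevel ρ R, (q2 : Lp ℝ 2 μ) x * hN.val v hv x ∂μ =
        ∫ x, (q2 : Lp ℝ 2 μ) x * hN.val v hv x ∂μ := hset _ (by
      filter_upwards [hNv0] with x hx hxR
      rw [hx hxR, mul_zero])
    have h4 : ∫ x, Γ.gamma q2 v' x + (q2 : Lp ℝ 2 μ) x * hN.val v hv x - 2⁻¹ * hN.val P hPb x ∂μ =
        ∫ x, Γ.gamma q2 v' x ∂μ + ∫ x, (q2 : Lp ℝ 2 μ) x * hN.val v hv x ∂μ := by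
      have hadd : Integrable (fun x => Γ.gamma q2 v' x + (q2 : Lp ℝ 2 μ) x * hN.val v hv x) μ :=
        (Γ.integrable q2 v').add hi1
      rw [integral_sub hadd hi2, integral_add (Γ.integrable q2 v') hi1, integral_const_mul, hNP0]
      ring
    rw [h2]
    -- Pointwise, `Γ(q2, v) + q2 N v - N(q²)/2` equals `Γ(q, q) - e^{2ψ} v² (ψ'² Γ(ρ, ρ) + ψ'
    -- N(ρ))`. The term `N(q²)` is inserted at no cost, as its integral is 0.
    have h5 : ∫ x, Γ.gamma q q x - c * (v x ^ 2 * Real.exp (ψ (ρ x)) ^ 2) ∂μ ≤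
        ∫ x, Γ.gamma q2 v' x + (q2 : Lp ℝ 2 μ) x * hN.val v hv x - 2⁻¹ * hN.val P hPb x ∂μ := by
      refine integral_mono_ae ((Γ.integrable q q).sub (hsq.const_mul c))
        (((Γ.integrable q2 v').add hi1).sub hi2) ?_
      filter_upwards [hq2Γ v', hqΓ v', hqΓ q, hqΓ (hρ.approxDom M), hq2v, hqv, hqN,
        hN.val_mul hq hq hPb hP, hc, hloc'] with x h6 h7 h8 h9 h10 h11 h12 h13 h14 h15
      have e1 : Γ.gamma v' q x = Γ.gamma q v' x := by rw [Γ.symm]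
      have e2 : Γ.gamma (hρ.approxDom M) q x = Γ.gamma q (hρ.approxDom M) x := by rw [Γ.symm]
      have e3 : Γ.gamma v' (hρ.approxDom M) x = Γ.gamma (hρ.approxDom M) v' x := by rw [Γ.symm]
      have e4 : deriv ψ (ρ x) ^ 2 * Γ.gamma (hρ.approxDom M) (hρ.approxDom M) x +
          deriv ψ (ρ x) * hN.val (hρ.approxDom M) (hρ.approxDom_memBdd M) x ≤ c := by
        rcases lt_or_ge (ρ x) M with h | h
        · rwa [(h15 h).1, (h15 h).2] at h14
        · rw [hdψ _ h] at h14 ⊢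
          simpa using h14
      rw [h8, e1, e2, h9, e3, h6, h13, h12, h7, h10, h11]
      have h16 := mul_le_mul_of_nonneg_left e4
        (show 0 ≤ Real.exp (ψ (ρ x)) ^ 2 * v x ^ 2 by positivity)
      simp only [hv']
      linarith
    rw [integral_sub (Γ.integrable q q) (hsq.const_mul c), integral_const_mul, h4] at h5
    rw [h3] at h1
    linarith
  -- Test function `u = θ(ρ)`.
  · have h1 := hrep u hu hu0
    have h2 : ∫ x in sublevel ρ R, y x * θ (ρ x) ∂μ =
        ∫ x in sublevel ρ R, y x * (u : Lp ℝ 2 μ) x ∂μ := by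
      refine integral_congr_ae (ae_restrict_of_ae ?_)
      filter_upwards [huθ] with x h3
      rw [h3]
    obtain ⟨B, hB⟩ := hu.2
    obtain ⟨B', hB'⟩ := hv.2
    have hi1 : Integrable (fun x => (u : Lp ℝ 2 μ) x * hN.val v hv x) μ :=
      hNv.bdd_mul (c := B) (Lp.aestronglyMeasurable _) hB
    have hi2 : Integrable (fun x => v x * hN.val u hu x) μ :=
      hNu.bdd_mul (c := B') (Lp.aestronglyMeasurable _) hB'
    have h3 : ∫ x in sublevel ρ R, (u : Lp ℝ 2 μ) x * hN.val v hv x ∂μ =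
        ∫ x, (u : Lp ℝ 2 μ) x * hN.val v hv x ∂μ := hset _ (by
      filter_upwards [hNv0] with x hx hxR
      rw [hx hxR, mul_zero])
    -- The integral of `N(u v)` is 0, so `N` moves from `v` to `u`, where it is explicit.
    have h4 : ∫ x, v x * hN.val u hu x ∂μ + ∫ x, (u : Lp ℝ 2 μ) x * hN.val v hv x ∂μ = 0 := by
      rw [← integral_add hi2 hi1, ← hNP0']
      refine integral_congr_ae ?_
      filter_upwards [hN.val_mul hu hv hPb' hP'] with x hx
      rw [hx]
    have h5 : ∫ x, v x * hN.val u hu x - Γ.gamma u v' x ∂μ =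
        ∫ x, v x * hN.val u hu x ∂μ - ∫ x, Γ.gamma u v' x ∂μ :=
      integral_sub hi2 (Γ.integrable u v')
    -- With `v = e^{-ψ} q`, the integrand is `v θ' (N(ρ) + ψ' Γ(ρ, ρ)) - e^{-ψ} Γ(q, u)`. Young's
    -- inequality for each of the two terms leaves `Γ(q, q)` and `v² e^{2ψ}` with factor `l` and the
    -- explicit function of `ρ` with factor `1 / (4 l)`.
    have h6 : ∫ x, -(l * (Γ.gamma q q x + v x ^ 2 * Real.exp (ψ (ρ x)) ^ 2)) -
        (1 / (4 * l)) * (Real.exp (-ψ (ρ x)) ^ 2 * deriv θ (ρ x) ^ 2 *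
      (Γ.gammaLoc hρ x + (deriv ψ (ρ x) * Γ.gammaLoc hρ x + hN.nLoc hρ x) ^ 2)) ∂μ ≤
        ∫ x, v x * hN.val u hu x - Γ.gamma u v' x ∂μ := by
      refine integral_mono_ae ((((Γ.integrable q q).add hsq).const_mul l).neg.sub
        (hDint.const_mul _)) (hi2.sub (Γ.integrable u v')) ?_
      filter_upwards [hqΓ u, huΓ u, huΓ (hρ.approxDom M), huN, hqv, Γ.gamma_sq_le_ae u q, hloc',
        Γ.nonneg q, Γ.nonneg (hρ.approxDom M)] with x h7 h8 h9 h10 h11 h12 h13 h14 h15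
      have e1 : Γ.gamma v' u x = Γ.gamma u v' x := by rw [Γ.symm]
      have e2 : Γ.gamma (hρ.approxDom M) u x = Γ.gamma u (hρ.approxDom M) x := by rw [Γ.symm]
      have e3 : Γ.gamma u q x = Γ.gamma q u x := by rw [Γ.symm]
      rw [e1, e2, h9] at h7
      rw [e2, h9] at h8
      rw [e3, h8] at h12
      have hee : Real.exp (-ψ (ρ x)) * Real.exp (ψ (ρ x)) = 1 := by
        rw [← Real.exp_add, neg_add_cancel, Real.exp_zero]
      set e := Real.exp (ψ (ρ x)) with he
      set e' := Real.exp (-ψ (ρ x)) with he'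
      set T := deriv θ (ρ x) with hT
      set d := deriv ψ (ρ x) with hd
      set G := Γ.gamma (hρ.approxDom M) (hρ.approxDom M) x with hG
      set H := hN.val (hρ.approxDom M) (hρ.approxDom_memBdd M) x with hH
      have hGH : T ^ 2 * (Γ.gammaLoc hρ x + (d * Γ.gammaLoc hρ x + hN.nLoc hρ x) ^ 2) =
          T ^ 2 * (G + (d * G + H) ^ 2) := by
        rcases lt_or_ge (ρ x) M with h | h
        · rw [(h13 h).1, (h13 h).2]
        · rw [hT, hdθ _ h]; ring
      rw [mul_assoc, hGH, h10]
      have hx1 : Γ.gamma u v' x = e' * Γ.gamma q u x - v x * d * (T * G) := by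
        rw [h7]
        simp only [hv']
        linear_combination (-(Γ.gamma u ⟨v, hv.1⟩ x) - v x * d * (T * G)) * hee
      have ha : e' * Γ.gamma q u x ≤ l * Γ.gamma q q x + e' ^ 2 * (T ^ 2 * G) / (4 * l) := by
        refine le_add_of_sq_le_mul (by positivity) (by positivity) ?_
        have : 4 * (l * Γ.gamma q q x * (e' ^ 2 * (T ^ 2 * G) / (4 * l))) =
            e' ^ 2 * (T * (T * G) * Γ.gamma q q x) := by
          field_simp
        rw [this, mul_pow]
        exact mul_le_mul_of_nonneg_left h12 (sq_nonneg _)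
      have hb := neg_le_mul_of_pos hl (v x * e) (e' * T * (d * G + H))
      have hb1 : v x * e * (e' * T * (d * G + H)) = v x * (T * (d * G + H)) := by
        linear_combination (v x * (T * (d * G + H))) * hee
      rw [hb1] at hb
      rw [hx1]
      have hs : 1 / (4 * l) * (e' ^ 2 * (T ^ 2 * (G + (d * G + H) ^ 2))) =
          e' ^ 2 * (T ^ 2 * G) / (4 * l) + (e' * T * (d * G + H)) ^ 2 / (4 * l) := by
        field_simp
      rw [hs]
      rw [mul_pow] at hb
      linarith
    have hneg : Integrable (fun x => -(l * (Γ.gamma q q x + v x ^ 2 *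
        Real.exp (ψ (ρ x)) ^ 2))) μ := (((Γ.integrable q q).add hsq).const_mul l).neg
    rw [integral_sub hneg (hDint.const_mul _),
      integral_neg, integral_const_mul, integral_const_mul,
      integral_add (Γ.integrable q q) hsq] at h6
    rw [h2]
    rw [h3] at h1
    have h7 : 1 / (4 * l) * (∫ x, Real.exp (-ψ (ρ x)) ^ 2 * deriv θ (ρ x) ^ 2 *
      (Γ.gammaLoc hρ x + (deriv ψ (ρ x) * Γ.gammaLoc hρ x + hN.nLoc hρ x) ^ 2) ∂μ) ≤
        D / (4 * l) := by
      rw [one_div, inv_mul_eq_div]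
      gcongr
    change _ = ∫ x, Γ.gamma u v' x ∂μ + _ at h1
    linarith

end SymmDirichletForm
end Weighted
/-! ## From energy inequalities to loss of mass -/

section Dynamics

variable {E : Type*} [MeasurableSpace E] {ν : Measure E} {p : ℝ≥0∞} [Fact (1 ≤ p)]
  [IsFiniteMeasure ν] {S : ℝ → Lp ℝ p ν →L[ℝ] Lp ℝ p ν}

/-- Consider `(lam/2) e^{-(2c+2) r} F(r) - I(r)`. The first energy inequality contributes `-lam
e^{-(2c+2) r} (F + Q)` to its derivative, and the second, with `l = lam e^{-(2c+2) r}`, contributes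
`+l (Q + F)`. The two cancel and only `D² / (4 l) ≤ lam / 4` remains. At time 0, `F(0) ≤ M ∫ g W`.
-/
theorem integral_orbit_ge_of_generatorMaps (hS : IsC0ContractionSemigroup S)
    (hsub : ∀ s : ℝ, 0 ≤ s → IsSubMarkovian (S s)) {W θ : E → ℝ}
    (hW : AEStronglyMeasurable W ν) (hWB : EssBdd ν W) (hW0 : ∀ x, 0 ≤ W x)
    (hθ : AEStronglyMeasurable θ ν) (hθB : EssBdd ν θ) {c D : ℝ} (hc : 0 ≤ c) (hD : 0 < D)
    (hen : ∀ v y : Lp ℝ p ν, GeneratorMaps S v y → EssBdd ν v → ∃ Q : ℝ, 0 ≤ Q ∧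
      ∫ x, y x * (W x * v x) ∂ν ≤ c * (∫ x, v x ^ 2 * W x ∂ν) - Q ∧
      ∀ l : ℝ, 0 < l → -(l * (Q + ∫ x, v x ^ 2 * W x ∂ν)) - D ^ 2 / (4 * l) ≤
        ∫ x, y x * θ x ∂ν) {M : ℝ} (hM : 0 < M) {g y : Lp ℝ p ν} (hgy : GeneratorMaps S g y)
    (hg : ∀ᵐ x ∂ν, 0 ≤ g x ∧ g x ≤ M) (hy : ∀ s : ℝ, 0 ≤ s → EssBdd ν (S s y)) {s τ : ℝ}
    (hs : 0 ≤ s) (hsτ : s ≤ τ) :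
    ∫ x, g x * θ x ∂ν - D * Real.exp ((c + 1) * τ) * (M * ∫ x, g x * W x ∂ν + τ) ≤
      ∫ x, S s g x * θ x ∂ν := by
  have hbd : ∀ r : ℝ, 0 ≤ r → ∀ᵐ x ∂ν, 0 ≤ S r g x ∧ S r g x ≤ M := fun r hr =>
    (hsub r hr).bounds hM hg
  have habs : ∀ r : ℝ, 0 ≤ r → ∀ᵐ x ∂ν, |S r g x| ≤ M := fun r hr => by
    filter_upwards [hbd r hr] with x hx
    rw [abs_of_nonneg hx.1]
    exact hx.2
  set F : ℝ → ℝ := fun r => ∫ x, S r g x ^ 2 * W x ∂ν with hF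
  set I : ℝ → ℝ := fun r => testCLM p θ hθ hθB (S r g) with hI
  have hIe : ∀ r, I r = ∫ x, S r g x * θ x ∂ν := fun r => testCLM_apply θ hθ hθB _
  -- The least value with `D² ≤ lam² e^{-(2c+2) r}` for all `r ≤ τ`.
  set lam : ℝ := D * Real.exp ((c + 1) * τ) with hlam
  have hlam0 : 0 < lam := by positivity
  have hder := fun (r : ℝ) (hr : 0 ≤ r) => hS.hasDerivWithinAt_orbit hgy hr
  have hF' : ∀ r : ℝ, 0 ≤ r →
      HasDerivWithinAt F (2 * ∫ x, S r g x * S r y x * W x ∂ν) (Ici r) r := fun r hr =>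
    hasDerivWithinAt_integral_sq (hder r hr) (fun r' hr' => habs r' (hr.trans hr')) (hy r hr) hW hWB
  have hI' : ∀ r : ℝ, 0 ≤ r → HasDerivWithinAt I (∫ x, S r y x * θ x ∂ν) (Ici r) r := fun r hr => by
    have := (testCLM p θ hθ hθB).hasFDerivAt.comp_hasDerivWithinAt r (hder r hr)
    rwa [testCLM_apply] at this
  have hFc : ContinuousOn F (Ici 0) :=
    continuousOn_integral_sq (hS.continuousOn_orbit g) (fun r hr => habs r hr) hW hWB
  have hIc : ContinuousOn I (Ici 0) :=
    (testCLM p θ hθ hθB).continuous.comp_continuousOn (hS.continuousOn_orbit g)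
  have hF0 : ∀ r, 0 ≤ F r := fun r => integral_nonneg fun x => mul_nonneg (sq_nonneg _) (hW0 x)
  set e : ℝ → ℝ := fun r => Real.exp (-(2 * c + 2) * r) with he
  have hed : ∀ r, HasDerivAt e (e r * -(2 * c + 2)) r := fun r => by
    have h1 : HasDerivAt (fun r : ℝ => -(2 * c + 2) * r) (-(2 * c + 2)) r := by
      simpa using (hasDerivAt_id r).const_mul (-(2 * c + 2))
    exact h1.exp
  -- The generator provides right derivatives only, hence a comparison theorem for these.
  have key := image_le_of_deriv_right_le_deriv_boundary (a := 0) (b := τ)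
    (f := fun r => lam / 2 * (e r * F r) - I r)
    (f' := fun r => lam / 2 * (e r * -(2 * c + 2) * F r +
      e r * (2 * ∫ x, S r g x * S r y x * W x ∂ν)) - ∫ x, S r y x * θ x ∂ν)
    (B := fun r => lam / 2 * F 0 - I 0 + lam / 4 * r) (B' := fun _ => lam / 4)
    (by
      have h1 : ContinuousOn e (Icc 0 τ) := fun r _ => (hed r).continuousAt.continuousWithinAt
      exact ((h1.mul (hFc.mono Icc_subset_Ici_self)).const_smul (lam / 2)).sub
        (hIc.mono Icc_subset_Ici_self))
    (fun r hr => (((hed r).hasDerivWithinAt.mul (hF' r hr.1)).const_mul (lam / 2)).sub (hI' r hr.1))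
    (by simp [he]) (by fun_prop)
    (fun r _ => by
      have h1 : HasDerivAt (fun r : ℝ => lam / 2 * F 0 - I 0 + lam / 4 * r) (lam / 4) r := by
        simpa using ((hasDerivAt_id r).const_mul (lam / 4)).const_add (lam / 2 * F 0 - I 0)
      exact h1.hasDerivWithinAt)
    (fun r hr => by
      obtain ⟨Q, hQ0, hE1, hE2⟩ := hen (S r g) (S r y) (hS.generatorMaps_orbit hgy hr.1)
        ⟨M, habs r hr.1⟩
      have her : 0 < e r := Real.exp_pos _
      have h2 := hE2 (lam * e r) (by positivity)
      have h3 : ∫ x, S r g x * S r y x * W x ∂ν = ∫ x, S r y x * (W x * S r g x) ∂ν :=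
        integral_congr_ae (Eventually.of_forall fun x => by ring)
      have h4 : D ^ 2 / (4 * (lam * e r)) ≤ lam / 4 := by
        rw [div_le_iff₀ (by positivity)]
        have h5 : 1 ≤ Real.exp ((c + 1) * τ) * Real.exp ((c + 1) * τ) * e r := by
          rw [he, ← Real.exp_add, ← Real.exp_add]
          refine Real.one_le_exp ?_
          nlinarith [hr.2]
        have h6 := mul_le_mul_of_nonneg_left h5 (sq_nonneg D)
        rw [hlam]
        linarith
      have h7 := mul_le_mul_of_nonneg_left hE1 (show 0 ≤ lam * e r by positivity)
      rw [h3]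
      change _ ≤ c * F r - Q at hE1
      change -(lam * e r * (Q + F r)) - _ ≤ _ at h2
      change _ ≤ lam * e r * (c * F r - Q) at h7
      linarith)
    (x := s) ⟨hs, hsτ⟩
  have h0 : S 0 g = g := hS.zero_apply g
  have hF0' : F 0 ≤ M * ∫ x, g x * W x ∂ν := by
    obtain ⟨B, hB⟩ := hWB
    have hi : Integrable (fun x => g x * W x) ν := Lp.integrable_mul_of_bdd g hW hB
    rw [← integral_const_mul]
    simp only [hF, h0]
    refine integral_mono_of_nonneg (Eventually.of_forall fun x => mul_nonneg (sq_nonneg _) (hW0 x))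
      (hi.const_mul M) ?_
    filter_upwards [hg] with x hx
    rw [← mul_assoc]
    refine mul_le_mul_of_nonneg_right ?_ (hW0 x)
    nlinarith [hx.1, hx.2]
  have hgW : 0 ≤ M * ∫ x, g x * W x ∂ν := (hF0 0).trans hF0'
  have h8 : 0 ≤ lam / 2 * (e s * F s) := by
    have := hF0 s
    have : 0 < e s := Real.exp_pos _
    positivity
  rw [← hIe s]
  have h9 : I 0 = ∫ x, g x * θ x ∂ν := by rw [hIe, h0]
  rw [← h9]
  have h10 := mul_le_mul_of_nonneg_left hF0' hlam0.le
  have h11 := mul_le_mul_of_nonneg_left hsτ hlam0.le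
  have h12 := mul_nonneg hlam0.le hgW
  have h13 := mul_nonneg hlam0.le (hs.trans hsτ)
  linarith

/-- Sub-Markovian semigroups on a finite measure space: energy inequalities for the generator
bound the loss of mass. -/
theorem integral_orbit_ge (hS : IsC0ContractionSemigroup S)
    (hsub : ∀ s : ℝ, 0 ≤ s → IsSubMarkovian (S s)) {W θ : E → ℝ}
    (hW : AEStronglyMeasurable W ν) (hWB : EssBdd ν W) (hW0 : ∀ x, 0 ≤ W x)
    (hθ : AEStronglyMeasurable θ ν) (hθB : EssBdd ν θ) {c D : ℝ} (hc : 0 ≤ c) (hD : 0 < D)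
    (hen : ∀ v y : Lp ℝ p ν, GeneratorMaps S v y → EssBdd ν v → ∃ Q : ℝ, 0 ≤ Q ∧
      ∫ x, y x * (W x * v x) ∂ν ≤ c * (∫ x, v x ^ 2 * W x ∂ν) - Q ∧
      ∀ l : ℝ, 0 < l → -(l * (Q + ∫ x, v x ^ 2 * W x ∂ν)) - D ^ 2 / (4 * l) ≤
        ∫ x, y x * θ x ∂ν) {M : ℝ} (hM : 0 < M) {f : Lp ℝ p ν}
    (hf : ∀ᵐ x ∂ν, 0 ≤ f x ∧ f x ≤ M) {s τ : ℝ} (hs : 0 ≤ s) (hsτ : s ≤ τ) :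
    ∫ x, f x * θ x ∂ν - D * Real.exp ((c + 1) * τ) * (M * ∫ x, f x * W x ∂ν + τ) ≤
      ∫ x, S s f x * θ x ∂ν := by
  obtain ⟨g, y, hgy, hg, hy, hlim⟩ := exists_bounded_generator_approx hS hsub hM hf
  have h1 := fun j => integral_orbit_ge_of_generatorMaps hS hsub hW hWB hW0 hθ hθB hc hD hen hM
    (hgy j) (hg j) (hy j) hs hsτ
  simp only [← testCLM_apply θ hθ hθB, ← testCLM_apply W hW hWB] at h1 ⊢
  refine le_of_tendsto_of_tendsto' (b := atTop) ?_ ?_ h1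
  · exact (((testCLM p θ hθ hθB).continuous.tendsto f).comp hlim).sub
      ((((((testCLM p W hW hWB).continuous.tendsto f).comp hlim).const_mul M).add_const τ).const_mul _)
  · exact (((testCLM p θ hθ hθB).comp (S s)).continuous.tendsto f).comp hlim

end Dynamics
/-! ## Profiles -/

/-- A smooth step rescaled to `[2m, 4m]`; the constant `L` is independent of `m`, which produces the
factor `1/n` in the criterion. -/
theorem exists_cutoff_profile : ∃ L : ℝ, 0 ≤ L ∧ ∀ m : ℕ, 1 ≤ m → ∃ θ : ℝ → ℝ, ContDiff ℝ 1 θ ∧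
    (∀ r, 0 ≤ θ r ∧ θ r ≤ 1) ∧ (∀ r : ℝ, r ≤ 2 * m → θ r = 1) ∧ (∀ r : ℝ, 4 * m ≤ r → θ r = 0) ∧
    (∀ r, |deriv θ r| ≤ L / m) ∧ ∀ r : ℝ, r < 2 * m → deriv θ r = 0 := by
  have hst : ContDiff ℝ 1 Real.smoothTransition := Real.smoothTransition.contDiff
  obtain ⟨L, hL⟩ := isCompact_Icc.exists_bound_of_continuousOn (s := Icc (0 : ℝ) 1)
    (hst.continuous_deriv le_rfl).continuousOn
  have hL0 : 0 ≤ L := (norm_nonneg _).trans (hL 0 (by simp))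
  have hneg : ∀ r : ℝ, r < 0 → deriv Real.smoothTransition r = 0 := fun r hr => by
    have : Real.smoothTransition =ᶠ[𝓝 r] fun _ => 0 := by
      filter_upwards [Iio_mem_nhds hr] with x hx using
        Real.smoothTransition.zero_of_nonpos (le_of_lt hx)
    rw [this.deriv_eq, deriv_const]
  have hpos : ∀ r : ℝ, 1 < r → deriv Real.smoothTransition r = 0 := fun r hr => by
    have : Real.smoothTransition =ᶠ[𝓝 r] fun _ => 1 := by
      filter_upwards [Ioi_mem_nhds hr] with x hx using
        Real.smoothTransition.one_of_one_le (le_of_lt hx)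
    rw [this.deriv_eq, deriv_const]
  have hbd : ∀ r, |deriv Real.smoothTransition r| ≤ L := fun r => by
    rcases lt_or_ge r 0 with h | h
    · rw [hneg r h, abs_zero]; exact hL0
    · rcases lt_or_ge 1 r with h' | h'
      · rw [hpos r h', abs_zero]; exact hL0
      · exact hL r ⟨h, h'⟩
  refine ⟨L, hL0, fun m hm => ?_⟩
  have hm' : (0 : ℝ) < m := by exact_mod_cast hm
  have hd : ∀ r : ℝ, HasDerivAt (fun r : ℝ => 1 - Real.smoothTransition ((r - 2 * m) / (2 * m)))
      (-(deriv Real.smoothTransition ((r - 2 * m) / (2 * m)) * (1 / (2 * m)))) r := fun r => by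
    have h1 : HasDerivAt (fun r : ℝ => (r - 2 * m) / (2 * m)) (1 / (2 * m)) r :=
      ((hasDerivAt_id r).sub_const _).div_const _
    exact (((hst.differentiable one_ne_zero _).hasDerivAt).comp r h1).const_sub 1
  refine ⟨fun r => 1 - Real.smoothTransition ((r - 2 * m) / (2 * m)), ?_, fun r => ⟨?_, ?_⟩,
    fun r hr => ?_, fun r hr => ?_, fun r => ?_, fun r hr => ?_⟩
  · exact contDiff_const.sub (hst.comp ((contDiff_id.sub contDiff_const).div_const _))
  · exact sub_nonneg.2 (Real.smoothTransition.le_one _)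
  · exact sub_le_self _ (Real.smoothTransition.nonneg _)
  · simp only
    rw [Real.smoothTransition.zero_of_nonpos (div_nonpos_of_nonpos_of_nonneg (by linarith)
      (by positivity)), sub_zero]
  · simp only
    rw [Real.smoothTransition.one_of_one_le ((one_le_div (by positivity)).2 (by linarith)), sub_self]
  · rw [(hd r).deriv, abs_neg, abs_mul, abs_of_pos (show (0 : ℝ) < 1 / (2 * m) by positivity),
      mul_one_div]
    calc _ ≤ L / (2 * m) := by gcongr; exact hbd _
      _ ≤ L / m := by gcongr; linarith
  · rw [(hd r).deriv, hneg _ (div_neg_of_neg_of_pos (by linarith) (by positivity))]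
    simp

section Admissible

variable {φ : ℝ → ℝ} (hφ : IsAdmissible φ)
include hφ

theorem IsAdmissible.continuousOn_dphi : ContinuousOn (dphi φ) (Ici 0) :=
  hφ.contDiffOn.continuousOn_derivWithin (uniqueDiffOn_Ici 0) le_rfl

theorem IsAdmissible.dphi_nonneg (r : ℝ) : 0 ≤ dphi φ r := hφ.monotoneOn.derivWithin_nonneg

theorem IsAdmissible.hasDerivAt {r : ℝ} (hr : 0 < r) : HasDerivAt φ (dphi φ r) r :=
  ((hφ.contDiffOn.differentiableOn one_ne_zero r hr.le).hasDerivWithinAt).hasDerivAt (Ici_mem_nhds hr)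

/-- `ψ` is the primitive of `χ φ'` with a plateau function `0 ≤ χ ≤ 1`. It vanishes up to `k`, so
the weight is 1 on the support of the initial function. It has the full growth of `φ` between `k +
1` and `2m`, and it is constant past `4m`. -/
theorem IsAdmissible.exists_weight_profile {k m : ℕ} (hk : k + 1 ≤ 2 * m) : ∃ ψ : ℝ → ℝ,
    ContDiff ℝ 1 ψ ∧ (∃ C, ∀ r, |ψ r| ≤ C ∧ |deriv ψ r| ≤ C) ∧
    (∃ κ, ∀ r : ℝ, 4 * m ≤ r → ψ r = κ) ∧ (∀ r : ℝ, r ≤ k → ψ r = 0) ∧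
    (∀ r : ℝ, 2 * m ≤ r → φ (2 * m) - φ (k + 1) ≤ ψ r) ∧
    ∀ r : ℝ, 0 ≤ r → ∃ χ : ℝ, 0 ≤ χ ∧ χ ≤ 1 ∧ deriv ψ r = χ * dphi φ r ∧
      (r < k ∨ 4 * m ≤ r → χ = 0) := by
  have hkm : (k : ℝ) + 1 ≤ 2 * m := by exact_mod_cast hk
  have hk0 : (0 : ℝ) ≤ k := Nat.cast_nonneg k
  have hm0 : (0 : ℝ) < m := by linarith
  -- A trapezoid: rising on `[k, k+1]`, equal to 1 on `[k+1, 2m]`, falling to 0 on `[2m, 4m]`.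
  set χ : ℝ → ℝ := fun x => max 0 (min 1 (min (x - k) ((4 * m - x) / (2 * m)))) with hχ
  have hχc : Continuous χ := by fun_prop
  have hχ0 : ∀ x, 0 ≤ χ x := fun x => le_max_left _ _
  have hχ1 : ∀ x, χ x ≤ 1 := fun x => max_le zero_le_one (min_le_left _ _)
  have hχk : ∀ x : ℝ, x ≤ k → χ x = 0 := fun x hx =>
    max_eq_left ((min_le_right _ _).trans ((min_le_left _ _).trans (by linarith)))
  have hχm : ∀ x : ℝ, 4 * m ≤ x → χ x = 0 := fun x hx =>
    max_eq_left ((min_le_right _ _).trans ((min_le_right _ _).trans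
      (div_nonpos_of_nonpos_of_nonneg (by linarith) (by positivity))))
  have hχi : ∀ x : ℝ, k + 1 ≤ x → x ≤ 2 * m → χ x = 1 := fun x h1 h2 => by
    have h3 : (1 : ℝ) ≤ (4 * m - x) / (2 * m) := (one_le_div (by positivity)).2 (by linarith)
    simp only [hχ]
    rw [min_eq_left (le_min (by linarith) h3), max_eq_right zero_le_one]
  -- The derivative of `φ` is continuous on `[0, ∞)` only, hence `max x 0`; for negative `x` the
  -- factor `χ` vanishes.
  set d : ℝ → ℝ := fun x => χ x * dphi φ (max x 0) with hd
  have hdc : Continuous d := hχc.mul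
    (hφ.continuousOn_dphi.comp_continuous (by fun_prop) fun x => mem_Ici.2 (le_max_right _ _))
  have hd0 : ∀ x, 0 ≤ d x := fun x => mul_nonneg (hχ0 x) (hφ.dphi_nonneg _)
  obtain ⟨ψ, hψ, hdψ, hψi⟩ := exists_primitive hdc
  have hsub : ∀ x y : ℝ, ψ y - ψ x = ∫ z in x..y, d z := fun x y => by
    rw [hψi, hψi, intervalIntegral.integral_interval_sub_left (hdc.intervalIntegrable _ _)
      (hdc.intervalIntegrable _ _)]
  have hmono : Monotone ψ := monotone_of_deriv_nonneg (hψ.differentiable one_ne_zero) fun x => by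
    rw [hdψ]; exact hd0 x
  have hψk : ∀ r : ℝ, r ≤ k → ψ r = 0 := fun r hr => by
    rw [hψi]
    refine (intervalIntegral.integral_congr (g := fun _ => (0 : ℝ)) fun x hx => ?_).trans
      intervalIntegral.integral_zero
    have : x ≤ k := (hx.2).trans (max_le hk0 hr)
    simp only [hd, hχk x this, zero_mul]
  have hψm : ∀ r : ℝ, 4 * m ≤ r → ψ r = ψ (4 * m) := fun r hr => by
    rw [← sub_eq_zero, hsub]
    refine (intervalIntegral.integral_congr (g := fun _ => (0 : ℝ)) fun x hx => ?_).trans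
      intervalIntegral.integral_zero
    rw [uIcc_of_le hr] at hx
    simp only [hd, hχm x hx.1, zero_mul]
  obtain ⟨B, hB⟩ := isCompact_Icc.exists_bound_of_continuousOn (s := Icc (0 : ℝ) (4 * m))
    hdc.continuousOn
  have hψ0 : ∀ r, 0 ≤ ψ r := fun r => by
    rcases le_total r 0 with h | h
    · exact (hψk r (h.trans hk0)).ge
    · rw [← hψk 0 hk0]; exact hmono h
  refine ⟨ψ, hψ, ⟨max B (ψ (4 * m)), fun r => ⟨?_, ?_⟩⟩, ⟨_, hψm⟩, hψk, fun r hr => ?_,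
    fun r hr => ⟨χ r, hχ0 r, hχ1 r, ?_, ?_⟩⟩
  · rw [abs_of_nonneg (hψ0 r)]
    refine le_trans ?_ (le_max_right _ _)
    rcases le_total (4 * m : ℝ) r with h | h
    · rw [hψm r h]
    · exact hmono h
  · rw [hdψ]
    by_cases hr : r ∈ Icc (0 : ℝ) (4 * m)
    · exact (hB r hr).trans (le_max_left _ _)
    · have hχr : χ r = 0 := by
        rcases lt_or_ge r 0 with h | h
        · exact hχk r (h.le.trans hk0)
        · exact hχm r (not_lt.1 fun h' => hr ⟨h, h'.le⟩)
      simp only [hd, hχr, zero_mul, abs_zero]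
      exact (hψ0 _).trans (le_max_right _ _)
  · have h1 : φ (2 * m) - φ (k + 1) = ∫ z in ((k : ℝ) + 1)..(2 * m), d z := by
      rw [← intervalIntegral.integral_eq_sub_of_hasDerivAt (f := φ) (f' := dphi φ)]
      · refine intervalIntegral.integral_congr fun x hx => ?_
        rw [uIcc_of_le hkm] at hx
        simp only [hd, hχi x hx.1 hx.2, one_mul]
        rw [max_eq_left (by linarith [hx.1])]
      · intro x hx
        rw [uIcc_of_le hkm] at hx
        exact hφ.hasDerivAt (by linarith [hx.1])
      · refine (hφ.continuousOn_dphi.mono fun x hx => ?_).intervalIntegrable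
        rw [uIcc_of_le hkm] at hx
        exact le_trans (by linarith) hx.1
    rw [h1, ← hsub]
    linarith [hmono hr, hψ0 (k + 1)]
  · rw [hdψ]
    simp only [hd]
    rw [max_eq_left hr]
  · rintro (h | h)
    · exact hχk r h.le
    · exact hχm r h

end Admissible

/-! ## Essential suprema -/

section EssSup

variable {E : Type*} [MeasurableSpace E] {ν : Measure E} {f : E → ℝ}

theorem EssBdd.ae_le_essSup (hf : EssBdd ν f) : ∀ᵐ x ∂ν, f x ≤ essSup f ν := by
  obtain ⟨C, hC⟩ := hf
  exact _root_.ae_le_essSup ⟨C, eventually_map.2 (hC.mono fun x hx => (le_abs_self _).trans hx)⟩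

/-- For the zero measure the real `essSup` is the infimum of all of `ℝ`, whose default value 0
agrees with the convention for null sets. -/
theorem essSup_zero_measure (f : E → ℝ) : essSup f (0 : Measure E) = 0 := by
  simp [essSup, limsup, limsSup]

theorem EssBdd.essSup_nonneg (hf : EssBdd ν f) (h0 : ∀ᵐ x ∂ν, 0 ≤ f x) : 0 ≤ essSup f ν := by
  rcases eq_or_ne ν 0 with rfl | hν
  · rw [essSup_zero_measure]
  · have : (ae ν).NeBot := ae_neBot.2 hν
    obtain ⟨x, h1, h2⟩ := (hf.ae_le_essSup.and h0).exists
    exact h2.trans h1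

theorem essSup_le_of_nonneg {c : ℝ} (hc : 0 ≤ c) (hf : ∀ᵐ x ∂ν, f x ≤ c)
    (h0 : ∀ᵐ x ∂ν, 0 ≤ f x) : essSup f ν ≤ c := by
  rcases eq_or_ne ν 0 with rfl | hν
  · rwa [essSup_zero_measure]
  · have : (ae ν).NeBot := ae_neBot.2 hν
    exact essSup_le_of_ae_le c hf (IsCoboundedUnder.of_frequently_ge (a := 0) h0.frequently)

end EssSup
/-! ## The coefficients of the criterion -/

/-- For an eventually non-negative sequence the lower limit is at least 0, so a vanishing upper
limit means convergence. -/
theorem limsup_coe_eq_zero_iff {u : ℕ → ℝ} (h0 : ∀ᶠ n in atTop, 0 ≤ u n) :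
    limsup (fun n => (u n : EReal)) atTop = 0 ↔ Tendsto u atTop (𝓝 0) := by
  constructor
  · intro h
    rw [← EReal.tendsto_coe]
    refine tendsto_of_le_liminf_of_limsup_le ?_ h.le
    exact le_liminf_of_le (by isBoundedDefault) (h0.mono fun n hn => by exact_mod_cast hn)
  · intro h
    exact ((EReal.tendsto_coe.2 h).limsup_eq).trans EReal.coe_zero

theorem sq_toReal_eLpNorm_two {E : Type*} [MeasurableSpace E] {ν : Measure E} {f : E → ℝ}
    (hf : MemLp f 2 ν) : (eLpNorm f 2 ν).toReal ^ 2 = ∫ x, f x ^ 2 ∂ν := by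
  have h0 : 0 ≤ ∫ x, f x ^ 2 ∂ν := integral_nonneg fun x => sq_nonneg _
  rw [hf.eLpNorm_eq_integral_rpow_norm two_ne_zero ENNReal.ofNat_ne_top]
  simp only [ENNReal.toReal_ofNat, Real.rpow_ofNat, Real.norm_eq_abs, sq_abs]
  rw [ENNReal.toReal_ofReal (by positivity), ← Real.rpow_natCast, ← Real.rpow_mul h0]
  norm_num

/-- On the annulus `(d G + H)² ≤ 2 b² + 2 H²`, so the integral is at most `ε² δ²` times `(a + 2 b²)
μ(A) + 2 ‖H‖²`, which is dominated by twice a single square. This is where `Â_n` comes from. -/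
theorem integral_annulus_le {E : Type*} [MeasurableSpace E] {μ : Measure E} {A : Set E}
    (hA : MeasurableSet A) (hAfin : μ A ≠ ∞) {e T d G H : E → ℝ}
    (he : AEStronglyMeasurable e μ) (hT : AEStronglyMeasurable T μ) (hd : AEStronglyMeasurable d μ)
    (hG : AEStronglyMeasurable G (μ.restrict A)) (hH : AEStronglyMeasurable H (μ.restrict A))
    (hHb : EssBdd (μ.restrict A) H) {a b ε δ : ℝ} (ha : 0 ≤ a) (hb : 0 ≤ b) 
    (hTA : ∀ x, x ∉ A → T x = 0) (heb : ∀ x ∈ A, |e x| ≤ ε) (hTb : ∀ x, |T x| ≤ δ)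
    (hGa : ∀ᵐ x ∂μ.restrict A, 0 ≤ G x ∧ G x ≤ a)
    (hdG : ∀ᵐ x ∂μ.restrict A, 0 ≤ d x * G x ∧ d x * G x ≤ b) :
    Integrable (fun x => e x ^ 2 * T x ^ 2 * (G x + (d x * G x + H x) ^ 2)) μ ∧
      ∫ x, e x ^ 2 * T x ^ 2 * (G x + (d x * G x + H x) ^ 2) ∂μ ≤
        2 * (ε * δ * ((√a + b) * √(μ.real A) + (eLpNorm H 2 (μ.restrict A)).toReal)) ^ 2 := by
  have hfin : IsFiniteMeasure (μ.restrict A) := isFiniteMeasure_restrict.2 hAfin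
  obtain ⟨B, hB⟩ := hHb
  have hH2 : MemLp H 2 (μ.restrict A) := MemLp.of_bound hH B hB
  have hδ : ∀ x, T x ^ 2 ≤ δ ^ 2 := fun x => sq_le_sq.2 ((hTb x).trans (le_abs_self _))
  have hdom : Integrable (fun x => ε ^ 2 * δ ^ 2 * (a + 2 * b ^ 2 + 2 * H x ^ 2)) (μ.restrict A) :=
    ((integrable_const _).add (hH2.integrable_sq.const_mul 2)).const_mul _
  have hle : ∀ᵐ x ∂μ.restrict A, 0 ≤ e x ^ 2 * T x ^ 2 * (G x + (d x * G x + H x) ^ 2) ∧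
      e x ^ 2 * T x ^ 2 * (G x + (d x * G x + H x) ^ 2) ≤
        ε ^ 2 * δ ^ 2 * (a + 2 * b ^ 2 + 2 * H x ^ 2) := by
    filter_upwards [hGa, hdG, ae_restrict_mem hA] with x h1 h2 h3
    have h4 : e x ^ 2 ≤ ε ^ 2 := sq_le_sq.2 ((heb x h3).trans (le_abs_self _))
    have h5 : 0 ≤ G x + (d x * G x + H x) ^ 2 := add_nonneg h1.1 (sq_nonneg _)
    refine ⟨by positivity, ?_⟩
    refine mul_le_mul (mul_le_mul h4 (hδ x) (sq_nonneg _) (sq_nonneg _)) ?_ h5 (by positivity)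
    nlinarith [sq_nonneg (d x * G x - H x), mul_le_mul h2.2 h2.2 h2.1 hb]
  have hmeas : AEStronglyMeasurable (fun x => e x ^ 2 * T x ^ 2 * (G x + (d x * G x + H x) ^ 2))
      (μ.restrict A) :=
    (((he.restrict).pow 2).mul ((hT.restrict).pow 2)).mul (hG.add (((hd.restrict.mul hG).add hH).pow 2))
  have hint : IntegrableOn (fun x => e x ^ 2 * T x ^ 2 * (G x + (d x * G x + H x) ^ 2)) A μ :=
    hdom.mono' hmeas (hle.mono fun x hx => by
      rw [Real.norm_eq_abs, abs_of_nonneg hx.1]; exact hx.2)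
  have hz : ∀ x, x ∉ A → e x ^ 2 * T x ^ 2 * (G x + (d x * G x + H x) ^ 2) = 0 := fun x hx => by
    rw [hTA x hx]; ring
  refine ⟨(integrableOn_iff_integrable_of_support_subset fun x hx => ?_).1 hint, ?_⟩
  · by_contra h
    exact hx (hz x h)
  · rw [← setIntegral_eq_integral_of_forall_compl_eq_zero hz]
    refine (integral_mono_ae hint hdom (hle.mono fun x hx => hx.2)).trans ?_
    rw [integral_const_mul, integral_add (integrable_const _) (hH2.integrable_sq.const_mul 2),
      integral_const, integral_const_mul, ← sq_toReal_eLpNorm_two hH2]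
    set h := (eLpNorm H 2 (μ.restrict A)).toReal
    have hh : 0 ≤ h := ENNReal.toReal_nonneg
    have e1 : (μ.restrict A).real univ = √(μ.real A) ^ 2 := by
      rw [measureReal_restrict_apply_univ, Real.sq_sqrt measureReal_nonneg]
    rw [e1, smul_eq_mul]
    set s := √(μ.real A)
    have hs : 0 ≤ s := Real.sqrt_nonneg _
    have e2 : a = √a ^ 2 := (Real.sq_sqrt ha).symm
    have hr : 0 ≤ √a := Real.sqrt_nonneg _
    set r := √a
    rw [e2]
    have h1 : s ^ 2 * (r ^ 2 + 2 * b ^ 2) + 2 * h ^ 2 ≤ 2 * ((r + b) * s + h) ^ 2 := by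
      have : 0 ≤ s ^ 2 * r ^ 2 := by positivity
      have : 0 ≤ s ^ 2 * (r * b) := by positivity
      have : 0 ≤ (r + b) * s * h := by positivity
      nlinarith
    have h2 := mul_le_mul_of_nonneg_left h1 (show 0 ≤ ε ^ 2 * δ ^ 2 by positivity)
    linarith

section Coefficients

variable {E : Type*} [MetricSpace E] [LocallyCompactSpace E] [SecondCountableTopology E]
  [MeasurableSpace E] [BorelSpace E] {μ : Measure E} [IsFiniteMeasureOnCompacts μ]
  {𝓔 : SymmDirichletForm μ}

namespace SymmDirichletForm

variable (Γ : 𝓔.CarreDuChamp) (hreg : 𝓔.IsRegular) (hloc : 𝓔.IsStronglyLocal)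
  {N : Lp ℝ 2 μ →ₗ.[ℝ] (E →ₘ[μ] ℝ)} (hN : 𝓔.IsDivFreeDerivation N)
  {ρ : E → ℝ} (hρ : 𝓔.IsExhaustion ρ)

omit [LocallyCompactSpace E] [SecondCountableTopology E] [BorelSpace E] in
include hρ in
theorem IsExhaustion.measure_sublevel_lt_top (r : ℝ) : μ (sublevel ρ r) < ∞ := by
  rcases le_or_gt r 0 with h | h
  · have : sublevel ρ r = ∅ := eq_empty_of_forall_notMem fun x hx =>
      absurd (lt_of_lt_of_le hx h) (not_lt.2 (hρ.nonneg x))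
    rw [this, measure_empty]
    exact ENNReal.zero_lt_top
  · exact (measure_mono subset_closure).trans_lt (hρ.relCompact r h).measure_lt_top

omit [LocallyCompactSpace E] [SecondCountableTopology E] [IsFiniteMeasureOnCompacts μ]
  [BorelSpace E] in
include hρ in
theorem IsExhaustion.essBdd_annulus {K₀ : Set E} {g : E → ℝ} (hg : LocEssBddOff μ K₀ g) {k : ℝ}
    (hk : K₀ ⊆ sublevel ρ k) (r : ℝ) : EssBdd (μ.restrict (sublevel ρ r \ sublevel ρ k)) g := by
  -- This compact set contains the difference of sublevel sets and misses `K₀`; `max r 1` only makes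
  -- the radius positive.
  have hF : IsCompact (closure (sublevel ρ (max r 1)) ∩ {x | k ≤ ρ x}) :=
    (hρ.relCompact _ (by positivity)).inter_right (isClosed_le continuous_const hρ.continuous)
  obtain ⟨C, hC⟩ := hg _ hF fun x hx hxK =>
    absurd (show ρ x < k from hk hxK) (not_lt.2 hx.2)
  refine ⟨C, ae_restrict_of_ae_restrict_of_subset ?_ hC⟩
  exact fun x hx => ⟨subset_closure (lt_of_lt_of_le (show ρ x < r from hx.1) (le_max_left _ _)),
    not_lt.1 (show ¬ρ x < k from hx.2)⟩

omit [IsFiniteMeasureOnCompacts μ] in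
include hreg hloc in
theorem CarreDuChamp.gammaLoc_nonneg : ∀ᵐ x ∂μ, 0 ≤ Γ.gammaLoc hρ x := by
  filter_upwards [ae_all_iff.2 (Γ.gammaLoc_ae hreg hloc hρ),
    ae_all_iff.2 fun M => Γ.nonneg (hρ.approxDom M)] with x h1 h2
  rw [h1 ⌊ρ x⌋₊ (Nat.lt_floor_add_one _)]
  exact h2 _

omit [IsFiniteMeasureOnCompacts μ] in
include hreg hloc in
theorem CarreDuChamp.aestronglyMeasurable_gammaLoc (M : ℕ) :
    AEStronglyMeasurable (Γ.gammaLoc hρ) (μ.restrict (sublevel ρ M)) := by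
  refine (Lp.aestronglyMeasurable (Γ.gamma (hρ.approxDom M) (hρ.approxDom M))).restrict.congr ?_
  filter_upwards [ae_restrict_of_ae (Γ.gammaLoc_ae hreg hloc hρ M),
    ae_restrict_mem (isOpen_sublevel hρ.continuous _).measurableSet] with x h1 h2
  exact (h1 (lt_trans h2 (lt_add_one _))).symm

omit [LocallyCompactSpace E] [SecondCountableTopology E] [IsFiniteMeasureOnCompacts μ] in
theorem IsDivFreeDerivation.aestronglyMeasurable_nLoc (M : ℕ) :
    AEStronglyMeasurable (hN.nLoc hρ) (μ.restrict (sublevel ρ M)) := by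
  refine (AEEqFun.aestronglyMeasurable
    (hN.val (hρ.approxDom M) (hρ.approxDom_memBdd M))).restrict.congr ?_
  filter_upwards [ae_restrict_of_ae (hN.nLoc_ae hρ M),
    ae_restrict_mem (isOpen_sublevel hρ.continuous _).measurableSet] with x h1 h2
  exact (h1 (lt_trans h2 (lt_add_one _))).symm

omit [LocallyCompactSpace E] [SecondCountableTopology E] [IsFiniteMeasureOnCompacts μ]
  [BorelSpace E] in
include hρ in
theorem IsExhaustion.exists_dphi_le {φ : ℝ → ℝ} (hφ : IsAdmissible φ) (r : ℝ) :
    ∃ C : ℝ, 0 ≤ C ∧ ∀ x ∈ sublevel ρ r, |dphi φ (ρ x)| ≤ C := by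
  obtain ⟨C, hC⟩ := isCompact_Icc.exists_bound_of_continuousOn (s := Icc (0 : ℝ) r)
    (hφ.continuousOn_dphi.mono Icc_subset_Ici_self)
  exact ⟨max C 0, le_max_right _ _, fun x hx =>
    (hC _ ⟨hρ.nonneg x, le_of_lt hx⟩).trans (le_max_left _ _)⟩

section Bounds

variable {φ : ℝ → ℝ} (hφ : IsAdmissible φ) {K₀ : Set E} (hΓρ : LocEssBddOff μ K₀ (Γ.gammaLoc hρ))
  (hNρ : LocEssBddOff μ K₀ (hN.nLoc hρ)) {k : ℕ} (hk : K₀ ⊆ sublevel ρ k)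

omit [LocallyCompactSpace E] [SecondCountableTopology E] [IsFiniteMeasureOnCompacts μ] in
include hρ hφ hk in
theorem essBdd_dphi_mul {g : E → ℝ} (hg : LocEssBddOff μ K₀ g) (r : ℝ) :
    EssBdd (μ.restrict (sublevel ρ r \ sublevel ρ k)) (fun x => dphi φ (ρ x) * g x) := by
  obtain ⟨C, hC0, hC⟩ := hρ.exists_dphi_le hφ r
  obtain ⟨B, hB⟩ := hρ.essBdd_annulus hg hk r
  refine ⟨C * B, ?_⟩
  filter_upwards [hB, ae_restrict_mem ((isOpen_sublevel hρ.continuous r).measurableSet.diff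
    (isOpen_sublevel hρ.continuous k).measurableSet)] with x h1 h2
  rw [abs_mul]
  exact mul_le_mul (hC x h2.1) h1 (abs_nonneg _) hC0

omit [LocallyCompactSpace E] [SecondCountableTopology E] [IsFiniteMeasureOnCompacts μ] in
include hφ hΓρ hNρ hk in
theorem essBdd_cCoef (n : ℕ) :
    EssBdd (μ.restrict (sublevel ρ (4 * n) \ sublevel ρ k))
      (fun x => |dphi φ (ρ x) ^ 2 * Γ.gammaLoc hρ x + dphi φ (ρ x) * hN.nLoc hρ x|) := by
  obtain ⟨C, hC0, hC⟩ := hρ.exists_dphi_le hφ (4 * n)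
  obtain ⟨B, hB⟩ := essBdd_dphi_mul hρ hφ hk hΓρ (4 * n)
  obtain ⟨B', hB'⟩ := essBdd_dphi_mul hρ hφ hk hNρ (4 * n)
  refine ⟨C * B + B', ?_⟩
  filter_upwards [hB, hB', ae_restrict_mem ((isOpen_sublevel hρ.continuous _).measurableSet.diff
    (isOpen_sublevel hρ.continuous k).measurableSet)] with x h1 h2 h3
  rw [abs_abs]
  refine (abs_add_le _ _).trans (add_le_add ?_ h2)
  rw [pow_two, mul_assoc, abs_mul]
  exact mul_le_mul (hC x h3.1) h1 (abs_nonneg _) hC0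

omit [LocallyCompactSpace E] [SecondCountableTopology E] [IsFiniteMeasureOnCompacts μ] in
include hφ hΓρ hNρ hk in
theorem cCoef_nonneg (n : ℕ) : 0 ≤ cCoef μ ρ (Γ.gammaLoc hρ) (hN.nLoc hρ) φ k n :=
  (essBdd_cCoef Γ hN hρ hφ hΓρ hNρ hk n).essSup_nonneg (Eventually.of_forall fun _ => abs_nonneg _)

omit [LocallyCompactSpace E] [SecondCountableTopology E] [IsFiniteMeasureOnCompacts μ]
  [MeasurableSpace E] [BorelSpace E] [MetricSpace E] in
theorem annulus_subset {ρ : E → ℝ} {k n : ℕ} (hkn : k ≤ 2 * n) :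
    annulus ρ n ⊆ sublevel ρ (4 * n) \ sublevel ρ k := fun x hx =>
  ⟨hx.1, fun h => hx.2 (lt_of_lt_of_le (show ρ x < k from h) (by exact_mod_cast hkn))⟩

omit [IsFiniteMeasureOnCompacts μ] in
include hreg hloc hφ hΓρ hk in
theorem bCoef_nonneg {n : ℕ} (hkn : k ≤ 2 * n) : 0 ≤ bCoef μ ρ (Γ.gammaLoc hρ) φ n := by
  obtain ⟨C, hC⟩ := essBdd_dphi_mul hρ hφ hk hΓρ (4 * n)
  refine EssBdd.essSup_nonneg ⟨C, ae_restrict_of_ae_restrict_of_subset (annulus_subset hkn) hC⟩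
    (ae_restrict_of_ae ?_)
  filter_upwards [Γ.gammaLoc_nonneg hreg hloc hρ] with x hx
  exact mul_nonneg (hφ.dphi_nonneg _) hx

omit [IsFiniteMeasureOnCompacts μ] in
include hreg hloc hφ hΓρ hk in
theorem aHat_nonneg {n : ℕ} (hkn : k ≤ 2 * n) :
    0 ≤ aHat μ ρ (Γ.gammaLoc hρ) (hN.nLoc hρ) φ n := by
  have := bCoef_nonneg Γ hreg hloc hρ hφ hΓρ hk hkn
  unfold aHat
  positivity

omit [IsFiniteMeasureOnCompacts μ] in
include hreg hloc hφ hΓρ hk in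
theorem criterion_iff (τ : ℝ) (j : ℕ) :
    Criterion μ ρ (Γ.gammaLoc hρ) (hN.nLoc hρ) φ τ j ↔
      Tendsto (fun n : ℕ => Real.exp (-φ (2 * n) +
        cCoef μ ρ (Γ.gammaLoc hρ) (hN.nLoc hρ) φ j n * τ) / n *
          aHat μ ρ (Γ.gammaLoc hρ) (hN.nLoc hρ) φ n) atTop (𝓝 0) := by
  refine limsup_coe_eq_zero_iff ?_
  filter_upwards [eventually_ge_atTop k] with n hn
  have := aHat_nonneg Γ hreg hloc hN hρ hφ hΓρ hk (n := n) (by omega)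
  positivity

omit [IsFiniteMeasureOnCompacts μ] in
include hreg hloc hφ hΓρ hNρ hk in
/-- The criterion does not depend on the index at which the essential suprema `c_n` start. -/
theorem Criterion.of_index {τ : ℝ} (hτ : 0 < τ) {k' : ℕ} (hk' : K₀ ⊆ sublevel ρ k')
    (h : Criterion μ ρ (Γ.gammaLoc hρ) (hN.nLoc hρ) φ τ k) :
    Criterion μ ρ (Γ.gammaLoc hρ) (hN.nLoc hρ) φ τ k' := by
  rw [criterion_iff Γ hreg hloc hN hρ hφ hΓρ hk] at h ⊢
  set c := fun j n => cCoef μ ρ (Γ.gammaLoc hρ) (hN.nLoc hρ) φ j n with hc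
  have hC0 : 0 ≤ c k' k := cCoef_nonneg Γ hN hρ hφ hΓρ hNρ hk' k
  -- A point of `E_{4n} \ E_{k'}` lies either outside `E_k`, where the supremum for `k` applies, or
  -- in `E_k ⊆ E_{4k}`, where the supremum for `k'` at the fixed index `k` applies. So the
  -- exponential changes by a constant factor at most.
  have hle : ∀ n, c k' n ≤ c k n + c k' k := fun n => by
    have h0 : 0 ≤ c k n := cCoef_nonneg Γ hN hρ hφ hΓρ hNρ hk n
    refine essSup_le_of_nonneg (add_nonneg h0 hC0) ?_ (Eventually.of_forall fun _ => abs_nonneg _)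
    have h1 := (essBdd_cCoef Γ hN hρ hφ hΓρ hNρ hk n).ae_le_essSup
    have h2 := (essBdd_cCoef Γ hN hρ hφ hΓρ hNρ hk' k).ae_le_essSup
    have hm := fun r : ℝ => (isOpen_sublevel hρ.continuous r).measurableSet
    rw [ae_restrict_iff' ((hm _).diff (hm _))] at h1 h2 ⊢
    filter_upwards [h1, h2] with x h3 h4 h5
    by_cases hx : x ∈ sublevel ρ k
    · have hxk : x ∈ sublevel ρ (4 * k) := lt_of_lt_of_le (show ρ x < k from hx) (by
        have : (0 : ℝ) ≤ k := Nat.cast_nonneg k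
        linarith)
      exact (h4 ⟨hxk, h5.2⟩).trans (le_add_of_nonneg_left h0)
    · exact (h3 ⟨h5.1, hx⟩).trans (le_add_of_nonneg_right hC0)
  have h' := h.const_mul (Real.exp (c k' k * τ))
  rw [mul_zero] at h'
  refine squeeze_zero' ?_ ?_ h'
  · filter_upwards [eventually_ge_atTop k] with n hn
    have := aHat_nonneg Γ hreg hloc hN hρ hφ hΓρ hk (n := n) (by omega)
    positivity
  · filter_upwards [eventually_ge_atTop k] with n hn
    have h3 := aHat_nonneg Γ hreg hloc hN hρ hφ hΓρ hk (n := n) (by omega)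
    rw [← mul_assoc, ← mul_div_assoc, ← Real.exp_add]
    refine mul_le_mul_of_nonneg_right
      (div_le_div_of_nonneg_right (Real.exp_le_exp.2 ?_) (Nat.cast_nonneg _)) h3
    have := mul_le_mul_of_nonneg_right (hle n) hτ.le
    linarith

end Bounds

end SymmDirichletForm

end Coefficients
/-! ## Loss of mass of the local semigroups -/

section Mass

variable {E : Type*} [MetricSpace E] [LocallyCompactSpace E] [SecondCountableTopology E]
  [MeasurableSpace E] [BorelSpace E] {μ : Measure E} [IsFiniteMeasureOnCompacts μ]
  {𝓔 : SymmDirichletForm μ}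

namespace SymmDirichletForm

variable (Γ : 𝓔.CarreDuChamp) (hreg : 𝓔.IsRegular) (hloc : 𝓔.IsStronglyLocal)
  {N : Lp ℝ 2 μ →ₗ.[ℝ] (E →ₘ[μ] ℝ)} (hN : 𝓔.IsDivFreeDerivation N)
  {ρ : E → ℝ} (hρ : 𝓔.IsExhaustion ρ)
  {φ : ℝ → ℝ} (hφ : IsAdmissible φ) {K₀ : Set E} (hΓρ : LocEssBddOff μ K₀ (Γ.gammaLoc hρ))
  (hNρ : LocEssBddOff μ K₀ (hN.nLoc hρ)) {k : ℕ} (hk : K₀ ⊆ sublevel ρ k)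

include hreg hloc in
/-- The energy inequalities for the generator of a local semigroup. -/
theorem energy_bound_of_locallyRepresents {p : ℝ≥0∞} [Fact (1 ≤ p)]
    {S : ∀ n : ℕ, ℝ → Lp ℝ p (μ.restrict (V ρ n)) →L[ℝ] Lp ℝ p (μ.restrict (V ρ n))}
    (hH2 : LocallyRepresents S Γ hN) {ψ θ : ℝ → ℝ} (hψ : ContDiff ℝ 1 ψ) {C : ℝ}
    (hC : ∀ r, |ψ r| ≤ C ∧ |deriv ψ r| ≤ C) {M : ℕ} (hM : 0 < M) {κ : ℝ}
    (hψM : ∀ r : ℝ, M ≤ r → ψ r = κ) (hθ : ContDiff ℝ 1 θ)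
    (hCθ : ∀ r, |θ r| ≤ C ∧ |deriv θ r| ≤ C) (hθM : ∀ r : ℝ, M ≤ r → θ r = 0)
    {n : ℕ} (hn : 1 ≤ n) (hMn : M ≤ 4 * n) {c : ℝ}
    (hc : ∀ᵐ x ∂μ, deriv ψ (ρ x) ^ 2 * Γ.gammaLoc hρ x + deriv ψ (ρ x) * hN.nLoc hρ x ≤ c)
    {D : ℝ} (hDint : Integrable (fun x => Real.exp (-ψ (ρ x)) ^ 2 * deriv θ (ρ x) ^ 2 *
      (Γ.gammaLoc hρ x + (deriv ψ (ρ x) * Γ.gammaLoc hρ x + hN.nLoc hρ x) ^ 2)) μ)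
    (hD : ∫ x, Real.exp (-ψ (ρ x)) ^ 2 * deriv θ (ρ x) ^ 2 *
      (Γ.gammaLoc hρ x + (deriv ψ (ρ x) * Γ.gammaLoc hρ x + hN.nLoc hρ x) ^ 2) ∂μ ≤ D)
    (v y : Lp ℝ p (μ.restrict (V ρ n))) (hvy : GeneratorMaps (S n) v y)
    (hv : EssBdd (μ.restrict (V ρ n)) v) :
    ∃ Q : ℝ, 0 ≤ Q ∧
      ∫ x, y x * (Real.exp (ψ (ρ x)) ^ 2 * v x) ∂μ.restrict (V ρ n) ≤
        c * (∫ x, v x ^ 2 * Real.exp (ψ (ρ x)) ^ 2 ∂μ.restrict (V ρ n)) - Q ∧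
      ∀ l : ℝ, 0 < l →
        -(l * (Q + ∫ x, v x ^ 2 * Real.exp (ψ (ρ x)) ^ 2 ∂μ.restrict (V ρ n))) - D / (4 * l) ≤
          ∫ x, y x * θ (ρ x) ∂μ.restrict (V ρ n) := by
  obtain ⟨w, hw, hwv, hrep⟩ := hH2 n hn v y hvy hv
  have hmeas : MeasurableSet (V ρ n) := (isOpen_sublevel hρ.continuous _).measurableSet
  have hw0 : ∀ᵐ x ∂μ, x ∉ sublevel ρ (4 * n) → w x = 0 := by
    filter_upwards [hwv] with x hx hxn
    rw [hx]
    exact indicator_of_notMem hxn _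
  have hwr : ∀ᵐ x ∂μ.restrict (V ρ n), w x = v x := by
    filter_upwards [ae_restrict_of_ae hwv, ae_restrict_mem hmeas] with x h1 h2
    rw [h1, indicator_of_mem h2]
  obtain ⟨Q, hQ, h1, h2⟩ := exists_energy_bound Γ hreg hloc hN hρ hψ hC hM hψM hθ hCθ hθM
    (R := 4 * n) (by exact_mod_cast hMn) hc hDint hD hw hw0 hrep
  have e1 : ∫ x, w x ^ 2 * Real.exp (ψ (ρ x)) ^ 2 ∂μ =
      ∫ x, v x ^ 2 * Real.exp (ψ (ρ x)) ^ 2 ∂μ.restrict (V ρ n) := by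
    rw [← setIntegral_eq_integral_of_ae_compl_eq_zero (s := V ρ n) (hw0.mono fun x hx hxn => by
      rw [hx hxn]; ring)]
    exact integral_congr_ae (hwr.mono fun x hx => by simp only [hx])
  have e2 : ∫ x in sublevel ρ (4 * n), y x * (Real.exp (ψ (ρ x)) ^ 2 * w x) ∂μ =
      ∫ x, y x * (Real.exp (ψ (ρ x)) ^ 2 * v x) ∂μ.restrict (V ρ n) :=
    integral_congr_ae (hwr.mono fun x hx => by simp only [hx])
  rw [e1, e2] at h1
  rw [e1] at h2
  exact ⟨Q, hQ, h1, h2⟩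

include hreg hloc hφ hΓρ hNρ hk in
/-- Under the criterion, the local semigroups move little mass far away, up to time `τ`. -/
theorem exists_mass_loss {τ : ℝ} (hτ : 0 < τ)
    (hcrit : Criterion μ ρ (Γ.gammaLoc hρ) (hN.nLoc hρ) φ τ k) {p : ℝ≥0∞} [Fact (1 ≤ p)]
    {S : ∀ n : ℕ, ℝ → Lp ℝ p (μ.restrict (V ρ n)) →L[ℝ] Lp ℝ p (μ.restrict (V ρ n))}
    (hS : ∀ n : ℕ, 1 ≤ n → IsC0ContractionSemigroup (S n))
    (hsub : ∀ n : ℕ, 1 ≤ n → ∀ s : ℝ, 0 ≤ s → IsSubMarkovian (S n s))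
    (hH2 : LocallyRepresents S Γ hN) {M : ℝ} (hM : 0 < M) :
    ∃ err : ℕ → ℝ, Tendsto err atTop (𝓝 0) ∧ ∀ᶠ m in atTop, ∀ n ≥ m,
      ∀ f : Lp ℝ p (μ.restrict (V ρ n)), (∀ᵐ x ∂μ.restrict (V ρ n), 0 ≤ f x ∧ f x ≤ M) →
        (∀ᵐ x ∂μ.restrict (V ρ n), x ∉ sublevel ρ k → f x = 0) → ∀ s : ℝ, 0 ≤ s → s ≤ τ →
          ∫ x, f x ∂μ.restrict (V ρ n) - err m ≤
            ∫ x in V ρ m, S n s f x ∂μ.restrict (V ρ n) := by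
  rw [criterion_iff Γ hreg hloc hN hρ hφ hΓρ hk] at hcrit
  obtain ⟨L, hL0, hL⟩ := exists_cutoff_profile
  set c := fun n => cCoef μ ρ (Γ.gammaLoc hρ) (hN.nLoc hρ) φ k n with hc
  set A := fun n => aHat μ ρ (Γ.gammaLoc hρ) (hN.nLoc hρ) φ n with hA
  -- The error is `D e^{(c_m + 1) τ}` times a bound for `M ∫ f W + τ`, with `D` chosen below. It
  -- depends on `m` but not on `n`, because the profiles `ψ` and `θ` are fixed by `m`.
  refine ⟨fun m => (√2 * (L * Real.exp (φ (k + 1) + τ)) *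
    (Real.exp (-φ (2 * m) + c m * τ) / m * A m) + 1 / m) * (M * (M * μ.real (sublevel ρ k)) + τ),
    ?_, ?_⟩
  · have h1 := ((hcrit.const_mul (√2 * (L * Real.exp (φ (k + 1) + τ)))).add
      tendsto_one_div_atTop_nhds_zero_nat).mul_const (M * (M * μ.real (sublevel ρ k)) + τ)
    simpa using h1
  filter_upwards [eventually_ge_atTop (k + 1)] with m hm n hmn f hf hfk s hs hsτ
  have hm1 : 1 ≤ m := by omega
  have hm0 : (0 : ℝ) < m := by exact_mod_cast hm1
  have hn1 : 1 ≤ n := hm1.trans hmn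
  obtain ⟨θ, hθ, hθ01, hθ1, hθ0, hθd, hθd0⟩ := hL m hm1
  obtain ⟨ψ, hψ, ⟨C, hC⟩, ⟨κ, hκ⟩, hψk, hψm, hψd⟩ :=
    hφ.exists_weight_profile (k := k) (m := m) (by omega)
  have hmeas : ∀ r : ℝ, MeasurableSet (sublevel ρ r) := fun r =>
    (isOpen_sublevel hρ.continuous r).measurableSet
  have hA0 : 0 ≤ A m := aHat_nonneg Γ hreg hloc hN hρ hφ hΓρ hk (by omega)
  have hc0 : 0 ≤ c m := cCoef_nonneg Γ hN hρ hφ hΓρ hNρ hk m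
  have hG0 := Γ.gammaLoc_nonneg hreg hloc hρ
  -- With `ψ' = χ φ'` and `0 ≤ χ ≤ 1`, non-negativity of `Γ(ρ, ρ)` allows `χ²` to be replaced by `χ`
  -- in the quadratic term, leaving `χ` times a quantity bounded by `c_m`.
  have hcae : ∀ᵐ x ∂μ,
      deriv ψ (ρ x) ^ 2 * Γ.gammaLoc hρ x + deriv ψ (ρ x) * hN.nLoc hρ x ≤ c m := by
    have h1 := (essBdd_cCoef Γ hN hρ hφ hΓρ hNρ hk m).ae_le_essSup
    rw [ae_restrict_iff' ((hmeas _).diff (hmeas _))] at h1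
    filter_upwards [h1, hG0] with x h2 h3
    obtain ⟨χ, hχ0, hχ1, hχd, hχz⟩ := hψd (ρ x) (hρ.nonneg x)
    by_cases hx : ρ x < k ∨ 4 * m ≤ ρ x
    · rw [hχd, hχz hx]
      simpa using hc0
    · rw [not_or, not_lt, not_le] at hx
      have h4 := (le_abs_self _).trans (h2 ⟨hx.2, not_lt.2 hx.1⟩)
      change _ ≤ c m at h4
      rw [hχd]
      have h5 : 0 ≤ dphi φ (ρ x) ^ 2 * Γ.gammaLoc hρ x := mul_nonneg (sq_nonneg _) h3
      have h6 := mul_le_mul_of_nonneg_left h4 hχ0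
      have h7 : χ * c m ≤ c m := mul_le_of_le_one_left hc0 hχ1
      have h8 : χ ^ 2 * (dphi φ (ρ x) ^ 2 * Γ.gammaLoc hρ x) ≤
          χ * (dphi φ (ρ x) ^ 2 * Γ.gammaLoc hρ x) :=
        mul_le_mul_of_nonneg_right (by nlinarith) h5
      linarith
  set ε := Real.exp (-(φ (2 * m) - φ (k + 1))) with hε
  have hann : MeasurableSet (annulus ρ m) := (hmeas _).diff (hmeas _)
  have hannsub : annulus ρ m ⊆ sublevel ρ ((4 * m : ℕ) : ℝ) := fun x hx => by
    push_cast
    exact hx.1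
  have hks : annulus ρ m ⊆ sublevel ρ (4 * m) \ sublevel ρ k := annulus_subset (by omega)
  have hcont : Continuous ρ := hρ.continuous
  have hbG : EssBdd (μ.restrict (annulus ρ m)) (Γ.gammaLoc hρ) := by
    obtain ⟨B, hB⟩ := hρ.essBdd_annulus hΓρ hk (4 * m)
    exact ⟨B, ae_restrict_of_ae_restrict_of_subset hks hB⟩
  have hbH : EssBdd (μ.restrict (annulus ρ m)) (hN.nLoc hρ) := by
    obtain ⟨B, hB⟩ := hρ.essBdd_annulus hNρ hk (4 * m)
    exact ⟨B, ae_restrict_of_ae_restrict_of_subset hks hB⟩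
  have hbdG : EssBdd (μ.restrict (annulus ρ m)) (fun x => dphi φ (ρ x) * Γ.gammaLoc hρ x) := by
    obtain ⟨B, hB⟩ := essBdd_dphi_mul hρ hφ hk hΓρ (4 * m)
    exact ⟨B, ae_restrict_of_ae_restrict_of_subset hks hB⟩
  obtain ⟨hDint, hD⟩ := integral_annulus_le (μ := μ) hann
    ((measure_mono fun x hx => hx.1).trans_lt (hρ.measure_sublevel_lt_top (4 * m))).ne
    (e := fun x => Real.exp (-ψ (ρ x))) (T := fun x => deriv θ (ρ x)) (d := fun x => deriv ψ (ρ x))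
    (G := Γ.gammaLoc hρ) (H := hN.nLoc hρ)
    ((Real.continuous_exp.comp (hψ.continuous.comp hcont).neg).aestronglyMeasurable)
    (((hθ.continuous_deriv le_rfl).comp hcont).aestronglyMeasurable)
    (((hψ.continuous_deriv le_rfl).comp hcont).aestronglyMeasurable)
    ((Γ.aestronglyMeasurable_gammaLoc hreg hloc hρ (4 * m)).mono_set hannsub)
    ((hN.aestronglyMeasurable_nLoc hρ (4 * m)).mono_set hannsub) hbH
    (a := aCoef μ ρ (Γ.gammaLoc hρ) m) (b := bCoef μ ρ (Γ.gammaLoc hρ) φ m) (ε := ε) (δ := L / m)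
    (hbG.essSup_nonneg (ae_restrict_of_ae hG0))
    (bCoef_nonneg Γ hreg hloc hρ hφ hΓρ hk (by omega))
    (fun x hx => by
      rcases lt_or_ge (ρ x) (2 * m) with h | h
      · exact hθd0 _ h
      · exact deriv_eq_zero_of_eq_zero_on_Ici hθ hθ0 (not_lt.1 fun h' => hx ⟨h', not_lt.2 h⟩))
    (fun x hx => by
      have := hψm (ρ x) (not_lt.1 (show ¬ρ x < 2 * m from hx.2))
      rw [abs_of_pos (Real.exp_pos _)]
      exact Real.exp_le_exp.2 (neg_le_neg this))
    (fun x => hθd _)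
    (by filter_upwards [hbG.ae_le_essSup, ae_restrict_of_ae hG0] with x h1 h2 using ⟨h2, h1⟩)
    (by
      filter_upwards [hbdG.ae_le_essSup, ae_restrict_of_ae hG0] with x h1 h2
      obtain ⟨χ, hχ0, hχ1, hχd, hχz⟩ := hψd (ρ x) (hρ.nonneg x)
      have h3 : 0 ≤ dphi φ (ρ x) * Γ.gammaLoc hρ x := mul_nonneg (hφ.dphi_nonneg _) h2
      rw [hχd, mul_assoc]
      exact ⟨mul_nonneg hχ0 h3, (mul_le_of_le_one_left h3 hχ1).trans h1⟩)
  -- The factor `√2` matches `integral_annulus_le`. The second summand keeps `D` positive and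
  -- becomes `1/m` after multiplication by `e^{(c_m + 1) τ}`.
  set D := √2 * (ε * (L / m) * A m) + Real.exp (-((c m + 1) * τ)) / m with hDdef
  have hε0 : 0 < ε := Real.exp_pos _
  have hD0 : 0 ≤ √2 * (ε * (L / m) * A m) := by positivity
  have hDpos : 0 < D := by
    have : 0 < Real.exp (-((c m + 1) * τ)) / m := by positivity
    linarith
  have hD2 : 2 * (ε * (L / m) * A m) ^ 2 ≤ D ^ 2 := by
    have h1 : 2 * (ε * (L / m) * A m) ^ 2 = (√2 * (ε * (L / m) * A m)) ^ 2 := by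
      rw [mul_pow √2, Real.sq_sqrt (by norm_num)]
    rw [h1]
    refine pow_le_pow_left₀ hD0 ?_ 2
    rw [hDdef]
    have : 0 < Real.exp (-((c m + 1) * τ)) / m := by positivity
    linarith
  have hCθ : ∀ r, |θ r| ≤ max C (max 1 (L / m)) ∧ |deriv θ r| ≤ max C (max 1 (L / m)) := fun r => by
    constructor
    · rw [abs_of_nonneg (hθ01 r).1]
      exact (hθ01 r).2.trans ((le_max_left _ _).trans (le_max_right _ _))
    · exact (hθd r).trans ((le_max_right _ _).trans (le_max_right _ _))
  have hCψ : ∀ r, |ψ r| ≤ max C (max 1 (L / m)) ∧ |deriv ψ r| ≤ max C (max 1 (L / m)) := fun r =>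
    ⟨(hC r).1.trans (le_max_left _ _), (hC r).2.trans (le_max_left _ _)⟩
  have hfin : IsFiniteMeasure (μ.restrict (V ρ n)) :=
    isFiniteMeasure_restrict.2 (hρ.measure_sublevel_lt_top _).ne
  have hW : Continuous fun x => Real.exp (ψ (ρ x)) ^ 2 :=
    (Real.continuous_exp.comp (hψ.continuous.comp hcont)).pow 2
  have hen := integral_orbit_ge (hS n hn1) (hsub n hn1) (W := fun x => Real.exp (ψ (ρ x)) ^ 2)
    (θ := fun x => θ (ρ x)) hW.aestronglyMeasurable
    ⟨Real.exp C ^ 2, Eventually.of_forall fun x => by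
      rw [abs_of_nonneg (by positivity)]
      exact pow_le_pow_left₀ (Real.exp_pos _).le
        (Real.exp_le_exp.2 ((le_abs_self _).trans (hC _).1)) 2⟩
    (fun x => by positivity) (hθ.continuous.comp hcont).aestronglyMeasurable
    ⟨1, Eventually.of_forall fun x => by
      rw [abs_of_nonneg (hθ01 _).1]; exact (hθ01 _).2⟩ hc0 hDpos
    (energy_bound_of_locallyRepresents Γ hreg hloc hN hρ hH2 hψ hCψ (M := 4 * m) (by omega)
      (fun r hr => hκ r (by push_cast at hr; exact hr)) hθ hCθ
      (fun r hr => hθ0 r (by push_cast at hr; exact hr)) hn1 (by omega) hcae hDint (hD.trans hD2))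
    hM hf hs hsτ
  have hkm : (k : ℝ) + 1 ≤ m := by exact_mod_cast hm
  have hfθ : ∫ x, f x * θ (ρ x) ∂μ.restrict (V ρ n) = ∫ x, f x ∂μ.restrict (V ρ n) := by
    refine integral_congr_ae (hfk.mono fun x hx => ?_)
    by_cases h : x ∈ sublevel ρ k
    · have h' : ρ x < k := h
      simp only [hθ1 (ρ x) (by linarith), mul_one]
    · simp only [hx h, zero_mul]
  have hfW : ∫ x, f x * Real.exp (ψ (ρ x)) ^ 2 ∂μ.restrict (V ρ n) ≤ M * μ.real (sublevel ρ k) := by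
    have h1 : ∫ x, f x * Real.exp (ψ (ρ x)) ^ 2 ∂μ.restrict (V ρ n) =
        ∫ x, f x ∂μ.restrict (V ρ n) := by
      refine integral_congr_ae (hfk.mono fun x hx => ?_)
      by_cases h : x ∈ sublevel ρ k
      · have h' : ρ x < k := h
        simp only [hψk (ρ x) h'.le, Real.exp_zero, one_pow, mul_one]
      · simp only [hx h, zero_mul]
    have hkV : sublevel ρ k ⊆ V ρ n := fun x hx => by
      have h' : ρ x < k := hx
      have h'' : (m : ℝ) ≤ n := by exact_mod_cast hmn
      change ρ x < 4 * n
      linarith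
    rw [h1, ← setIntegral_eq_integral_of_ae_compl_eq_zero hfk, Measure.restrict_restrict (hmeas _),
      inter_eq_left.2 hkV]
    have hfin2 : IsFiniteMeasure (μ.restrict (sublevel ρ k)) :=
      isFiniteMeasure_restrict.2 (hρ.measure_sublevel_lt_top _).ne
    have h3 := ae_restrict_of_ae_restrict_of_subset hkV hf
    calc _ ≤ ∫ _ in sublevel ρ k, M ∂μ := integral_mono_of_nonneg (h3.mono fun x hx => hx.1)
            (integrable_const _) (h3.mono fun x hx => hx.2)
      _ = M * μ.real (sublevel ρ k) := by
        rw [integral_const, measureReal_restrict_apply_univ, smul_eq_mul, mul_comm]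
  have hSf := (hsub n hn1 s hs).bounds hM hf
  -- `θ(ρ) ≤ 1` vanishes off `E_{4m} = V_m`, so the smoothed mass is at most the mass in `V_m`.
  have hup : ∫ x, S n s f x * θ (ρ x) ∂μ.restrict (V ρ n) ≤
      ∫ x in V ρ m, S n s f x ∂μ.restrict (V ρ n) := by
    have hi := Lp.integrable_of_isFiniteMeasure (S n s f)
    have hVm : MeasurableSet (V ρ m) := hmeas _
    rw [← integral_indicator hVm]
    refine integral_mono_of_nonneg (hSf.mono fun x hx => mul_nonneg hx.1 (hθ01 _).1)
      (hi.indicator hVm) (hSf.mono fun x hx => ?_)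
    by_cases h : x ∈ V ρ m
    · simp only [indicator_of_mem h]
      exact mul_le_of_le_one_right hx.1 (hθ01 _).2
    · simp only [indicator_of_notMem h]
      rw [hθ0 (ρ x) (not_lt.1 h), mul_zero]
  refine le_trans ?_ (hen.trans hup)
  rw [hfθ]
  refine sub_le_sub_left ?_ _
  have hDe : D * Real.exp ((c m + 1) * τ) = √2 * (L * Real.exp (φ (k + 1) + τ)) *
      (Real.exp (-φ (2 * m) + c m * τ) / m * A m) + 1 / m := by
    have h1 : Real.exp (-((c m + 1) * τ)) * Real.exp ((c m + 1) * τ) = 1 := by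
      rw [← Real.exp_add, neg_add_cancel, Real.exp_zero]
    have h2 : ε * Real.exp ((c m + 1) * τ) =
        Real.exp (φ (k + 1) + τ) * Real.exp (-φ (2 * m) + c m * τ) := by
      rw [hε, ← Real.exp_add, ← Real.exp_add]
      congr 1
      ring
    rw [hDdef]
    linear_combination (√2 * (L / m) * A m) * h2 + (1 / (m : ℝ)) * h1
  rw [hDe]
  refine mul_le_mul_of_nonneg_left ?_ (by positivity)
  have := mul_le_mul_of_nonneg_left hfW hM.le
  linarith

end SymmDirichletForm

end Mass
-- Iteration over several time steps
section Iteration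

variable {E : Type*} [MetricSpace E] [LocallyCompactSpace E] [SecondCountableTopology E]
  [MeasurableSpace E] [BorelSpace E] {μ : Measure E} [IsFiniteMeasureOnCompacts μ]
  {𝓔 : SymmDirichletForm μ}

namespace SymmDirichletForm

variable (Γ : 𝓔.CarreDuChamp) (hreg : 𝓔.IsRegular) (hloc : 𝓔.IsStronglyLocal)
  {N : Lp ℝ 2 μ →ₗ.[ℝ] (E →ₘ[μ] ℝ)} (hN : 𝓔.IsDivFreeDerivation N)
  {ρ : E → ℝ} (hρ : 𝓔.IsExhaustion ρ)
  {φ : ℝ → ℝ} (hφ : IsAdmissible φ) {K₀ : Set E} (hΓρ : LocEssBddOff μ K₀ (Γ.gammaLoc hρ))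
  (hNρ : LocEssBddOff μ K₀ (hN.nLoc hρ)) {k : ℕ} (hk : K₀ ⊆ sublevel ρ k)

include hreg hloc hφ hΓρ hNρ hk in
/-- Under the criterion with horizon `τ`, at the times `i s`, `s ≤ τ`, the local semigroups keep
the mass of bounded functions tight, uniformly along the exhaustion. -/
theorem exists_tight {τ : ℝ} (hτ : 0 < τ)
    (hcrit : Criterion μ ρ (Γ.gammaLoc hρ) (hN.nLoc hρ) φ τ k) {p : ℝ≥0∞} [Fact (1 ≤ p)]
    {S : ∀ n : ℕ, ℝ → Lp ℝ p (μ.restrict (V ρ n)) →L[ℝ] Lp ℝ p (μ.restrict (V ρ n))}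
    (hS : ∀ n : ℕ, 1 ≤ n → IsC0ContractionSemigroup (S n))
    (hsub : ∀ n : ℕ, 1 ≤ n → ∀ s : ℝ, 0 ≤ s → IsSubMarkovian (S n s))
    (hH2 : LocallyRepresents S Γ hN) {M : ℝ} (hM : 0 < M) {s : ℝ} (hs : 0 ≤ s) (hsτ : s ≤ τ)
    (k' : ℕ) (i : ℕ) : ∀ ε : ℝ, 0 < ε → ∃ J : ℕ, k + k' + 1 ≤ J ∧ ∀ n ≥ J,
      ∀ f : Lp ℝ p (μ.restrict (V ρ n)), (∀ᵐ x ∂μ.restrict (V ρ n), 0 ≤ f x ∧ f x ≤ M) →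
        (∀ᵐ x ∂μ.restrict (V ρ n), x ∉ sublevel ρ k' → f x = 0) →
          ∫ x, f x ∂μ.restrict (V ρ n) - ε ≤
            ∫ x in V ρ J, S n (i * s) f x ∂μ.restrict (V ρ n) := by
  have hmeas : ∀ j : ℕ, MeasurableSet (V ρ j) := fun j =>
    (isOpen_sublevel hρ.continuous _).measurableSet
  have hfin : ∀ j, IsFiniteMeasure (μ.restrict (V ρ j)) := fun j =>
    isFiniteMeasure_restrict.2 (hρ.measure_sublevel_lt_top _).ne
  induction i with
  | zero =>
    refine fun ε hε => ⟨k + k' + 1, le_rfl, fun n hn f hf hfk => ?_⟩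
    have h1 : S n ((0 : ℕ) * s) f = f := by
      rw [Nat.cast_zero, zero_mul, (hS n (by omega)).zero_apply]
    have h5 : ∫ x in V ρ (k + k' + 1), f x ∂μ.restrict (V ρ n) = ∫ x, f x ∂μ.restrict (V ρ n) := by
      refine setIntegral_eq_integral_of_ae_compl_eq_zero (hfk.mono fun x hx hxV => ?_)
      refine hx fun hxk => hxV ?_
      have h2 : ρ x < k' := hxk
      have h3 : (0 : ℝ) ≤ k := Nat.cast_nonneg k
      have h4 : (0 : ℝ) ≤ k' := Nat.cast_nonneg k'
      change ρ x < 4 * ((k + k' + 1 : ℕ) : ℝ)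
      push_cast
      linarith
    rw [h1, h5]
    linarith
  | succ i ih =>
    intro ε hε
    obtain ⟨J, hJ, hJf⟩ := ih (ε / 2) (half_pos hε)
    -- The next step starts from a function supported in `V_J = E_{4J}`, so the estimate is
    -- restarted with index `4 J` in place of `k`.
    have hkJ : K₀ ⊆ sublevel ρ ((4 * J : ℕ) : ℝ) := fun x hx => by
      have h1 : ρ x < k := hk hx
      have h2 : (k : ℝ) ≤ J := by exact_mod_cast (by omega : k ≤ J)
      change ρ x < ((4 * J : ℕ) : ℝ)
      push_cast
      have h3 : (0 : ℝ) ≤ J := Nat.cast_nonneg J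
      linarith
    obtain ⟨err, herr, hloss⟩ := exists_mass_loss Γ hreg hloc hN hρ hφ hΓρ hNρ hkJ hτ
      (Criterion.of_index Γ hreg hloc hN hρ hφ hΓρ hNρ hk hτ hkJ hcrit) hS hsub hH2 hM
    obtain ⟨m, hm1, hm2, hmJ⟩ := (hloss.and ((herr.eventually (gt_mem_nhds (half_pos hε))).and
      (eventually_ge_atTop J))).exists
    refine ⟨m, by omega, fun n hn f hf hfk => ?_⟩
    have hn1 : 1 ≤ n := by omega
    have his : 0 ≤ (i : ℝ) * s := by positivity
    set g := S n (i * s) f with hg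
    have hgb := (hsub n hn1 _ his).bounds hM hf
    -- Only `h = 1_{V_J} g` is propagated. Positivity gives `S h ≤ S g`, and the mass lost in the
    -- cutoff is already controlled by the induction hypothesis.
    have hmem : MemLp ((V ρ J).indicator g) p (μ.restrict (V ρ n)) :=
      (Lp.memLp g).indicator (hmeas J)
    set h := hmem.toLp with hh
    have hhe : h =ᵐ[μ.restrict (V ρ n)] (V ρ J).indicator g := hmem.coeFn_toLp
    have hhb : ∀ᵐ x ∂μ.restrict (V ρ n), 0 ≤ h x ∧ h x ≤ M := by
      filter_upwards [hhe, hgb] with x h1 h2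
      rw [h1]
      by_cases hx : x ∈ V ρ J
      · rw [indicator_of_mem hx]; exact h2
      · rw [indicator_of_notMem hx]; exact ⟨le_rfl, hM.le⟩
    have hgh : ∀ᵐ x ∂μ.restrict (V ρ n), 0 ≤ (g - h) x ∧ (g - h) x ≤ M := by
      filter_upwards [hhe, hgb, Lp.coeFn_sub g h] with x h1 h2 h3
      rw [h3, Pi.sub_apply, h1]
      by_cases hx : x ∈ V ρ J
      · rw [indicator_of_mem hx, sub_self]; exact ⟨le_rfl, hM.le⟩
      · rw [indicator_of_notMem hx, sub_zero]; exact h2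
    have h1 := hm1 n hn h hhb (by
      filter_upwards [hhe] with x hx hxn
      rw [hx]
      refine indicator_of_notMem (fun hxJ => hxn ?_) _
      change ρ x < ((4 * J : ℕ) : ℝ)
      push_cast
      exact hxJ) s hs hsτ
    have h2 := hJf n (hmJ.trans hn) f hf hfk
    have h3 : ∫ x, h x ∂μ.restrict (V ρ n) = ∫ x in V ρ J, g x ∂μ.restrict (V ρ n) := by
      rw [← integral_indicator (hmeas J)]
      exact integral_congr_ae hhe
    have h4 : S n ((i + 1 : ℕ) * s) f = S n s g := by
      rw [hg, ← (hS n hn1).apply_add hs his]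
      congr 2
      push_cast
      ring
    have h5 : ∫ x in V ρ m, S n s h x ∂μ.restrict (V ρ n) ≤
        ∫ x in V ρ m, S n s g x ∂μ.restrict (V ρ n) := by
      refine integral_mono_ae (Lp.integrable_of_isFiniteMeasure _).restrict
        (Lp.integrable_of_isFiniteMeasure _).restrict (ae_restrict_of_ae ?_)
      filter_upwards [(hsub n hn1 s hs).bounds hM hgh, Lp.coeFn_sub (S n s g) (S n s h)]
        with x h6 h7
      rw [map_sub, h7, Pi.sub_apply] at h6
      exact sub_nonneg.1 h6.1
    rw [h4]
    rw [h3] at h1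
    linarith

end SymmDirichletForm
end Iteration
/-! ## Duality and mass preservation -/

section Duality

variable {E : Type*} [MeasurableSpace E] {μ : Measure E}

theorem inner_eq_integral_mul (f g : Lp ℝ 2 μ) : inner ℝ f g = ∫ x, f x * g x ∂μ := by
  rw [L2.inner_def]
  refine integral_congr_ae (Eventually.of_forall fun x => ?_)
  simp [mul_comm]

theorem integral_mul_adjoint (A : Lp ℝ 2 μ →L[ℝ] Lp ℝ 2 μ) (f g : Lp ℝ 2 μ) :
    ∫ x, f x * ContinuousLinearMap.adjoint A g x ∂μ = ∫ x, A f x * g x ∂μ := by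
  rw [← inner_eq_integral_mul, ← inner_eq_integral_mul, ContinuousLinearMap.adjoint_inner_right]

theorem setIntegral_adjoint (A : Lp ℝ 2 μ →L[ℝ] Lp ℝ 2 μ) (g : Lp ℝ 2 μ) {B : Set E}
    (hB : MeasurableSet B) (hμB : μ B ≠ ∞) :
    ∫ x in B, ContinuousLinearMap.adjoint A g x ∂μ =
      ∫ x, A (indicatorConstLp 2 hB hμB (1 : ℝ)) x * g x ∂μ := by
  rw [← L2.inner_indicatorConstLp_one hB hμB, inner_eq_integral_mul, integral_mul_adjoint]

theorem setIntegral_eq_integral_mul_adjoint (A : Lp ℝ 2 μ →L[ℝ] Lp ℝ 2 μ) (g : Lp ℝ 2 μ)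
    {B : Set E} (hB : MeasurableSet B) (hμB : μ B ≠ ∞) :
    ∫ x in B, A g x ∂μ =
      ∫ x, g x * ContinuousLinearMap.adjoint A (indicatorConstLp 2 hB hμB (1 : ℝ)) x ∂μ := by
  rw [← L2.inner_indicatorConstLp_one hB hμB, inner_eq_integral_mul, integral_mul_adjoint]
  exact integral_congr_ae (Eventually.of_forall fun x => mul_comm _ _)

theorem indicatorConstLp_one_bounds {B : Set E} (hB : MeasurableSet B) (hμB : μ B ≠ ∞) :
    ∀ᵐ x ∂μ, 0 ≤ indicatorConstLp 2 hB hμB (1 : ℝ) x ∧ indicatorConstLp 2 hB hμB (1 : ℝ) x ≤ 1 := by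
  filter_upwards [indicatorConstLp_coeFn (p := 2) (hs := hB) (hμs := hμB) (c := (1 : ℝ))] with x hx
  rw [hx]
  exact ⟨indicator_nonneg (fun _ _ => zero_le_one) x, indicator_le_self' (fun _ _ => zero_le_one) x⟩

theorem Lp.integrable_mul (f g : Lp ℝ 2 μ) : Integrable (fun x => f x * g x) μ :=
  (Lp.memLp f).integrable_mul (Lp.memLp g)

variable [SigmaFinite μ] {A : Lp ℝ 2 μ →L[ℝ] Lp ℝ 2 μ}

theorem IsSubMarkovian.adjoint_nonneg (hA : IsSubMarkovian A) {g : Lp ℝ 2 μ}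
    (hg : ∀ᵐ x ∂μ, 0 ≤ g x) : ∀ᵐ x ∂μ, 0 ≤ ContinuousLinearMap.adjoint A g x := by
  refine ae_nonneg_of_forall_setIntegral_nonneg_of_sigmaFinite
    (fun B hB hμB => integrableOn_Lp_of_measure_ne_top _ fact_one_le_two_ennreal.elim hμB.ne) fun B hB hμB => ?_
  rw [setIntegral_adjoint A g hB hμB.ne]
  refine integral_nonneg_of_ae ?_
  filter_upwards [hA _ (indicatorConstLp_one_bounds hB hμB.ne), hg] with x h1 h2
  exact mul_nonneg h1.1 h2

/-- The integral of `A* g` over a set `B` of finite measure is `∫ A(1_B) g`, and `A 1_B ≤ 1`. -/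
theorem IsSubMarkovian.lintegral_adjoint_le (hA : IsSubMarkovian A) {g : Lp ℝ 2 μ}
    (hg : ∀ᵐ x ∂μ, 0 ≤ g x) :
    ∫⁻ x, ENNReal.ofReal (ContinuousLinearMap.adjoint A g x) ∂μ ≤
      ∫⁻ x, ENNReal.ofReal (g x) ∂μ := by
  refine lintegral_le_of_forall_fin_meas_le _ (fun B hB hμB => ?_)
  have hi : IntegrableOn (ContinuousLinearMap.adjoint A g) B μ :=
    integrableOn_Lp_of_measure_ne_top _ fact_one_le_two_ennreal.elim hμB
  rw [← ofReal_integral_eq_lintegral_ofReal hi (ae_restrict_of_ae (hA.adjoint_nonneg hg)),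
    setIntegral_adjoint A g hB hμB, ofReal_integral_eq_lintegral_ofReal (Lp.integrable_mul _ _)]
  · refine lintegral_mono_ae ?_
    filter_upwards [hA _ (indicatorConstLp_one_bounds hB hμB), hg] with x h1 h2
    exact ENNReal.ofReal_le_ofReal (mul_le_of_le_one_left h2 h1.2)
  · filter_upwards [hA _ (indicatorConstLp_one_bounds hB hμB), hg] with x h1 h2
    exact mul_nonneg h1.1 h2

/-- `A` preserves the integral of non-negative functions. -/
def PreservesMass (A : Lp ℝ 2 μ →L[ℝ] Lp ℝ 2 μ) : Prop :=
  ∀ g : Lp ℝ 2 μ, (∀ᵐ x ∂μ, 0 ≤ g x) →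
    ∫⁻ x, ENNReal.ofReal (A g x) ∂μ = ∫⁻ x, ENNReal.ofReal (g x) ∂μ

omit [SigmaFinite μ] in
theorem IsSubMarkovian.apply_mono (hA : IsSubMarkovian A) {f g : Lp ℝ 2 μ}
    (hf : EssBdd μ f) (hg : EssBdd μ g) (hfg : ∀ᵐ x ∂μ, f x ≤ g x) : ∀ᵐ x ∂μ, A f x ≤ A g x := by
  obtain ⟨C, hC⟩ := hf
  obtain ⟨C', hC'⟩ := hg
  have h := hA.bounds (f := g - f) (M := max (C + C') 1) (by positivity) (by
    filter_upwards [hC, hC', hfg, Lp.coeFn_sub g f] with x h1 h2 h3 h4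
    rw [h4, Pi.sub_apply]
    refine ⟨sub_nonneg.2 h3, le_trans ?_ (le_max_left _ _)⟩
    linarith [(abs_le.1 h1).1, (abs_le.1 h2).2])
  filter_upwards [h, Lp.coeFn_sub (A g) (A f)] with x h1 h2
  rw [map_sub, h2, Pi.sub_apply] at h1
  exact sub_nonneg.1 h1.1

/-- If the adjoint of a sub-Markovian operator preserves mass, the operator preserves `1`. -/
theorem IsSubMarkovian.monotoneExtensionMaps_one (hA : IsSubMarkovian A)
    (hmass : PreservesMass (ContinuousLinearMap.adjoint A)) :
    MonotoneExtensionMaps A (fun _ => 1) (fun _ => 1) := by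
  intro F hFb hF
  have hmono : ∀ᵐ x ∂μ, Monotone fun k => A (F k) x := by
    have h1 : ∀ k, ∀ᵐ x ∂μ, A (F k) x ≤ A (F (k + 1)) x := fun k =>
      hA.apply_mono (hFb k) (hFb (k + 1)) (hF.mono fun x hx => hx.1 k.le_succ)
    filter_upwards [ae_all_iff.2 h1] with x hx using monotone_nat_of_le_succ hx
  have hle1 : ∀ᵐ x ∂μ, ∀ k, F k x ≤ 1 := hF.mono fun x hx k => hx.1.ge_of_tendsto hx.2 k
  have hbd : ∀ᵐ x ∂μ, ∀ k, A (F k) x ≤ 1 := by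
    refine ae_all_iff.2 fun k => ?_
    obtain ⟨C, hC⟩ := hFb k
    -- `F k` may be negative, so sub-Markovianity is applied to its positive part.
    have hpos := Lp.coeFn_posPart (F k)
    have hP01 : ∀ᵐ x ∂μ, 0 ≤ Lp.posPart (F k) x ∧ Lp.posPart (F k) x ≤ 1 := by
      filter_upwards [hpos, hle1] with x h1 h2
      rw [h1]
      exact ⟨le_max_right _ _, max_le (h2 k) zero_le_one⟩
    have h1 := hA.apply_mono (hFb k) (g := Lp.posPart (F k)) ⟨1, hP01.mono fun x hx => by
      rw [abs_of_nonneg hx.1]; exact hx.2⟩ (hpos.mono fun x hx => by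
        rw [hx]; exact le_max_left _ _)
    filter_upwards [h1, hA _ hP01] with x h2 h3 using h2.trans h3.2
  -- The functions `A (F k)` increase and stay below 1. Their integrals over `B` are `∫ F_k A* 1_B`,
  -- with limit `∫ A* 1_B = μ(B)` by mass preservation, which forces the limit 1 on `B`.
  have key : ∀ B : Set E, MeasurableSet B → μ B < ∞ →
      ∀ᵐ x ∂μ.restrict B, Tendsto (fun k => A (F k) x) atTop (𝓝 1) := by
    intro B hB hμB
    have hfin : IsFiniteMeasure (μ.restrict B) := isFiniteMeasure_restrict.2 hμB.ne
    refine tendsto_of_integral_tendsto_of_monotone (F := fun _ => (1 : ℝ))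
      (fun k => integrableOn_Lp_of_measure_ne_top _ fact_one_le_two_ennreal.elim hμB.ne)
      (integrable_const _) ?_ (ae_restrict_of_ae hmono) (ae_restrict_of_ae hbd)
    set b : Lp ℝ 2 μ := indicatorConstLp 2 hB hμB.ne (1 : ℝ) with hb
    have hb0 := indicatorConstLp_one_bounds hB hμB.ne
    have hg0 := hA.adjoint_nonneg (hb0.mono fun x hx => hx.1)
    set g := ContinuousLinearMap.adjoint A b with hg
    have hbi : ∫ x, b x ∂μ = μ.real B := by
      rw [integral_congr_ae (indicatorConstLp_coeFn (p := 2) (hs := hB) (hμs := hμB.ne)),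
        integral_indicator hB, integral_const, measureReal_restrict_apply_univ, smul_eq_mul, mul_one]
    have hbint : Integrable b μ := by
      refine (integrable_congr (indicatorConstLp_coeFn (p := 2) (hs := hB) (hμs := hμB.ne))).2 ?_
      exact (integrable_indicator_iff hB).2 (integrable_const _)
    have hgl : ∫⁻ x, ENNReal.ofReal (g x) ∂μ = ENNReal.ofReal (μ.real B) := by
      rw [hmass b (hb0.mono fun x hx => hx.1), ← hbi,
        ofReal_integral_eq_lintegral_ofReal hbint (hb0.mono fun x hx => hx.1)]
    have hgint : Integrable g μ := by
      refine ⟨Lp.aestronglyMeasurable _, ?_⟩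
      rw [hasFiniteIntegral_iff_ofReal hg0, hgl]
      exact ENNReal.ofReal_lt_top
    have hgi : ∫ x, g x ∂μ = μ.real B := by
      rw [integral_eq_lintegral_of_nonneg_ae hg0 hgint.1, hgl,
        ENNReal.toReal_ofReal measureReal_nonneg]
    have h1 : ∫ _ in B, (1 : ℝ) ∂μ = ∫ x, 1 * g x ∂μ := by
      simp only [one_mul]
      rw [hgi, integral_const, measureReal_restrict_apply_univ, smul_eq_mul, mul_one]
    rw [h1]
    simp only [fun k => setIntegral_eq_integral_mul_adjoint A (F k) hB hμB.ne]
    -- Domination holds because `F_0 ≤ F_k ≤ 1`.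
    refine tendsto_integral_of_dominated_convergence (fun x => |F 0 x * g x| + g x)
      (fun k => (Lp.integrable_mul _ _).1) ((Lp.integrable_mul _ _).abs.add hgint) (fun k => ?_) ?_
    · filter_upwards [hF, hle1, hg0] with x h2 h3 h4
      have h5 := h2.1 (Nat.zero_le k)
      have h6 := h3 k
      have h4' : 0 ≤ g x := h4
      rw [Real.norm_eq_abs, abs_mul, abs_mul, abs_of_nonneg h4', ← add_one_mul]
      refine mul_le_mul_of_nonneg_right (abs_le.2 ⟨?_, ?_⟩) h4'
      · simp only at h5
        linarith [neg_abs_le (F 0 x)]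
      · linarith [abs_nonneg (F 0 x)]
    · filter_upwards [hF] with x h2 using h2.2.mul_const _
  exact ae_of_forall_measure_lt_top_ae_restrict _ key

/-! ### Semigroups -/

variable {T : ℝ → Lp ℝ 2 μ →L[ℝ] Lp ℝ 2 μ}

omit [SigmaFinite μ] in
theorem IsC0ContractionSemigroup.adj_add (hT : IsC0ContractionSemigroup T) {s r : ℝ} (hs : 0 ≤ s)
    (hr : 0 ≤ r) (g : Lp ℝ 2 μ) : adj T (s + r) g = adj T s (adj T r g) := by
  unfold adj
  rw [add_comm s r, hT.add r s hr hs, ContinuousLinearMap.adjoint_comp,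
    ContinuousLinearMap.comp_apply]

variable (hT : IsC0ContractionSemigroup T) (hTsub : ∀ s : ℝ, 0 ≤ s → IsSubMarkovian (T s))
include hT hTsub

/-- The mass is non-increasing along the adjoint semigroup, so equality at time `t` forces equality
at every earlier time. -/
theorem preservesMass_adj_of_le {t r : ℝ} (hr : 0 ≤ r) (hrt : r ≤ t)
    (h : PreservesMass (adj T t)) : PreservesMass (adj T r) := fun g hg => by
  have h1 := (hTsub r hr).adjoint_nonneg hg
  refine le_antisymm ((hTsub r hr).lintegral_adjoint_le hg) ?_
  rw [← h g hg, ← sub_add_cancel t r, hT.adj_add (sub_nonneg.2 hrt) hr]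
  exact (hTsub _ (sub_nonneg.2 hrt)).lintegral_adjoint_le h1

theorem preservesMass_adj_nat_mul {r : ℝ} (hr : 0 ≤ r) (h : PreservesMass (adj T r)) (n : ℕ) :
    PreservesMass (adj T (n * r)) := by
  induction n with
  | zero => exact preservesMass_adj_of_le hT hTsub (by simp) (by simpa using hr) h
  | succ n ih =>
    intro g hg
    have h1 : ((n + 1 : ℕ) : ℝ) * r = n * r + r := by push_cast; ring
    rw [h1, hT.adj_add (by positivity) hr, ih (adj T r g) ((hTsub r hr).adjoint_nonneg hg),
      h g hg]

/-- Mass preservation of the adjoint at a single time gives conservativeness. -/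
theorem conservative_of_preservesMass_adj {t : ℝ} (ht : 0 < t) (h : PreservesMass (adj T t)) :
    Conservative T := fun r hr => by
  obtain ⟨n, hn⟩ := exists_nat_gt (r / t)
  have hn0 : (0 : ℝ) < n := (div_pos hr ht).trans hn
  have h1 : r / n ≤ t := by
    rw [div_lt_iff₀ ht] at hn
    rw [div_le_iff₀ hn0]
    linarith
  have h2 := preservesMass_adj_nat_mul hT hTsub (div_nonneg hr.le hn0.le)
    (preservesMass_adj_of_le hT hTsub (div_nonneg hr.le hn0.le) h1 h) n
  rw [mul_div_cancel₀ _ hn0.ne'] at h2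
  exact (hTsub r hr.le).monotoneExtensionMaps_one h2

end Duality
-- Mass preservation for signed functions
section Signed

variable {E : Type*} [MeasurableSpace E] {μ : Measure E}

theorem PreservesMass.integral_eq_of_nonneg {A : Lp ℝ 2 μ →L[ℝ] Lp ℝ 2 μ} (hA : PreservesMass A)
    (hpos : ∀ g : Lp ℝ 2 μ, (∀ᵐ x ∂μ, 0 ≤ g x) → ∀ᵐ x ∂μ, 0 ≤ A g x) {g : Lp ℝ 2 μ}
    (hg : ∀ᵐ x ∂μ, 0 ≤ g x) (hgi : Integrable g μ) :
    Integrable (A g) μ ∧ ∫ x, A g x ∂μ = ∫ x, g x ∂μ := by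
  have h1 : Integrable (A g) μ := by
    refine ⟨Lp.aestronglyMeasurable _, ?_⟩
    rw [hasFiniteIntegral_iff_ofReal (hpos g hg), hA g hg]
    exact (hasFiniteIntegral_iff_ofReal hg).1 hgi.2
  refine ⟨h1, ?_⟩
  rw [integral_eq_lintegral_of_nonneg_ae (hpos g hg) h1.1, hA g hg,
    integral_eq_lintegral_of_nonneg_ae hg hgi.1]

theorem PreservesMass.integral_eq {A : Lp ℝ 2 μ →L[ℝ] Lp ℝ 2 μ} (hA : PreservesMass A)
    (hpos : ∀ g : Lp ℝ 2 μ, (∀ᵐ x ∂μ, 0 ≤ g x) → ∀ᵐ x ∂μ, 0 ≤ A g x) {f : Lp ℝ 2 μ}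
    (hf : Integrable f μ) : Integrable (A f) μ ∧ ∫ x, A f x ∂μ = ∫ x, f x ∂μ := by
  have hp := Lp.coeFn_posPart f
  have hn : Lp.negPart f =ᵐ[μ] fun x => max (-f x) 0 := Lp.coeFn_negPart_eq_max f
  have hpi : Integrable (Lp.posPart f) μ := hf.pos_part.congr hp.symm
  have hni : Integrable (Lp.negPart f) μ := hf.neg_part.congr hn.symm
  obtain ⟨h1, h2⟩ := hA.integral_eq_of_nonneg hpos
    (hp.mono fun x hx => by rw [hx]; exact le_max_right _ _) hpi
  obtain ⟨h3, h4⟩ := hA.integral_eq_of_nonneg hpos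
    (hn.mono fun x hx => by rw [hx]; exact le_max_right _ _) hni
  have hsub : f = Lp.posPart f - Lp.negPart f := by
    refine Lp.ext ?_
    filter_upwards [hp, hn, Lp.coeFn_sub (Lp.posPart f) (Lp.negPart f)] with x h5 h6 h7
    rw [h7, Pi.sub_apply, h5, h6]
    exact (max_zero_sub_max_neg_zero_eq_self _).symm
  have hAe : A f =ᵐ[μ] fun x => A (Lp.posPart f) x - A (Lp.negPart f) x := by
    conv_lhs => rw [hsub, map_sub]
    exact Lp.coeFn_sub _ _
  have hfe : f =ᵐ[μ] fun x => Lp.posPart f x - Lp.negPart f x := by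
    conv_lhs => rw [hsub]
    exact Lp.coeFn_sub _ _
  refine ⟨(h1.sub h3).congr hAe.symm, ?_⟩
  rw [integral_congr_ae hAe, integral_congr_ae hfe, integral_sub h1 h3, integral_sub hpi hni, h2, h4]

end Signed

/-! ### Mass preservation for `T̂_t` -/

section Conclusion

variable {E : Type*} [MetricSpace E] [LocallyCompactSpace E] [SecondCountableTopology E]
  [MeasurableSpace E] [BorelSpace E] {μ : Measure E} [IsFiniteMeasureOnCompacts μ]
  {𝓔 : SymmDirichletForm μ}

namespace SymmDirichletForm

variable (Γ : 𝓔.CarreDuChamp) (hreg : 𝓔.IsRegular) (hloc : 𝓔.IsStronglyLocal)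
  {N : Lp ℝ 2 μ →ₗ.[ℝ] (E →ₘ[μ] ℝ)} (hN : 𝓔.IsDivFreeDerivation N)
  {ρ : E → ℝ} (hρ : 𝓔.IsExhaustion ρ)
  {φ : ℝ → ℝ} (hφ : IsAdmissible φ) {K₀ : Set E} (hΓρ : LocEssBddOff μ K₀ (Γ.gammaLoc hρ))
  (hNρ : LocEssBddOff μ K₀ (hN.nLoc hρ)) {k : ℕ} (hk : K₀ ⊆ sublevel ρ k)
  {T : ℝ → Lp ℝ 2 μ →L[ℝ] Lp ℝ 2 μ} (hTsub : ∀ s : ℝ, 0 ≤ s → IsSubMarkovian (T s))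
  {τ : ℝ} (hτ : 0 < τ) (hcrit : Criterion μ ρ (Γ.gammaLoc hρ) (hN.nLoc hρ) φ τ k)
  {p : ℝ≥0∞} [Fact (1 ≤ p)]
  {S : ∀ n : ℕ, ℝ → Lp ℝ p (μ.restrict (V ρ n)) →L[ℝ] Lp ℝ p (μ.restrict (V ρ n))}
  {t : ℝ} (ht : 0 < t) (hH1 : LocallyApproximates S T t) (hH2 : LocallyRepresents S Γ hN)

include hreg hloc hφ hΓρ hNρ hk hTsub hτ hcrit ht hH1 hH2 in
-- Tightness after `r` steps of length `t / r ≤ τ`, used on the single domain `V_J`, bounds the mass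
-- of the local evolution from below by `∫ f - ε`. The local evolutions increase to `T̂_t f`, so
-- `T̂_t f` inherits the bound; the opposite inequality is contractivity of the adjoint.
theorem lintegral_adj_eq_of_bdd {f : Lp ℝ 2 μ} {M : ℝ} (hM : 0 < M)
    (hf : ∀ᵐ x ∂μ, 0 ≤ f x ∧ f x ≤ M) {k' : ℕ} (hfk : ∀ᵐ x ∂μ, x ∉ sublevel ρ k' → f x = 0) :
    ∫⁻ x, ENNReal.ofReal (adj T t f x) ∂μ = ∫⁻ x, ENNReal.ofReal (f x) ∂μ := by
  have hf0 : ∀ᵐ x ∂μ, 0 ≤ f x := hf.mono fun x hx => hx.1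
  have hT0 : ∀ᵐ x ∂μ, 0 ≤ adj T t f x := (hTsub t ht.le).adjoint_nonneg hf0
  have hint : Integrable f μ :=
    (integrableOn_Lp_of_measure_ne_top f fact_one_le_two_ennreal.elim
      (hρ.measure_sublevel_lt_top k').ne).integrable_of_ae_notMem_eq_zero hfk
  have hbd : EssBdd μ f := ⟨M, hf.mono fun x hx => by rw [abs_of_nonneg hx.1]; exact hx.2⟩
  refine le_antisymm ((hTsub t ht.le).lintegral_adjoint_le hf0) ?_
  rw [← ofReal_integral_eq_lintegral_ofReal hint hf0]
  obtain ⟨r, hr⟩ := exists_nat_gt (t / τ)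
  have hr0 : (0 : ℝ) < r := (div_pos ht hτ).trans hr
  have hsτ : t / r ≤ τ := by
    rw [div_lt_iff₀ hτ] at hr
    rw [div_le_iff₀ hr0]
    linarith
  have key : ∀ ε : ℝ, 0 < ε →
      ENNReal.ofReal (∫ x, f x ∂μ - ε) ≤ ∫⁻ x, ENNReal.ofReal (adj T t f x) ∂μ := by
    intro ε hε
    obtain ⟨J, hJ, hJf⟩ := exists_tight Γ hreg hloc hN hρ hφ hΓρ hNρ hk hτ hcrit hH1.semigroup
      hH1.subMarkovian hH2 hM (div_nonneg ht.le hr0.le) hsτ k' r ε hε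
    have hfin : IsFiniteMeasure (μ.restrict (V ρ J)) :=
      isFiniteMeasure_restrict.2 (hρ.measure_sublevel_lt_top _).ne
    have hmeas : MeasurableSet (V ρ J) := (isOpen_sublevel hρ.continuous _).measurableSet
    have hmem : MemLp f p (μ.restrict (V ρ J)) :=
      MemLp.of_bound (Lp.aestronglyMeasurable f).restrict M (ae_restrict_of_ae (by
        filter_upwards [hf] with x hx
        rw [Real.norm_eq_abs, abs_of_nonneg hx.1]; exact hx.2))
    set g := restrictLp μ p (V ρ J) f with hg
    have hge : g =ᵐ[μ.restrict (V ρ J)] f := by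
      rw [hg, restrictLp, dif_pos hmem]
      exact hmem.coeFn_toLp
    have h1 := hJf J le_rfl g (by
      filter_upwards [hge, ae_restrict_of_ae hf] with x h2 h3
      rwa [h2]) (by
      filter_upwards [hge, ae_restrict_of_ae hfk] with x h2 h3
      rwa [h2])
    rw [mul_div_cancel₀ _ hr0.ne', Measure.restrict_restrict hmeas, inter_self,
      integral_congr_ae hge, setIntegral_eq_integral_of_ae_compl_eq_zero (by
        filter_upwards [hfk] with x hx hxJ
        refine hx fun hxk => hxJ ?_
        have h2 : ρ x < k' := hxk
        have h3 : (k' : ℝ) ≤ J := by exact_mod_cast (by omega : k' ≤ J)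
        have h4 : (0 : ℝ) ≤ J := Nat.cast_nonneg J
        change ρ x < 4 * J
        linarith)] at h1
    have hTi : IntegrableOn (adj T t f) (V ρ J) μ :=
      integrableOn_Lp_of_measure_ne_top _ fact_one_le_two_ennreal.elim
        (hρ.measure_sublevel_lt_top _).ne
    have h2 : ∫ x in V ρ J, S J t g x ∂μ ≤ ∫ x in V ρ J, adj T t f x ∂μ := by
      refine integral_mono_ae (Lp.integrable_of_isFiniteMeasure _) hTi ?_
      filter_upwards [ae_restrict_of_ae (hH1.increases f hint hbd hf0), ae_restrict_mem hmeas]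
        with x h3 h4
      have h5 := ge_of_tendsto h3.2 ((eventually_ge_atTop J).mono fun n hn =>
        h3.1 (show 1 ≤ J by omega) (show 1 ≤ n by omega) hn)
      simp only at h5
      rwa [indicator_of_mem h4] at h5
    calc ENNReal.ofReal (∫ x, f x ∂μ - ε) ≤ ENNReal.ofReal (∫ x in V ρ J, adj T t f x ∂μ) :=
          ENNReal.ofReal_le_ofReal (h1.trans h2)
      _ = ∫⁻ x in V ρ J, ENNReal.ofReal (adj T t f x) ∂μ :=
          ofReal_integral_eq_lintegral_ofReal hTi (ae_restrict_of_ae hT0)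
      _ ≤ _ := setLIntegral_le_lintegral _ _
  have hlim : Tendsto (fun ε : ℝ => ENNReal.ofReal (∫ x, f x ∂μ - ε)) (𝓝[>] 0)
      (𝓝 (ENNReal.ofReal (∫ x, f x ∂μ - 0))) :=
    ((ENNReal.continuous_ofReal.comp (continuous_const.sub continuous_id)).tendsto 0).mono_left
      nhdsWithin_le_nhds
  rw [sub_zero] at hlim
  exact le_of_tendsto hlim (eventually_mem_nhdsWithin.mono fun ε hε => key ε hε)

include hreg hloc hφ hΓρ hNρ hk hTsub hτ hcrit ht hH1 hH2 in
-- The functions `1_{V_j} min(g, j)` lie below `g`, are bounded and vanish off `V_j`; positivity and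
-- Fatou's lemma pass from them to `g`.
theorem preservesMass_adj : PreservesMass (adj T t) := by
  intro g hg
  refine le_antisymm ((hTsub t ht.le).lintegral_adjoint_le hg) ?_
  have hmeas : ∀ j : ℕ, MeasurableSet (V ρ j) := fun j =>
    (isOpen_sublevel hρ.continuous _).measurableSet
  have hGm : ∀ j : ℕ, AEStronglyMeasurable ((V ρ j).indicator fun x => min (g x) j) μ := fun j =>
    ((Lp.aestronglyMeasurable g).inf aestronglyMeasurable_const).indicator (hmeas j)
  have hG : ∀ j : ℕ, ∀ᵐ x ∂μ, 0 ≤ (V ρ j).indicator (fun x => min (g x) j) x ∧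
      (V ρ j).indicator (fun x => min (g x) j) x ≤ g x ∧
      (V ρ j).indicator (fun x => min (g x) j) x ≤ j := fun j => by
    filter_upwards [hg] with x hx
    by_cases h : x ∈ V ρ j
    · rw [indicator_of_mem h]
      exact ⟨le_min hx j.cast_nonneg, min_le_left _ _, min_le_right _ _⟩
    · rw [indicator_of_notMem h]
      exact ⟨le_rfl, hx, j.cast_nonneg⟩
  have hmem : ∀ j : ℕ, MemLp ((V ρ j).indicator fun x => min (g x) j) 2 μ := fun j =>
    (Lp.memLp g).mono (hGm j) (by
      filter_upwards [hG j] with x hx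
      rw [Real.norm_eq_abs, Real.norm_eq_abs, abs_of_nonneg hx.1]
      exact hx.2.1.trans (le_abs_self _))
  have hle : ∀ j : ℕ, ∫⁻ x, ENNReal.ofReal ((V ρ j).indicator (fun x => min (g x) j) x) ∂μ ≤
      ∫⁻ x, ENNReal.ofReal (adj T t g x) ∂μ := fun j => by
    obtain ⟨q, hj⟩ : ∃ q : Lp ℝ 2 μ, q =ᵐ[μ] (V ρ j).indicator fun x => min (g x) j :=
      ⟨(hmem j).toLp, (hmem j).coeFn_toLp⟩
    have h1 := lintegral_adj_eq_of_bdd Γ hreg hloc hN hρ hφ hΓρ hNρ hk hTsub hτ hcrit ht hH1 hH2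
      (f := q) (M := j + 1) (by positivity) (by
        filter_upwards [hj, hG j] with x h1 h2
        rw [h1]
        exact ⟨h2.1, h2.2.2.trans (by linarith)⟩) (k' := 4 * j) (by
        filter_upwards [hj] with x h1 h2
        rw [h1]
        refine indicator_of_notMem (fun h3 => h2 ?_) _
        change ρ x < ((4 * j : ℕ) : ℝ)
        push_cast
        exact h3)
    have h2 : ∫⁻ x, ENNReal.ofReal (q x) ∂μ =
        ∫⁻ x, ENNReal.ofReal ((V ρ j).indicator (fun x => min (g x) j) x) ∂μ :=
      lintegral_congr_ae (hj.mono fun x hx => by simp only [hx])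
    rw [← h2, ← h1]
    refine lintegral_mono_ae ?_
    have h3 := (hTsub t ht.le).adjoint_nonneg (g := g - q) (by
      filter_upwards [hj, hG j, Lp.coeFn_sub g q] with x h4 h5 h6
      rw [h6, Pi.sub_apply, h4]
      exact sub_nonneg.2 h5.2.1)
    filter_upwards [h3, Lp.coeFn_sub (adj T t g) (adj T t q)] with x h4 h5
    rw [map_sub] at h4
    change 0 ≤ (adj T t g - adj T t q : Lp ℝ 2 μ) x at h4
    rw [h5, Pi.sub_apply] at h4
    exact ENNReal.ofReal_le_ofReal (sub_nonneg.1 h4)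
  have hlim : ∀ x, Tendsto
      (fun j : ℕ => ENNReal.ofReal ((V ρ j).indicator (fun x => min (g x) j) x)) atTop
        (𝓝 (ENNReal.ofReal (g x))) := fun x => by
    refine tendsto_const_nhds.congr' ?_
    obtain ⟨j0, hj0⟩ := exists_nat_gt (max (ρ x) (g x))
    filter_upwards [eventually_ge_atTop j0] with j hj
    have h1 : (j0 : ℝ) ≤ j := by exact_mod_cast hj
    have h2 := (max_lt_iff.1 hj0)
    have h3 : x ∈ V ρ j := by
      change ρ x < 4 * j
      have : (0 : ℝ) ≤ j := j.cast_nonneg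
      linarith [h2.1]
    rw [indicator_of_mem h3, min_eq_left (by linarith [h2.2])]
  calc ∫⁻ x, ENNReal.ofReal (g x) ∂μ = ∫⁻ x, liminf (fun j : ℕ =>
        ENNReal.ofReal ((V ρ j).indicator (fun x => min (g x) j) x)) atTop ∂μ :=
        lintegral_congr fun x => ((hlim x).liminf_eq).symm
    _ ≤ liminf (fun j : ℕ => ∫⁻ x, ENNReal.ofReal
        ((V ρ j).indicator (fun x => min (g x) j) x) ∂μ) atTop :=
        lintegral_liminf_le' fun j => (hGm j).aemeasurable.ennreal_ofReal
    _ ≤ _ := liminf_le_of_frequently_le' (Eventually.of_forall hle).frequently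

omit [LocallyCompactSpace E] [IsFiniteMeasureOnCompacts μ] [SecondCountableTopology E]
  [BorelSpace E] in
-- `ρ` is bounded on the compact sets involved, so the defining set of indices is non-empty and the
-- infimum is attained rather than being the default 0.
theorem kIndex_spec {ρ : E → ℝ} (hρ : Continuous ρ) {K : Set E} (hK : IsCompact K) {f : E → ℝ}
    (hf : IsCompact (supp μ f)) :
    supp μ f ⊆ sublevel ρ (kIndex μ ρ K f) ∧ K ⊆ sublevel ρ (kIndex μ ρ K f) := by
  have hne : {m : ℕ | 1 ≤ m ∧ supp μ f ⊆ sublevel ρ m ∧ K ⊆ sublevel ρ m}.Nonempty := by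
    obtain ⟨C, hC⟩ := (hf.union hK).exists_bound_of_continuousOn hρ.continuousOn
    obtain ⟨m, hm⟩ := exists_nat_gt (max C 1)
    have h1 := max_lt_iff.1 hm
    have h2 : ∀ x ∈ supp μ f ∪ K, x ∈ sublevel ρ m := fun x hx =>
      lt_of_le_of_lt ((le_abs_self _).trans (hC x hx)) h1.1
    refine ⟨m, ?_, fun x hx => h2 x (Or.inl hx), fun x hx => h2 x (Or.inr hx)⟩
    exact_mod_cast h1.2.le
  exact (Nat.sInf_mem hne).2

end SymmDirichletForm
end Conclusion
end DivFreePerturbation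

end

open DivFreePerturbation in
theorem theorem2
    {E : Type*} [MetricSpace E] [LocallyCompactSpace E] [TopologicalSpace.SeparableSpace E]
    [MeasurableSpace E] [BorelSpace E]
    (μ : Measure E) [IsFiniteMeasureOnCompacts μ] [μ.IsOpenPosMeasure]
    -- the semigroup `(T_t)` on `L²(E, μ)`
    (T : ℝ → Lp ℝ 2 μ →L[ℝ] Lp ℝ 2 μ) (hT : IsC0ContractionSemigroup T)
    (hTsub : ∀ s : ℝ, 0 ≤ s → IsSubMarkovian (T s))
    -- the strongly local regular symmetric Dirichlet form, its carré du champ, and `N`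
    (𝓔 : SymmDirichletForm μ) (hreg : 𝓔.IsRegular) (hloc : 𝓔.IsStronglyLocal)
    (Γ : 𝓔.CarreDuChamp)
    (N : Lp ℝ 2 μ →ₗ.[ℝ] (E →ₘ[μ] ℝ)) (hN : 𝓔.IsDivFreeDerivation N)
    -- the exhaustion function
    (ρ : E → ℝ) (hρ : 𝓔.IsExhaustion ρ) (K₀ : Set E) (hK₀ : IsCompact K₀)
    (hΓρ : LocEssBddOff μ K₀ (Γ.gammaLoc hρ)) (hNρ : LocEssBddOff μ K₀ (hN.nLoc hρ))
    -- the local semigroups on `V_n = {ρ < 4n}`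
    (t : ℝ) (ht : 0 < t) (p : ℝ≥0∞) [Fact (1 ≤ p)] (hp : p = 1 ∨ p = 2)
    (S : ∀ n : ℕ, ℝ → Lp ℝ p (μ.restrict (V ρ n)) →L[ℝ] Lp ℝ p (μ.restrict (V ρ n)))
    (hH1 : LocallyApproximates S T t) (hH2 : LocallyRepresents S Γ hN)
    -- the compact set in the definition of `k_f`
    (K : Set E) (hK : IsCompact K) (hK₀K : K₀ ⊆ K) :
    (∀ f ∈ D0 S K t, ∀ φ : ℝ → ℝ, IsAdmissible φ → ∀ τ : ℝ, 0 < τ →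
      Criterion μ ρ (Γ.gammaLoc hρ) (hN.nLoc hρ) φ τ (kIndex μ ρ K f) →
      Integrable (adj T t f) μ ∧ ∫ x, adj T t f x ∂μ = ∫ x, f x ∂μ) ∧
    (∀ f ∈ D0 S K t, ∀ φ : ℝ → ℝ, IsAdmissible φ → ∀ τ : ℝ, 0 < τ →
      Criterion μ ρ (Γ.gammaLoc hρ) (hN.nLoc hρ) φ τ (kIndex μ ρ K f) →
      (∀ g ∈ D0 S K t,
        Criterion μ ρ (Γ.gammaLoc hρ) (hN.nLoc hρ) φ τ (kIndex μ ρ K g)) ∧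
      (Dense {h : Lp ℝ 1 μ | ∃ f ∈ D0 S K t, h =ᵐ[μ] f} → Conservative T)) := by
  have : SecondCountableTopology E := UniformSpace.secondCountable_of_separable E
  have hindex : ∀ f ∈ D0 S K t, supp μ f ⊆ sublevel ρ (kIndex μ ρ K f) ∧
      K₀ ⊆ sublevel ρ (kIndex μ ρ K f) := fun f hf => by
    have h := SymmDirichletForm.kIndex_spec hρ.continuous hK hf.2.1
    exact ⟨h.1, hK₀K.trans h.2⟩
  -- `f` enters the criterion only through the index `k_f`, so a single triple gives mass
  -- preservation for all non-negative functions.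
  have hmass : ∀ f ∈ D0 S K t, ∀ φ : ℝ → ℝ, IsAdmissible φ → ∀ τ : ℝ, 0 < τ →
      Criterion μ ρ (Γ.gammaLoc hρ) (hN.nLoc hρ) φ τ (kIndex μ ρ K f) →
      PreservesMass (adj T t) := fun f hf φ hφ τ hτ hcrit =>
    SymmDirichletForm.preservesMass_adj Γ hreg hloc hN hρ hφ hΓρ hNρ (hindex f hf).2 hTsub hτ hcrit
      ht hH1 hH2
  refine ⟨fun f hf φ hφ τ hτ hcrit => ?_, fun f hf φ hφ τ hτ hcrit => ⟨fun g hg => ?_, fun _ => ?_⟩⟩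
  -- A function in `L²` that vanishes off a set of finite measure is integrable; the compact support
  -- is such a set.
  · have hfi : Integrable f μ :=
      (integrableOn_Lp_of_measure_ne_top f fact_one_le_two_ennreal.elim
        hf.2.1.measure_lt_top.ne).integrable_of_ae_notMem_eq_zero
          (ae_eq_zero_of_notMem_supp (Lp.aestronglyMeasurable f).aemeasurable)
    exact (hmass f hf φ hφ τ hτ hcrit).integral_eq
      (fun g hg => (hTsub t ht.le).adjoint_nonneg hg) hfi
  · exact SymmDirichletForm.Criterion.of_index Γ hreg hloc hN hρ hφ hΓρ hNρ (hindex f hf).2 hτ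
      (hindex g hg).2 hcrit
  · exact conservative_of_preservesMass_adj hT hTsub ht (hmass f hf φ hφ τ hτ hcrit)
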